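/- **Setting.** Let $\Lambda$ be a left noetherian ring and $E\subseteq\Lambda$ a semisimple artinian subring (with the same unit). Write $\bar\Lambda=\Lambda/E$, an $E$-$E$-bimodule, $\bar a$ for the class of $a\in\Lambda$, and $\otimes=\otimes_E$. Modules are left modules and complexes are unbounded cochain complexes of $\Lambda$-modules; $\Sigma$ is the suspension. Let $s\bar\Lambda$ be $\bar\Lambda$ placed in degree $-1$, and write $s\bar a_{i,j}=s\bar a_i\otimes\cdots\otimes s\bar a_j$. For a complex $X$ let $\Omega_{\rm nc}(X)=s\bar\Lambda\otimes X$, with differential $s\bar a\otimes x\mapsto -s\bar a\otimes d(x)$ and $\Lambda$-action $b\blacktriangleright(s\bar a\otimes x)=s\overline{ba}\otimes x-s\bar b\otimes ax$; it is a complex of $\Lambda$-modules, and $\Omega_{\rm nc}^p$ denotes the $p$-th iterate. For complexes $X,Y$ let $\mathcal Y(X,Y)=\prod_{q\ge 0}\mathcal Y_q(X,Y)$, with $\mathcal Y_q(X,Y)={\rm Hom}_E((s\bar\Lambda)^{\otimes q}\otimes X,Y)$ the graded group of homogeneous $E$-linear maps (the product being taken degreewise), and with differential $\delta=\delta_{\rm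 in}+\delta_{\rm ex}$, where for $f\in\mathcal Y_q(X,Y)$ homogeneous of degree $|f|$ the map $\delta_{\rm in}(f)\in\mathcal Y_q(X,Y)$ is given by $$\delta_{\rm in}(f)(s\bar a_{1,q}\otimes x)=d_Y\big(f(s\bar a_{1,q}\otimes x)\big)-(-1)^{|f|+q}f(s\bar a_{1,q}\otimes d_X(x)),$$ and $\delta_{\rm ex}(f)\in\mathcal Y_{q+1}(X,Y)$ by $$\delta_{\rm ex}(f)(s\bar a_{1,q+1}\otimes x)=(-1)^{|f|+1}a_1f(s\bar a_{2,q+1}\otimes x)+(-1)^{|f|+q}f(s\bar a_{1,q}\otimes a_{q+1}x)+\sum_{i=1}^{q}(-1)^{|f|+i+1}f(s\bar a_{1,i-1}\otimes s\overline{a_ia_{i+1}}\otimes s\bar a_{i+2,q+1}\otimes x).$$ There are maps of complexes $\mathcal Y(X,Y)\to\mathcal Y(X,\Omega_{\rm nc}(Y))$ sending $f\in\mathcal Y_q(X,Y)$ to $$\big(s\bar a_{1,q+1}\otimes x\mapsto(-1)^{|f|}s\bar a_1\otimes f(s\bar a_{2,q+1}\otimes x)\big)\in\mathcal Y_{q+1}(X,\Omega_{\rm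 nc}(Y)).$$ Put $$\mathcal{SY}(X,Y)={\rm colim}\big(\mathcal Y(X,Y)\to\mathcal Y(X,\Omega_{\rm nc}(Y))\to\mathcal Y(X,\Omega_{\rm nc}^2(Y))\to\cdots\big),$$ and write $[f;p]$ for the class of $f\in\mathcal Y(X,\Omega^p_{\rm nc}(Y))$. For the stalk complex $\Lambda$ in degree zero, the right multiplication of $\Lambda$ on itself makes $\mathcal{SY}(\Lambda,X)$ a complex of (left) $\Lambda$-modules, and $X\mapsto\mathcal{SY}(\Lambda,X)$ is a functor from complexes of $\Lambda$-modules to complexes of $\Lambda$-modules. **Statement.** 1. For every complex $X$ of $\Lambda$-modules, $\mathcal{SY}(\Lambda,X)$ is an acyclic complex, and all its terms are injective $\Lambda$-modules. 2. For every acyclic complex $X$ of $\Lambda$-modules, the complex $\mathcal{SY}(\Lambda,X)$ of $\Lambda$-modules is contractible, i.e. its identity is null-homotopic through $\Lambda$-linear maps. 3. Consequently, $\mathcal{SY}(\Lambda,-)$ induces a triangle functor $$\mathcal{SY}(\Lambda,-)\colon\mathbf D(\Lambda\text{-Mod})\longrightarrow\mathbf K_{\rm ac}(\Lambda\text{-Inj}),$$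 where $\mathbf K_{\rm ac}(\Lambda\text{-Inj})$ is the homotopy category of acyclic complexes of injective $\Lambda$-modules, viewed as a full triangulated subcategory of $\mathbf K(\Lambda\text{-Mod})$. That is, there is a functor $F\colon\mathbf D(\Lambda\text{-Mod})\to\mathbf K_{\rm ac}(\Lambda\text{-Inj})$ that commutes with suspension and preserves exact triangles, together with a natural isomorphism in $\mathbf K(\Lambda\text{-Mod})$ between $F(X)$ and $\mathcal{SY}(\Lambda,X)$, for $X$ in the category of complexes of $\Lambda$-modules, under which the suspension isomorphism $F(\Sigma X)\simeq\Sigma F(X)$ corresponds to the canonical map $\mathcal{SY}(\Lambda,\Sigma X)\to\Sigma\,\mathcal{SY}(\Lambda,X)$, $[f;p]\mapsto[(-1)^pf;p]$ (with the underlying graded modules of $\Omega_{\rm nc}^p(\Sigma X)$ and $\Sigma\,\Omega^p_{\rm nc}(X)$ identified in the evident way). -/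

import Mathlib

open CategoryTheory Limits Pretriangulated
open scoped TensorProduct

universe w u

namespace SingularYoneda

noncomputable section

/-! ### The functor `M ↦ Λ̄ ⊗_E M` -/

section Module

variable {Λ : Type u} [Ring Λ] (E : Subring Λ)

/-- The subgroup of `(Λ / E) ⊗_ℤ M` generated by the elements `(a e)‾ ⊗ m - a‾ ⊗ (e m)`
with `a ∈ Λ`, `e ∈ E`, `m ∈ M`. -/
def balanced (M : Type u) [AddCommGroup M] [Module Λ M] :
    AddSubgroup ((Λ ⧸ E.toAddSubgroup) ⊗[ℤ] M) :=
  AddSubgroup.closure {t | ∃ (a : Λ) (e : E) (m : M),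
    t = ((a * (e : Λ) : Λ) : Λ ⧸ E.toAddSubgroup) ⊗ₜ[ℤ] m
      - (a : Λ ⧸ E.toAddSubgroup) ⊗ₜ[ℤ] (e • m)}

/-- The tensor product `Λ̄ ⊗_E M` over the (possibly noncommutative) ring `E`, where
`Λ̄ = Λ / E`. -/
def BarTensor (M : Type u) [AddCommGroup M] [Module Λ M] : Type u :=
  ((Λ ⧸ E.toAddSubgroup) ⊗[ℤ] M) ⧸ balanced E M

namespace BarTensor

variable (M : Type u) [AddCommGroup M] [Module Λ M]

instance : AddCommGroup (BarTensor E M) :=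
  inferInstanceAs (AddCommGroup (((Λ ⧸ E.toAddSubgroup) ⊗[ℤ] M) ⧸ balanced E M))

variable {M}

variable (M) in
/-- The projection `Λ̄ ⊗_ℤ M → Λ̄ ⊗_E M`. -/
def proj : (Λ ⧸ E.toAddSubgroup) ⊗[ℤ] M →+ BarTensor E M :=
  QuotientAddGroup.mk' (balanced E M)

lemma proj_surjective : Function.Surjective (proj E M) :=
  QuotientAddGroup.mk'_surjective (balanced E M)

/-- The element `ā ⊗ m` of `Λ̄ ⊗_E M`, as a biadditive function of `a` and `m`. -/
def tmul : Λ →+ M →+ BarTensor E M :=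
  AddMonoidHom.mk' (fun a => AddMonoidHom.mk'
      (fun m => proj E M ((a : Λ ⧸ E.toAddSubgroup) ⊗ₜ[ℤ] m))
      (fun m m' => by rw [TensorProduct.tmul_add, map_add]))
    (fun a a' => by
      ext m
      change proj E M _ = proj E M _ + proj E M _
      rw [QuotientAddGroup.mk_add, TensorProduct.add_tmul, map_add])

lemma tmul_coe (e : E) (m : M) : tmul E (e : Λ) m = 0 := by
  have : ((e : Λ) : Λ ⧸ E.toAddSubgroup) = 0 := (QuotientAddGroup.eq_zero_iff _).2 e.2
  change proj E M _ = 0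
  rw [this, TensorProduct.zero_tmul, map_zero]

lemma tmul_one (m : M) : tmul E (1 : Λ) m = 0 := tmul_coe E 1 m

lemma tmul_mul_coe (a : Λ) (e : E) (m : M) : tmul E (a * (e : Λ)) m = tmul E a (e • m) := by
  refine sub_eq_zero.1 ?_
  change proj E M _ - proj E M _ = 0
  rw [← map_sub]
  exact (QuotientAddGroup.eq_zero_iff _).2 (AddSubgroup.subset_closure ⟨a, e, m, rfl⟩)

variable {E}

@[elab_as_elim]
lemma induction_on {p : BarTensor E M → Prop} (t : BarTensor E M)
    (h₀ : p 0) (h₁ : ∀ (a : Λ) (m : M), p (tmul E a m))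
    (h₂ : ∀ x y, p x → p y → p (x + y)) : p t := by
  obtain ⟨t, rfl⟩ := proj_surjective E t
  induction t using TensorProduct.induction_on with
  | zero => rw [map_zero]; exact h₀
  | tmul x m =>
    obtain ⟨a, rfl⟩ := QuotientAddGroup.mk_surjective x
    exact h₁ a m
  | add x y hx hy => rw [map_add]; exact h₂ _ _ hx hy

/-- The universal property of `Λ̄ ⊗_E M`. -/
def lift {A : Type u} [AddCommGroup A] (φ : Λ →+ M →+ A) (h₀ : ∀ (e : E) (m : M), φ e m = 0)
    (h₁ : ∀ (a : Λ) (e : E) (m : M), φ (a * e) m = φ a (e • m)) : BarTensor E M →+ A :=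
  QuotientAddGroup.lift (balanced E M)
    (TensorProduct.liftAddHom
      (QuotientAddGroup.lift E.toAddSubgroup φ (fun e he => by ext m; exact h₀ ⟨e, he⟩ m))
      (fun n x m => by simp))
    (by
      rw [balanced, AddSubgroup.closure_le]
      rintro _ ⟨a, e, m, rfl⟩
      exact (map_sub _ _ _).trans (sub_eq_zero.2 (h₁ a e m)))

@[simp]
lemma lift_tmul {A : Type u} [AddCommGroup A] (φ : Λ →+ M →+ A) (h₀ h₁) (a : Λ) (m : M) :
    lift (E := E) φ h₀ h₁ (tmul E a m) = φ a m := rfl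

lemma addHom_ext {A : Type u} [AddCommGroup A] {f g : BarTensor E M →+ A}
    (h : ∀ (a : Λ) (m : M), f (tmul E a m) = g (tmul E a m)) : f = g := by
  ext t
  induction t using induction_on with
  | h₀ => simp
  | h₁ a m => exact h a m
  | h₂ x y hx hy => simp [hx, hy]

variable (E M)

/-- The action of `b ∈ Λ` on `Λ̄ ⊗_E M`, given by `b ▸ (ā ⊗ m) = (b a)‾ ⊗ m - b̄ ⊗ a m`. -/
def act (b : Λ) : BarTensor E M →+ BarTensor E M :=
  lift (AddMonoidHom.mk' (fun a => AddMonoidHom.mk'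
      (fun m => tmul E (b * a) m - tmul E b (a • m))
      (fun m m' => by simp only [map_add, smul_add]; abel))
    (fun a a' => by
      ext m
      simp only [AddMonoidHom.mk'_apply, mul_add, map_add, add_smul, AddMonoidHom.add_apply]
      abel))
    (fun e m => by simp [tmul_mul_coe, Subring.smul_def])
    (fun a e m => by simp [← mul_assoc, tmul_mul_coe, mul_smul, Subring.smul_def])

lemma act_tmul (b a : Λ) (m : M) :
    act E M b (tmul E a m) = tmul E (b * a) m - tmul E b (a • m) := rfl

instance : Module Λ (BarTensor E M) where
  smul b t := act E M b t
  one_smul t := by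
    change act E M 1 t = t
    induction t using induction_on with
    | h₀ => simp
    | h₁ a m => simp [act_tmul, tmul_one]
    | h₂ x y hx hy => simp [hx, hy]
  mul_smul b c t := by
    change act E M (b * c) t = act E M b (act E M c t)
    induction t using induction_on with
    | h₀ => simp
    | h₁ a m => simp [act_tmul, mul_assoc, mul_smul]
    | h₂ x y hx hy => simp [hx, hy]
  smul_zero b := map_zero (act E M b)
  smul_add b := map_add (act E M b)
  add_smul b c t := by
    change act E M (b + c) t = act E M b t + act E M c t
    induction t using induction_on with
    | h₀ => simp
    | h₁ a m => simp only [act_tmul, add_mul, map_add, AddMonoidHom.add_apply]; abel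
    | h₂ x y hx hy => simp only [map_add, hx, hy]; abel
  zero_smul t := by
    change act E M 0 t = 0
    induction t using induction_on with
    | h₀ => simp
    | h₁ a m => simp [act_tmul]
    | h₂ x y hx hy => simp [hx, hy]

variable {M}

lemma smul_tmul (b a : Λ) (m : M) :
    b • tmul E a m = tmul E (b * a) m - tmul E b (a • m) := rfl

lemma coe_smul_tmul (e : E) (a : Λ) (m : M) : e • tmul E a m = tmul E ((e : Λ) * a) m := by
  rw [Subring.smul_def, smul_tmul, tmul_coe, sub_zero]

variable {E}
variable {N P : Type u} [AddCommGroup N] [Module Λ N] [AddCommGroup P] [Module Λ P]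

lemma hom_ext {f g : BarTensor E M →ₗ[E] N}
    (h : ∀ (a : Λ) (m : M), f (tmul E a m) = g (tmul E a m)) : f = g := by
  have := addHom_ext (f := f.toAddMonoidHom) (g := g.toAddMonoidHom) h
  ext t
  exact DFunLike.congr_fun this t

lemma hom_ext' {f g : BarTensor E M →ₗ[Λ] N}
    (h : ∀ (a : Λ) (m : M), f (tmul E a m) = g (tmul E a m)) : f = g := by
  have := addHom_ext (f := f.toAddMonoidHom) (g := g.toAddMonoidHom) h
  ext t
  exact DFunLike.congr_fun this t

/-- The `E`-linear map `Id ⊗ f : Λ̄ ⊗_E M → Λ̄ ⊗_E N` induced by an `E`-linear map `f`. -/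
def map (f : M →ₗ[E] N) : BarTensor E M →ₗ[E] BarTensor E N where
  __ := lift (AddMonoidHom.mk' (fun a => (tmul E a).comp f.toAddMonoidHom)
      (fun a a' => by ext m; simp))
    (fun e m => by simp [tmul_coe])
    (fun a e m => by simp [tmul_mul_coe])
  map_smul' e t := by
    induction t using induction_on with
    | h₀ => simp
    | h₁ a m => simp [coe_smul_tmul]
    | h₂ x y hx hy => simp_all

@[simp]
lemma map_tmul (f : M →ₗ[E] N) (a : Λ) (m : M) : map f (tmul E a m) = tmul E a (f m) := rfl

/-- The `Λ`-linear map `Id ⊗ f` induced by a `Λ`-linear map `f`. -/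
def mapΛ (f : M →ₗ[Λ] N) : BarTensor E M →ₗ[Λ] BarTensor E N where
  __ := (map (f.restrictScalars E)).toAddMonoidHom
  map_smul' b t := by
    induction t using induction_on with
    | h₀ => simp
    | h₁ a m => simp [smul_tmul]
    | h₂ x y hx hy => simp_all

@[simp]
lemma mapΛ_tmul (f : M →ₗ[Λ] N) (a : Λ) (m : M) :
    mapΛ (E := E) f (tmul E a m) = tmul E a (f m) := rfl

/-- The additive map underlying `cobd f` below. -/
def cobdAddHom (f : M →ₗ[E] N) : BarTensor E M →+ N :=
  lift (AddMonoidHom.mk' (fun a => AddMonoidHom.mk' (fun m => a • f m - f (a • m))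
        (fun m m' => by simp only [map_add, smul_add]; abel))
      (fun a a' => by
        ext m
        simp only [AddMonoidHom.mk'_apply, map_add, add_smul, AddMonoidHom.add_apply]
        abel))
    (fun e m => sub_eq_zero.2 (f.map_smul e m).symm)
    (fun a e m => by
      have := f.map_smul e m
      rw [Subring.smul_def, Subring.smul_def] at this
      simp only [AddMonoidHom.mk'_apply, Subring.smul_def, mul_smul, this])

lemma cobdAddHom_tmul (f : M →ₗ[E] N) (a : Λ) (m : M) :
    cobdAddHom f (tmul E a m) = a • f m - f (a • m) := rfl

/-- For an `E`-linear map `f : M → N`, the `E`-linear map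
`Λ̄ ⊗_E M → N`, `ā ⊗ m ↦ a f(m) - f(a m)`. -/
def cobd (f : M →ₗ[E] N) : BarTensor E M →ₗ[E] N where
  __ := cobdAddHom f
  map_smul' e t := by
    change cobdAddHom f (e • t) = e • cobdAddHom f t
    induction t using induction_on with
    | h₀ => rw [smul_zero, map_zero, smul_zero]
    | h₁ a m =>
      have := f.map_smul e (a • m)
      rw [Subring.smul_def, Subring.smul_def] at this
      rw [coe_smul_tmul, cobdAddHom_tmul, cobdAddHom_tmul, mul_smul, mul_smul, this,
        smul_sub, Subring.smul_def, Subring.smul_def]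
    | h₂ x y hx hy => rw [smul_add, map_add, map_add, smul_add, hx, hy]

@[simp]
lemma cobd_tmul (f : M →ₗ[E] N) (a : Λ) (m : M) :
    cobd f (tmul E a m) = a • f m - f (a • m) := rfl

lemma map_add (f g : M →ₗ[E] N) : map (f + g) = map f + map g :=
  hom_ext (fun a m => by simp)

lemma map_units_smul (ε : ℤˣ) (f : M →ₗ[E] N) : map (ε • f) = ε • map f := by
  obtain rfl | rfl := Int.units_eq_one_or ε
  · simp
  · exact hom_ext (fun a m => by simp)

lemma map_sub (f g : M →ₗ[E] N) : map (f - g) = map f - map g :=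
  hom_ext (fun a m => by simp)

lemma map_comp (g : N →ₗ[E] P) (f : M →ₗ[E] N) : map (g ∘ₗ f) = map g ∘ₗ map f :=
  hom_ext (fun a m => by simp)

lemma cobd_add (f g : M →ₗ[E] N) : cobd (f + g) = cobd f + cobd g :=
  hom_ext (fun a m => by simp; abel)

lemma cobd_sub (f g : M →ₗ[E] N) : cobd (f - g) = cobd f - cobd g :=
  hom_ext (fun a m => by simp [smul_sub]; abel)

lemma cobd_units_smul (ε : ℤˣ) (f : M →ₗ[E] N) : cobd (ε • f) = ε • cobd f := by
  obtain rfl | rfl := Int.units_eq_one_or ε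
  · simp
  · exact hom_ext (fun a m => by simp; abel)

lemma cobd_comp_left (g : N →ₗ[Λ] P) (f : M →ₗ[E] N) :
    cobd (g.restrictScalars E ∘ₗ f) = g.restrictScalars E ∘ₗ cobd f :=
  hom_ext (fun a m => by simp)

lemma cobd_comp_right (g : N →ₗ[E] P) (f : M →ₗ[Λ] N) :
    cobd (g ∘ₗ f.restrictScalars E) = cobd g ∘ₗ (mapΛ f).restrictScalars E :=
  hom_ext (fun a m => by simp)

lemma cobd_cobd (f : M →ₗ[E] N) : cobd (cobd f) = 0 :=
  hom_ext (fun a t => by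
    induction t using induction_on with
    | h₀ => simp
    | h₁ b m => simp [smul_tmul, mul_smul, smul_sub]
    | h₂ x y hx hy => rw [_root_.map_add, _root_.map_add, hx, hy]; simp)

lemma cobd_map (f : M →ₗ[E] N) : cobd (map f) = - map (cobd f) :=
  hom_ext (fun a t => by
    induction t using induction_on with
    | h₀ => simp
    | h₁ b m => simp [smul_tmul]
    | h₂ x y hx hy => rw [_root_.map_add, _root_.map_add, hx, hy, ← _root_.map_add])

end BarTensor

end Module

/-! ### Noncommutative differential forms -/

section Omega

variable {Λ : Type u} [Ring Λ] (E : Subring Λ)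

/-- The functor `M ↦ Λ̄ ⊗_E M` on `Λ`-modules, with the action
`b ▸ (ā ⊗ m) = (b a)‾ ⊗ m - b̄ ⊗ a m`. -/
def barFunctor : ModuleCat.{u} Λ ⥤ ModuleCat.{u} Λ where
  obj M := ModuleCat.of Λ (BarTensor E M)
  map f := ModuleCat.ofHom (BarTensor.mapΛ f.hom)
  map_id M := by
    ext : 1
    exact BarTensor.hom_ext' (fun a m => rfl)
  map_comp f g := by
    ext : 1
    exact BarTensor.hom_ext' (fun a m => rfl)

instance : (barFunctor E).Additive where
  map_add {M N f g} := by
    ext : 1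
    exact BarTensor.hom_ext' (fun a m => (BarTensor.tmul E a).map_add (f.hom m) (g.hom m))

/-- The functor `Ω_nc` on complexes: `Ω_nc(X) = s Λ̄ ⊗_E X` is the complex given in degree `n` by
`Λ̄ ⊗_E X^{n+1}`, with the differential `s ā ⊗ x ↦ - s ā ⊗ d x`. -/
def omega : CochainComplex (ModuleCat.{u} Λ) ℤ ⥤ CochainComplex (ModuleCat.{u} Λ) ℤ :=
  (barFunctor E).mapHomologicalComplex (ComplexShape.up ℤ) ⋙
    shiftFunctor (CochainComplex (ModuleCat.{u} Λ) ℤ) (1 : ℤ)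

instance : (omega E).Additive := by
  dsimp only [omega]
  infer_instance

/-- The iterates `Ω_nc^p`. As a graded `E`-module, `Ω_nc^p(X)` is `(s Λ̄)^{⊗ p} ⊗_E X`. -/
def omegaPow : ℕ → CochainComplex (ModuleCat.{u} Λ) ℤ ⥤ CochainComplex (ModuleCat.{u} Λ) ℤ
  | 0 => 𝟭 _
  | p + 1 => omegaPow p ⋙ omega E

instance (p : ℕ) : (omegaPow E p).Additive := by
  induction p with
  | zero => dsimp only [omegaPow]; infer_instance
  | succ p hp => dsimp only [omegaPow]; infer_instance

end Omega

/-! ### The Yoneda complexes -/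

section Yoneda

variable {Λ : Type u} [Ring Λ] (E : Subring Λ)

open CochainComplex.HomComplex

/-- The underlying `E`-linear map of a `Λ`-linear map. -/
abbrev resE {M N : ModuleCat.{u} Λ} (f : M ⟶ N) : M →ₗ[E] N := f.hom.restrictScalars E

lemma resE_comp {M N P : ModuleCat.{u} Λ} (f : M ⟶ N) (g : N ⟶ P) :
    resE E g ∘ₗ resE E f = resE E (f ≫ g) := rfl

section

variable {E} {X Y Z : CochainComplex (ModuleCat.{u} Λ) ℤ} {i j k : ℤ}

/-- The map `Λ̄ ⊗_E X^{i+1} → N`, `ā ⊗ x ↦ a f(x) - f(a x)`, on the term `Ω_nc(X)^i`. -/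
def cobdX {N : ModuleCat.{u} Λ} (f : X.X (i + 1) →ₗ[E] N) :
    ((omega E).obj X).X i →ₗ[E] N := BarTensor.cobd f

/-- The map `Id ⊗ f : Λ̄ ⊗_E X^{i+1} → Λ̄ ⊗_E Y^{j+1}` as a map `Ω_nc(X)^i → Ω_nc(Y)^j`. -/
def mapX (f : X.X (i + 1) →ₗ[E] Y.X (j + 1)) :
    ((omega E).obj X).X i →ₗ[E] ((omega E).obj Y).X j := BarTensor.map f

variable {N P : ModuleCat.{u} Λ}

lemma cobdX_add (f g : X.X (i + 1) →ₗ[E] N) : cobdX (f + g) = cobdX f + cobdX g :=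
  BarTensor.cobd_add f g

lemma cobdX_sub (f g : X.X (i + 1) →ₗ[E] N) : cobdX (f - g) = cobdX f - cobdX g :=
  BarTensor.cobd_sub f g

lemma cobdX_units_smul (ε : ℤˣ) (f : X.X (i + 1) →ₗ[E] N) : cobdX (ε • f) = ε • cobdX f :=
  BarTensor.cobd_units_smul ε f

lemma mapX_add (f g : X.X (i + 1) →ₗ[E] Y.X (j + 1)) : mapX (f + g) = mapX f + mapX g :=
  BarTensor.map_add f g

lemma mapX_sub (f g : X.X (i + 1) →ₗ[E] Y.X (j + 1)) : mapX (f - g) = mapX f - mapX g :=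
  BarTensor.map_sub f g

lemma mapX_units_smul (ε : ℤˣ) (f : X.X (i + 1) →ₗ[E] Y.X (j + 1)) :
    mapX (ε • f) = ε • mapX f :=
  BarTensor.map_units_smul ε f

lemma mapX_comp (g : Y.X (j + 1) →ₗ[E] Z.X (k + 1)) (f : X.X (i + 1) →ₗ[E] Y.X (j + 1)) :
    mapX (g ∘ₗ f) = mapX g ∘ₗ mapX f :=
  BarTensor.map_comp g f

lemma cobdX_comp_left (g : N ⟶ P) (f : X.X (i + 1) →ₗ[E] N) :
    cobdX (resE E g ∘ₗ f) = resE E g ∘ₗ cobdX f :=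
  BarTensor.cobd_comp_left g.hom f

lemma cobdX_comp_right (g : Y.X (j + 1) →ₗ[E] N) (f : X.X (i + 1) ⟶ Y.X (j + 1)) :
    cobdX (g ∘ₗ resE E f) = cobdX g ∘ₗ mapX (resE E f) :=
  BarTensor.cobd_comp_right g f.hom

lemma cobdX_cobdX (f : X.X (i + 1 + 1) →ₗ[E] N) : cobdX (cobdX f) = 0 :=
  BarTensor.cobd_cobd f

lemma cobdX_mapX (f : X.X (i + 1 + 1) →ₗ[E] Y.X (j + 1)) :
    cobdX (mapX f) = - mapX (cobdX f) :=
  BarTensor.cobd_map f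

lemma omega_map_f (g : X ⟶ Y) (i : ℤ) :
    resE E (((omega E).map g).f i) = mapX (resE E (g.f (i + 1))) := rfl

lemma omega_d (i j : ℤ) : resE E (((omega E).obj X).d i j) =
    - mapX (resE E (X.d (i + 1) (j + 1))) := by
  have : ((omega E).obj X).d i j = - (barFunctor E).map (X.d (i + 1) (j + 1)) := by
    change Int.negOnePow 1 • (barFunctor E).map (X.d (i + 1) (j + 1)) = _
    rw [Int.negOnePow_one, Units.neg_smul, one_smul]
  rw [this]
  rfl

end

/-- `E`-linear graded maps `X → Y` of degree `n`: families of `E`-linear maps `X^i → Y^j`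
for `i + n = j`. -/
def GradedHom (X Y : CochainComplex (ModuleCat.{u} Λ) ℤ) (n : ℤ) : Type u :=
  ∀ t : Triplet n, X.X t.p →ₗ[E] Y.X t.q

namespace GradedHom

instance (X Y : CochainComplex (ModuleCat.{u} Λ) ℤ) (n : ℤ) :
    AddCommGroup (GradedHom E X Y n) :=
  inferInstanceAs (AddCommGroup (∀ t : Triplet n, X.X t.p →ₗ[E] Y.X t.q))

variable {E}
variable {X Y Z : CochainComplex (ModuleCat.{u} Λ) ℤ} {n m l : ℤ}

/-- The component `X^i → Y^j` of a graded map. -/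
def v (f : GradedHom E X Y n) (i j : ℤ) (h : i + n = j) : X.X i →ₗ[E] Y.X j := f ⟨i, j, h⟩

/-- The graded map with the given components. -/
def mk (φ : ∀ (i j : ℤ), i + n = j → (X.X i →ₗ[E] Y.X j)) : GradedHom E X Y n :=
  fun t => φ t.p t.q t.hpq

@[simp] lemma mk_v (φ : ∀ (i j : ℤ), i + n = j → (X.X i →ₗ[E] Y.X j)) (i j : ℤ)
    (h : i + n = j) : (mk φ).v i j h = φ i j h := rfl

@[ext]
lemma ext {f g : GradedHom E X Y n} (h : ∀ i j hij, f.v i j hij = g.v i j hij) : f = g :=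
  funext (fun t => h t.p t.q t.hpq)

@[simp] lemma zero_v (i j : ℤ) (h : i + n = j) : (0 : GradedHom E X Y n).v i j h = 0 := rfl

@[simp] lemma add_v (f g : GradedHom E X Y n) (i j : ℤ) (h : i + n = j) :
    (f + g).v i j h = f.v i j h + g.v i j h := rfl

@[simp] lemma neg_v (f : GradedHom E X Y n) (i j : ℤ) (h : i + n = j) :
    (-f).v i j h = - f.v i j h := rfl

/-- The internal differential `δ_in(f) = d_Y f - (-1)^{|f|} f d_X`. It is applied below with `X`
replaced by `Ω_nc^q(X)`, whose differential is `s ā_{1,q} ⊗ x ↦ (-1)^q s ā_{1,q} ⊗ d x`. -/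
def deltaIn (h : n + 1 = m) (f : GradedHom E X Y n) : GradedHom E X Y m :=
  mk (fun i j hij => resE E (Y.d (j - 1) j) ∘ₗ f.v i (j - 1) (by lia) -
    n.negOnePow • (f.v (i + 1) j (by lia) ∘ₗ resE E (X.d i (i + 1))))

/-- The external differential, which sends a graded map `f : X → Y` to the graded map
`Ω_nc(X) → Y`, `s ā ⊗ x ↦ (-1)^{|f| + 1} (a f(x) - f(a x))`.

It is applied below with `X` replaced by `Ω_nc^q(X)`, whose underlying graded `E`-module is
`(s Λ̄)^{⊗ q} ⊗_E X`. Unfolding the rule `a ▸ (s b̄ ⊗ w) = s (a b)‾ ⊗ w - s ā ⊗ b ▸ w`, this is the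
usual formula: `s ā_{1,q+1} ⊗ x` is sent to
`(-1)^{|f| + 1} a_1 f(s ā_{2,q+1} ⊗ x) + (-1)^{|f| + q} f(s ā_{1,q} ⊗ a_{q+1} x)`
`+ ∑_{i=1}^{q} (-1)^{|f| + i + 1} f(s ā_{1,i-1} ⊗ s (a_i a_{i+1})‾ ⊗ s ā_{i+2,q+1} ⊗ x)`. -/
def deltaEx (h : n + 1 = m) (f : GradedHom E X Y n) : GradedHom E ((omega E).obj X) Y m :=
  mk (fun i j hij => m.negOnePow • cobdX (f.v (i + 1) j (by lia)))

/-- The graded map `Ω_nc(X) → Ω_nc(Y)`, `s ā ⊗ x ↦ (-1)^{|f|} s ā ⊗ f(x)`, attached to a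
graded map `f : X → Y`. -/
def sTensor (f : GradedHom E X Y n) : GradedHom E ((omega E).obj X) ((omega E).obj Y) n :=
  mk (fun i j hij => n.negOnePow • mapX (f.v (i + 1) (j + 1) (by lia)))

/-- Precomposition with a cochain map. -/
def precomp (g : Z ⟶ X) (f : GradedHom E X Y n) : GradedHom E Z Y n :=
  mk (fun i j hij => f.v i j hij ∘ₗ resE E (g.f i))

/-- Postcomposition with a cochain map. -/
def postcomp (g : Y ⟶ Z) (f : GradedHom E X Y n) : GradedHom E X Z n :=
  mk (fun i j hij => resE E (g.f j) ∘ₗ f.v i j hij)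

lemma deltaIn_v (h : n + 1 = m) (f : GradedHom E X Y n) (i j : ℤ) (hij : i + m = j)
    (j' i' : ℤ) (hj : j' + 1 = j) (hi : i + 1 = i') :
    (f.deltaIn h).v i j hij = resE E (Y.d j' j) ∘ₗ f.v i j' (by lia) -
      n.negOnePow • (f.v i' j (by lia) ∘ₗ resE E (X.d i i')) := by
  obtain rfl : j' = j - 1 := by lia
  subst hi
  rfl

lemma deltaEx_v (h : n + 1 = m) (f : GradedHom E X Y n) (i j : ℤ) (hij : i + m = j) :
    (f.deltaEx h).v i j hij = m.negOnePow • cobdX (f.v (i + 1) j (by lia)) := rfl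

lemma sTensor_v (f : GradedHom E X Y n) (i j : ℤ) (hij : i + n = j) :
    f.sTensor.v i j hij = n.negOnePow • mapX (f.v (i + 1) (j + 1) (by lia)) := rfl

@[simp] lemma precomp_v (g : Z ⟶ X) (f : GradedHom E X Y n) (i j : ℤ) (hij : i + n = j) :
    (f.precomp g).v i j hij = f.v i j hij ∘ₗ resE E (g.f i) := rfl

@[simp] lemma postcomp_v (g : Y ⟶ Z) (f : GradedHom E X Y n) (i j : ℤ) (hij : i + n = j) :
    (f.postcomp g).v i j hij = resE E (g.f j) ∘ₗ f.v i j hij := rfl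

lemma resE_d_d (i j k : ℤ) : resE E (X.d j k) ∘ₗ resE E (X.d i j) = 0 := by
  rw [resE_comp, X.d_comp_d]
  rfl

lemma deltaIn_deltaIn (h : n + 1 = m) (h' : m + 1 = l) (f : GradedHom E X Y n) :
    (f.deltaIn h).deltaIn h' = 0 := by
  ext1 i j hij
  rw [deltaIn_v h' _ i j hij (j - 1) (i + 1) (by lia) rfl,
    deltaIn_v h _ i (j - 1) _ (j - 2) (i + 1) (by lia) rfl,
    deltaIn_v h _ (i + 1) j _ (j - 1) (i + 1 + 1) (by lia) rfl]
  subst h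
  rw [LinearMap.comp_sub, LinearMap.sub_comp, ← LinearMap.comp_assoc, resE_d_d]
  obtain h | h := Int.units_eq_one_or n.negOnePow <;>
  simp [Int.negOnePow_succ, h, LinearMap.comp_assoc, resE_d_d, -ModuleCat.hom_comp, LinearMap.comp_neg]

lemma deltaEx_deltaEx (h : n + 1 = m) (h' : m + 1 = l) (f : GradedHom E X Y n) :
    (f.deltaEx h).deltaEx h' = 0 := by
  ext1 i j hij
  rw [deltaEx_v, deltaEx_v, cobdX_units_smul, cobdX_cobdX, smul_zero, smul_zero, zero_v]

lemma deltaIn_deltaEx (h : n + 1 = m) (h' : m + 1 = l) (f : GradedHom E X Y n) :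
    (f.deltaEx h).deltaIn h' = - (f.deltaIn h).deltaEx h' := by
  ext1 i j hij
  rw [neg_v, deltaEx_v, deltaIn_v h _ (i + 1) j _ (j - 1) (i + 1 + 1) (by lia) rfl,
    deltaIn_v h' _ i j _ (j - 1) (i + 1) (by lia) rfl, deltaEx_v, deltaEx_v, omega_d,
    cobdX_sub, cobdX_units_smul, cobdX_comp_left, cobdX_comp_right]
  subst h h'
  obtain h | h := Int.units_eq_one_or n.negOnePow <;>
  simp [Int.negOnePow_succ, h, LinearMap.comp_neg, LinearMap.neg_comp] <;>
  abel

lemma deltaIn_sTensor (h : n + 1 = m) (f : GradedHom E X Y n) :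
    f.sTensor.deltaIn h = (f.deltaIn h).sTensor := by
  ext1 i j hij
  obtain ⟨j, rfl⟩ : ∃ k, j = k + 1 := ⟨j - 1, by lia⟩
  rw [sTensor_v, deltaIn_v h _ (i + 1) (j + 1 + 1) _ (j + 1) (i + 1 + 1) (by lia) rfl,
    deltaIn_v h _ i (j + 1) _ j (i + 1) (by lia) rfl, sTensor_v, sTensor_v, omega_d, omega_d,
    mapX_sub, mapX_units_smul, mapX_comp, mapX_comp]
  subst h
  obtain h | h := Int.units_eq_one_or n.negOnePow <;>
  simp [Int.negOnePow_succ, h, LinearMap.comp_neg, LinearMap.neg_comp]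
  abel

lemma deltaEx_sTensor (h : n + 1 = m) (f : GradedHom E X Y n) :
    f.sTensor.deltaEx h = (f.deltaEx h).sTensor := by
  ext1 i j hij
  rw [sTensor_v, deltaEx_v, deltaEx_v, sTensor_v, mapX_units_smul, cobdX_units_smul, cobdX_mapX]
  subst h
  obtain h | h := Int.units_eq_one_or n.negOnePow <;>
  simp [Int.negOnePow_succ, h]

lemma deltaIn_precomp (h : n + 1 = m) (g : Z ⟶ X) (f : GradedHom E X Y n) :
    (f.precomp g).deltaIn h = (f.deltaIn h).precomp g := by
  ext1 i j hij
  rw [precomp_v, deltaIn_v h _ i j _ (j - 1) (i + 1) (by lia) rfl,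
    deltaIn_v h _ i j _ (j - 1) (i + 1) (by lia) rfl, precomp_v, precomp_v, LinearMap.comp_assoc,
    resE_comp, ← g.comm, LinearMap.sub_comp]
  rfl

lemma deltaEx_precomp (h : n + 1 = m) (g : Z ⟶ X) (f : GradedHom E X Y n) :
    (f.precomp g).deltaEx h = (f.deltaEx h).precomp ((omega E).map g) := by
  ext1 i j hij
  rw [precomp_v, deltaEx_v, deltaEx_v, precomp_v, cobdX_comp_right, omega_map_f]
  rfl

lemma sTensor_precomp (g : Z ⟶ X) (f : GradedHom E X Y n) :
    (f.precomp g).sTensor = f.sTensor.precomp ((omega E).map g) := by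
  ext1 i j hij
  rw [precomp_v, sTensor_v, sTensor_v, precomp_v, mapX_comp, omega_map_f]
  rfl

lemma deltaIn_postcomp (h : n + 1 = m) (g : Y ⟶ Z) (f : GradedHom E X Y n) :
    (f.postcomp g).deltaIn h = (f.deltaIn h).postcomp g := by
  ext1 i j hij
  rw [postcomp_v, deltaIn_v h _ i j _ (j - 1) (i + 1) (by lia) rfl,
    deltaIn_v h _ i j _ (j - 1) (i + 1) (by lia) rfl, postcomp_v, postcomp_v,
    ← LinearMap.comp_assoc, resE_comp, g.comm, LinearMap.comp_sub]
  obtain h | h := Int.units_eq_one_or n.negOnePow <;>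
  simp [h, LinearMap.comp_neg] <;> rfl

lemma deltaEx_postcomp (h : n + 1 = m) (g : Y ⟶ Z) (f : GradedHom E X Y n) :
    (f.postcomp g).deltaEx h = (f.deltaEx h).postcomp g := by
  ext1 i j hij
  rw [postcomp_v, deltaEx_v, deltaEx_v, postcomp_v, cobdX_comp_left]
  subst h
  obtain h | h := Int.units_eq_one_or n.negOnePow <;>
  simp [Int.negOnePow_succ, h, LinearMap.comp_neg]

lemma sTensor_postcomp (g : Y ⟶ Z) (f : GradedHom E X Y n) :
    (f.postcomp g).sTensor = f.sTensor.postcomp ((omega E).map g) := by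
  ext1 i j hij
  rw [postcomp_v, sTensor_v, sTensor_v, postcomp_v, mapX_comp, omega_map_f]
  obtain h | h := Int.units_eq_one_or n.negOnePow <;>
  simp [h, LinearMap.comp_neg]

lemma deltaIn_add (h : n + 1 = m) (f g : GradedHom E X Y n) :
    (f + g).deltaIn h = f.deltaIn h + g.deltaIn h := by
  ext1 i j hij
  rw [add_v]
  simp only [deltaIn_v h _ i j hij (j - 1) (i + 1) (by lia) rfl, add_v, LinearMap.comp_add,
    LinearMap.add_comp, smul_add]
  abel

lemma deltaEx_add (h : n + 1 = m) (f g : GradedHom E X Y n) :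
    (f + g).deltaEx h = f.deltaEx h + g.deltaEx h := by
  ext1 i j hij
  simp only [deltaEx_v, add_v, cobdX_add, smul_add]

lemma sTensor_add (f g : GradedHom E X Y n) :
    (f + g).sTensor = f.sTensor + g.sTensor := by
  ext1 i j hij
  simp only [sTensor_v, add_v, mapX_add, smul_add]

lemma precomp_add (k : Z ⟶ X) (f g : GradedHom E X Y n) :
    (f + g).precomp k = f.precomp k + g.precomp k := by
  ext1 i j hij
  simp only [precomp_v, add_v, LinearMap.add_comp]

lemma postcomp_add (k : Y ⟶ Z) (f g : GradedHom E X Y n) :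
    (f + g).postcomp k = f.postcomp k + g.postcomp k := by
  ext1 i j hij
  simp only [postcomp_v, add_v, LinearMap.comp_add]

end GradedHom

namespace GradedHom

variable {E}
variable {X Y Z : CochainComplex (ModuleCat.{u} Λ) ℤ} {n m l : ℤ} {q : ℕ}

lemma deltaIn_zero (h : n + 1 = m) : (0 : GradedHom E X Y n).deltaIn h = 0 :=
  (AddMonoidHom.mk' (deltaIn (E := E) (X := X) (Y := Y) h) (deltaIn_add h)).map_zero

/-- The external differential on `Hom_E(Ω_nc^q(X), Y)`. -/
def deltaExPow (h : n + 1 = m) (f : GradedHom E ((omegaPow E q).obj X) Y n) :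
    GradedHom E ((omegaPow E (q + 1)).obj X) Y m := f.deltaEx h

/-- The map `f ↦ (-1)^{|f|} Id_{s Λ̄} ⊗ f` on `Hom_E(Ω_nc^q(X), Y)`. -/
def sTensorPow (f : GradedHom E ((omegaPow E q).obj X) Y n) :
    GradedHom E ((omegaPow E (q + 1)).obj X) ((omega E).obj Y) n := f.sTensor

lemma deltaExPow_add (h : n + 1 = m) (f g : GradedHom E ((omegaPow E q).obj X) Y n) :
    (f + g).deltaExPow h = f.deltaExPow h + g.deltaExPow h := deltaEx_add h f g

lemma deltaExPow_zero (h : n + 1 = m) :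
    (0 : GradedHom E ((omegaPow E q).obj X) Y n).deltaExPow h = 0 :=
  (AddMonoidHom.mk' (deltaExPow (E := E) (X := X) (Y := Y) (q := q) h)
    (deltaExPow_add h)).map_zero

lemma sTensorPow_add (f g : GradedHom E ((omegaPow E q).obj X) Y n) :
    (f + g).sTensorPow = f.sTensorPow + g.sTensorPow := sTensor_add f g

lemma deltaExPow_deltaExPow (h : n + 1 = m) (h' : m + 1 = l)
    (f : GradedHom E ((omegaPow E q).obj X) Y n) :
    (f.deltaExPow h).deltaExPow h' = 0 := deltaEx_deltaEx h h' f

lemma deltaIn_deltaExPow (h : n + 1 = m) (h' : m + 1 = l)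
    (f : GradedHom E ((omegaPow E q).obj X) Y n) :
    (f.deltaExPow h).deltaIn h' = - (f.deltaIn h).deltaExPow h' := deltaIn_deltaEx h h' f

lemma deltaIn_sTensorPow (h : n + 1 = m) (f : GradedHom E ((omegaPow E q).obj X) Y n) :
    f.sTensorPow.deltaIn h = (f.deltaIn h).sTensorPow := deltaIn_sTensor h f

lemma deltaExPow_sTensorPow (h : n + 1 = m) (f : GradedHom E ((omegaPow E q).obj X) Y n) :
    f.sTensorPow.deltaExPow h = (f.deltaExPow h).sTensorPow := deltaEx_sTensor h f

lemma deltaExPow_precomp (h : n + 1 = m) (g : Z ⟶ X)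
    (f : GradedHom E ((omegaPow E q).obj X) Y n) :
    (f.precomp ((omegaPow E q).map g)).deltaExPow h =
      (f.deltaExPow h).precomp ((omegaPow E (q + 1)).map g) := deltaEx_precomp h _ f

lemma sTensorPow_precomp (g : Z ⟶ X) (f : GradedHom E ((omegaPow E q).obj X) Y n) :
    (f.precomp ((omegaPow E q).map g)).sTensorPow =
      f.sTensorPow.precomp ((omegaPow E (q + 1)).map g) := sTensor_precomp _ f

lemma deltaExPow_postcomp (h : n + 1 = m) (g : Y ⟶ Z)
    (f : GradedHom E ((omegaPow E q).obj X) Y n) :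
    (f.postcomp g).deltaExPow h = (f.deltaExPow h).postcomp g := deltaEx_postcomp h g f

lemma sTensorPow_postcomp (g : Y ⟶ Z) (f : GradedHom E ((omegaPow E q).obj X) Y n) :
    (f.postcomp g).sTensorPow = f.sTensorPow.postcomp ((omega E).map g) := sTensor_postcomp g f

end GradedHom

/-- The graded group `𝒴(X, Y) = ∏_{q ≥ 0} Hom_E((s Λ̄)^{⊗ q} ⊗_E X, Y)`, in degree `n`. -/
def YonedaHom (X Y : CochainComplex (ModuleCat.{u} Λ) ℤ) (n : ℤ) : Type u :=
  ∀ q : ℕ, GradedHom E ((omegaPow E q).obj X) Y n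

namespace YonedaHom

instance (X Y : CochainComplex (ModuleCat.{u} Λ) ℤ) (n : ℤ) :
    AddCommGroup (YonedaHom E X Y n) :=
  inferInstanceAs (AddCommGroup (∀ q : ℕ, GradedHom E ((omegaPow E q).obj X) Y n))

variable {E}
variable {X Y Z W : CochainComplex (ModuleCat.{u} Λ) ℤ} {n m l : ℤ}

/-- The component of filtration-degree `q`. -/
def comp (f : YonedaHom E X Y n) (q : ℕ) : GradedHom E ((omegaPow E q).obj X) Y n := f q

@[ext]
lemma ext {f g : YonedaHom E X Y n} (h : ∀ q, f.comp q = g.comp q) : f = g := funext h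

@[simp] lemma zero_comp (q : ℕ) : (0 : YonedaHom E X Y n).comp q = 0 := rfl

@[simp] lemma add_comp (f g : YonedaHom E X Y n) (q : ℕ) :
    (f + g).comp q = f.comp q + g.comp q := rfl

/-- The differential `δ = δ_in + δ_ex` of `𝒴(X, Y)`. -/
def delta (h : n + 1 = m) (f : YonedaHom E X Y n) : YonedaHom E X Y m
  | 0 => (f.comp 0).deltaIn h
  | q + 1 => (f.comp (q + 1)).deltaIn h + (f.comp q).deltaExPow h

/-- The map `𝒴(X, Y) → 𝒴(X, Ω_nc(Y))`, `f ↦ θ_Y ⊙ f`, which sends a map `f` of filtration-degree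
`q` to the map `s ā_{1,q+1} ⊗ x ↦ (-1)^{|f|} s ā_1 ⊗ f(s ā_{2,q+1} ⊗ x)` of filtration-degree
`q + 1`. -/
def theta (f : YonedaHom E X Y n) : YonedaHom E X ((omega E).obj Y) n
  | 0 => 0
  | q + 1 => (f.comp q).sTensorPow

/-- Precomposition with a cochain map. -/
def precomp (g : Z ⟶ X) (f : YonedaHom E X Y n) : YonedaHom E Z Y n :=
  fun q => (f.comp q).precomp ((omegaPow E q).map g)

/-- Postcomposition with a cochain map. -/
def postcomp (g : Y ⟶ Z) (f : YonedaHom E X Y n) : YonedaHom E X Z n :=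
  fun q => (f.comp q).postcomp g

@[simp] lemma delta_comp_zero (h : n + 1 = m) (f : YonedaHom E X Y n) :
    (f.delta h).comp 0 = (f.comp 0).deltaIn h := rfl

@[simp] lemma delta_comp_succ (h : n + 1 = m) (f : YonedaHom E X Y n) (q : ℕ) :
    (f.delta h).comp (q + 1) = (f.comp (q + 1)).deltaIn h + (f.comp q).deltaExPow h := rfl

@[simp] lemma theta_comp_zero (f : YonedaHom E X Y n) : f.theta.comp 0 = 0 := rfl

@[simp] lemma theta_comp_succ (f : YonedaHom E X Y n) (q : ℕ) :
    f.theta.comp (q + 1) = (f.comp q).sTensorPow := rfl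

@[simp] lemma precomp_comp (g : Z ⟶ X) (f : YonedaHom E X Y n) (q : ℕ) :
    (f.precomp g).comp q = (f.comp q).precomp ((omegaPow E q).map g) := rfl

@[simp] lemma postcomp_comp (g : Y ⟶ Z) (f : YonedaHom E X Y n) (q : ℕ) :
    (f.postcomp g).comp q = (f.comp q).postcomp g := rfl

lemma delta_add (h : n + 1 = m) (f g : YonedaHom E X Y n) :
    (f + g).delta h = f.delta h + g.delta h := by
  ext1 q
  cases q with
  | zero => simp [GradedHom.deltaIn_add]
  | succ q =>
    simp only [delta_comp_succ, add_comp, GradedHom.deltaIn_add, GradedHom.deltaExPow_add]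
    abel

lemma theta_add (f g : YonedaHom E X Y n) : (f + g).theta = f.theta + g.theta := by
  ext1 q
  cases q with
  | zero => simp
  | succ q => simp only [theta_comp_succ, add_comp, GradedHom.sTensorPow_add]

lemma precomp_add (k : Z ⟶ X) (f g : YonedaHom E X Y n) :
    (f + g).precomp k = f.precomp k + g.precomp k := by
  ext1 q
  simp only [precomp_comp, add_comp, GradedHom.precomp_add]

lemma postcomp_add (k : Y ⟶ Z) (f g : YonedaHom E X Y n) :
    (f + g).postcomp k = f.postcomp k + g.postcomp k := by
  ext1 q
  simp only [postcomp_comp, add_comp, GradedHom.postcomp_add]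

lemma delta_delta (h : n + 1 = m) (h' : m + 1 = l) (f : YonedaHom E X Y n) :
    (f.delta h).delta h' = 0 := by
  ext1 q
  obtain _ | _ | q := q
  · simp [GradedHom.deltaIn_deltaIn]
  · simp only [delta_comp_succ, delta_comp_zero, GradedHom.deltaIn_add]
    rw [GradedHom.deltaIn_deltaIn, GradedHom.deltaIn_deltaExPow, zero_comp]
    abel
  · simp only [delta_comp_succ, GradedHom.deltaIn_add, GradedHom.deltaExPow_add]
    rw [GradedHom.deltaIn_deltaIn, GradedHom.deltaIn_deltaExPow, GradedHom.deltaExPow_deltaExPow,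
      zero_add, add_zero, zero_comp]
    exact neg_add_cancel _

lemma delta_theta (h : n + 1 = m) (f : YonedaHom E X Y n) :
    f.theta.delta h = (f.delta h).theta := by
  ext1 q
  obtain _ | _ | q := q
  · exact GradedHom.deltaIn_zero h
  · simp only [delta_comp_succ, delta_comp_zero, theta_comp_succ, theta_comp_zero]
    rw [GradedHom.deltaIn_sTensorPow, GradedHom.deltaExPow_zero, add_zero]
  · simp only [delta_comp_succ, theta_comp_succ, GradedHom.sTensorPow_add]
    rw [GradedHom.deltaIn_sTensorPow, GradedHom.deltaExPow_sTensorPow]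

lemma delta_precomp (h : n + 1 = m) (g : Z ⟶ X) (f : YonedaHom E X Y n) :
    (f.precomp g).delta h = (f.delta h).precomp g := by
  ext1 q
  cases q with
  | zero => simp [GradedHom.deltaIn_precomp]
  | succ q =>
    simp only [delta_comp_succ, precomp_comp, GradedHom.precomp_add, GradedHom.deltaIn_precomp,
      GradedHom.deltaExPow_precomp]

lemma delta_postcomp (h : n + 1 = m) (g : Y ⟶ Z) (f : YonedaHom E X Y n) :
    (f.postcomp g).delta h = (f.delta h).postcomp g := by
  ext1 q
  cases q with
  | zero => simp [GradedHom.deltaIn_postcomp]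
  | succ q =>
    simp only [delta_comp_succ, postcomp_comp, GradedHom.postcomp_add,
      GradedHom.deltaIn_postcomp, GradedHom.deltaExPow_postcomp]

lemma theta_precomp (g : Z ⟶ X) (f : YonedaHom E X Y n) :
    (f.precomp g).theta = f.theta.precomp g := by
  ext1 q
  cases q with
  | zero => ext1 i j hij; simp
  | succ q =>
    simp only [theta_comp_succ, precomp_comp, GradedHom.sTensorPow_precomp]

lemma theta_postcomp (g : Y ⟶ Z) (f : YonedaHom E X Y n) :
    (f.postcomp g).theta = f.theta.postcomp ((omega E).map g) := by
  ext1 q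
  cases q with
  | zero => ext1 i j hij; simp
  | succ q => simp only [theta_comp_succ, postcomp_comp, GradedHom.sTensorPow_postcomp]

lemma precomp_postcomp (g : Z ⟶ X) (k : Y ⟶ W) (f : YonedaHom E X Y n) :
    (f.precomp g).postcomp k = (f.postcomp k).precomp g := rfl

lemma precomp_id (f : YonedaHom E X Y n) : f.precomp (𝟙 X) = f := by
  ext1 q
  simp only [precomp_comp, CategoryTheory.Functor.map_id]
  rfl

lemma precomp_comp_eq (g : Z ⟶ X) (k : W ⟶ Z) (f : YonedaHom E X Y n) :
    f.precomp (k ≫ g) = (f.precomp g).precomp k := by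
  ext1 q
  simp only [precomp_comp, Functor.map_comp]
  rfl

lemma precomp_map_add (g k : Z ⟶ X) (f : YonedaHom E X Y n) :
    f.precomp (g + k) = f.precomp g + f.precomp k := by
  ext1 q
  simp only [precomp_comp, Functor.map_add, add_comp]
  ext1 i j hij
  simp only [GradedHom.precomp_v, GradedHom.add_v, ← LinearMap.comp_add]
  rfl

lemma precomp_map_zero (f : YonedaHom E X Y n) :
    f.precomp (0 : Z ⟶ X) = 0 := by
  ext1 q
  simp only [precomp_comp, Functor.map_zero, zero_comp]
  ext1 i j hij
  simp only [GradedHom.precomp_v, GradedHom.zero_v]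
  exact (f.comp q |>.v i j hij).comp_zero

variable (Λ) in
/-- The `Λ`-module `Λ` as a stalk complex concentrated in degree zero. -/
def stalk : CochainComplex (ModuleCat.{u} Λ) ℤ :=
  (HomologicalComplex.single (ModuleCat.{u} Λ) (ComplexShape.up ℤ) 0).obj (ModuleCat.of Λ Λ)

/-- The endomorphism `x ↦ x b` of the stalk complex `Λ`. -/
def rightMul (b : Λ) : stalk Λ ⟶ stalk Λ :=
  (HomologicalComplex.single (ModuleCat.{u} Λ) (ComplexShape.up ℤ) 0).map
    (ModuleCat.ofHom (LinearMap.toSpanSingleton Λ Λ b))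

lemma rightMul_one : rightMul (1 : Λ) = 𝟙 _ := by
  refine Eq.trans ?_ (CategoryTheory.Functor.map_id _ _)
  dsimp only [rightMul]
  congr 1
  ext
  simp

lemma rightMul_zero : rightMul (0 : Λ) = 0 := by
  refine Eq.trans ?_ (Functor.map_zero _ _ _)
  dsimp only [rightMul]
  congr 1
  ext
  simp

lemma rightMul_add (b c : Λ) : rightMul (b + c) = rightMul b + rightMul c := by
  dsimp only [rightMul]
  refine Eq.trans ?_ (Functor.map_add _)
  congr 1
  ext
  simp

lemma rightMul_mul (b c : Λ) : rightMul (b * c) = rightMul b ≫ rightMul c := by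
  dsimp only [rightMul]
  refine Eq.trans ?_ (Functor.map_comp _ _ _)
  congr 1
  ext
  simp

/-- The left `Λ`-module structure on `𝒴(Λ, Y)` induced by the right `Λ`-module structure
on `Λ`. -/
instance (Y : CochainComplex (ModuleCat.{u} Λ) ℤ) (n : ℤ) :
    Module Λ (YonedaHom E (stalk Λ) Y n) where
  smul b f := f.precomp (rightMul b)
  one_smul f := by
    change f.precomp (rightMul 1) = f
    rw [rightMul_one, precomp_id]
  mul_smul b c f := by
    change f.precomp (rightMul (b * c)) = (f.precomp (rightMul c)).precomp (rightMul b)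
    rw [rightMul_mul, precomp_comp_eq]
  smul_zero b := by
    change (0 : YonedaHom E (stalk Λ) Y n).precomp (rightMul b) = 0
    ext1 q
    ext1 i j hij
    simp
  smul_add b f g := precomp_add _ f g
  add_smul b c f := by
    change f.precomp (rightMul (b + c)) = f.precomp (rightMul b) + f.precomp (rightMul c)
    rw [rightMul_add, precomp_map_add]
  zero_smul f := by
    change f.precomp (rightMul 0) = 0
    rw [rightMul_zero, precomp_map_zero]

end YonedaHom

open YonedaHom

variable {E} in
/-- The differential of `𝒴(Λ, Y)`, as a `Λ`-linear map. -/
def deltaΛ (Y : CochainComplex (ModuleCat.{u} Λ) ℤ) {n m : ℤ} (h : n + 1 = m) :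
    YonedaHom E (stalk Λ) Y n →ₗ[Λ] YonedaHom E (stalk Λ) Y m where
  toFun f := f.delta h
  map_add' := delta_add h
  map_smul' b f := delta_precomp h (rightMul b) f

/-- The differentials of the complex `𝒴(Λ, Y)`. -/
def deltaHom (Y : CochainComplex (ModuleCat.{u} Λ) ℤ) (n m : ℤ) :
    ModuleCat.of Λ (YonedaHom E (stalk Λ) Y n) ⟶ ModuleCat.of Λ (YonedaHom E (stalk Λ) Y m) :=
  if h : n + 1 = m then ModuleCat.ofHom (deltaΛ Y h) else 0

/-- The complex of `Λ`-modules `𝒴(Λ, Y)`. -/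
def yonedaObj (Y : CochainComplex (ModuleCat.{u} Λ) ℤ) : CochainComplex (ModuleCat.{u} Λ) ℤ where
  X n := ModuleCat.of Λ (YonedaHom E (stalk Λ) Y n)
  d n m := deltaHom E Y n m
  shape n m h := dif_neg h
  d_comp_d' n m l h h' := by
    change n + 1 = m at h
    change m + 1 = l at h'
    rw [deltaHom, deltaHom, dif_pos h, dif_pos h']
    exact ModuleCat.hom_ext (LinearMap.ext (fun f => delta_delta h h' f))

lemma yonedaObj_d_apply (Y : CochainComplex (ModuleCat.{u} Λ) ℤ) {n m : ℤ} (h : n + 1 = m)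
    (f : YonedaHom E (stalk Λ) Y n) : ((yonedaObj E Y).d n m).hom f = f.delta h := by
  change (deltaHom E Y n m).hom f = _
  rw [deltaHom, dif_pos h]
  rfl

variable {E} in
lemma yonedaObj_hom_ext {Y : CochainComplex (ModuleCat.{u} Λ) ℤ} {n : ℤ} {M : ModuleCat.{u} Λ}
    {φ ψ : (yonedaObj E Y).X n ⟶ M}
    (h : ∀ f : YonedaHom E (stalk Λ) Y n, φ.hom f = ψ.hom f) : φ = ψ := by
  ext f
  exact h f

/-- The functor `𝒴(Λ, -)` on complexes of `Λ`-modules. -/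
def yoneda : CochainComplex (ModuleCat.{u} Λ) ℤ ⥤ CochainComplex (ModuleCat.{u} Λ) ℤ where
  obj Y := yonedaObj E Y
  map {Y Z} g :=
    { f n := ModuleCat.ofHom
        { toFun := fun f : YonedaHom E (stalk Λ) Y n => f.postcomp g
          map_add' := postcomp_add g
          map_smul' := fun b f => rfl }
      comm' n m h := yonedaObj_hom_ext (fun f => by
        refine (yonedaObj_d_apply E Z h (f.postcomp g)).trans ((delta_postcomp h g f).trans ?_)
        exact congr_arg (postcomp g) (yonedaObj_d_apply E Y h f).symm) }
  map_id Y := by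
    ext n : 1
    exact yonedaObj_hom_ext (fun f => rfl)
  map_comp g k := by
    ext n : 1
    exact yonedaObj_hom_ext (fun f => rfl)

/-- The natural transformation `𝒴(Λ, -) → 𝒴(Λ, Ω_nc(-))`, `f ↦ θ ⊙ f`. -/
def thetaTrans : yoneda E ⟶ omega E ⋙ yoneda E where
  app Y :=
    { f n := ModuleCat.ofHom
        { toFun := fun f : YonedaHom E (stalk Λ) Y n => f.theta
          map_add' := theta_add
          map_smul' := fun b f => theta_precomp (rightMul b) f }
      comm' n m h := yonedaObj_hom_ext (fun f => by
        refine (yonedaObj_d_apply E _ h f.theta).trans ((delta_theta h f).trans ?_)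
        exact congr_arg theta (yonedaObj_d_apply E Y h f).symm) }
  naturality Y Z g := by
    ext n : 1
    exact yonedaObj_hom_ext (fun f => theta_postcomp g f)

/-- The sequence of functors `𝒴(Λ, -) → 𝒴(Λ, Ω_nc(-)) → 𝒴(Λ, Ω_nc^2(-)) → ⋯`. -/
def yonedaSequence : ℕ ⥤ CochainComplex (ModuleCat.{u} Λ) ℤ ⥤ CochainComplex (ModuleCat.{u} Λ) ℤ :=
  Functor.ofSequence (X := fun p => omegaPow E p ⋙ yoneda E)
    (fun p => Functor.whiskerLeft (omegaPow E p) (thetaTrans E))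

/-- The functor `𝒮𝒴(Λ, -)` on complexes of `Λ`-modules: the complex `𝒮𝒴(Λ, X)` is the colimit of
the sequence `𝒴(Λ, X) → 𝒴(Λ, Ω_nc(X)) → 𝒴(Λ, Ω_nc^2(X)) → ⋯`. -/
def singularYoneda :
    CochainComplex (ModuleCat.{u} Λ) ℤ ⥤ CochainComplex (ModuleCat.{u} Λ) ℤ :=
  (yonedaSequence E).flip ⋙ colim

/-! ### Compatibility with the suspension -/

/-- The morphism `Ω_nc(Σ X) → Σ Ω_nc(X)`, `s ā ⊗ x ↦ - s ā ⊗ x`. -/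
def omegaShift (X : CochainComplex (ModuleCat.{u} Λ) ℤ) :
    (omega E).obj (X⟦(1 : ℤ)⟧) ⟶ ((omega E).obj X)⟦(1 : ℤ)⟧ where
  f n := -𝟙 ((barFunctor E).obj (X.X (n + 1 + 1)))
  comm' i j _ := by
    change (-𝟙 _) ≫ (Int.negOnePow 1 • (Int.negOnePow 1 •
        (barFunctor E).map (X.d (i + 1 + 1) (j + 1 + 1)))) =
      (Int.negOnePow 1 • (barFunctor E).map (Int.negOnePow 1 • X.d (i + 1 + 1) (j + 1 + 1))) ≫
        (-𝟙 _)
    simp only [Int.negOnePow_one, Units.neg_smul, one_smul, Functor.map_neg, neg_neg,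
      Preadditive.neg_comp, Preadditive.comp_neg, Category.id_comp, Category.comp_id]

/-- The morphism `Ω_nc^p(Σ X) → Σ Ω_nc^p(X)`, `s ā_{1,p} ⊗ x ↦ (-1)^p s ā_{1,p} ⊗ x`. -/
def omegaPowShift (X : CochainComplex (ModuleCat.{u} Λ) ℤ) :
    ∀ p : ℕ, (omegaPow E p).obj (X⟦(1 : ℤ)⟧) ⟶ ((omegaPow E p).obj X)⟦(1 : ℤ)⟧
  | 0 => 𝟙 _
  | p + 1 => (omega E).map (omegaPowShift X p) ≫ omegaShift E ((omegaPow E p).obj X)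

namespace GradedHom

variable {E}
variable {X Y Z : CochainComplex (ModuleCat.{u} Λ) ℤ} {n m l : ℤ} {q : ℕ}

/-- A graded map `X → Σ Y` of degree `n`, considered as a graded map `X → Y` of degree `n + 1`. -/
def unshift (f : GradedHom E X (Y⟦(1 : ℤ)⟧) n) : GradedHom E X Y (n + 1) :=
  mk (fun i j hij => resE E (Y.XIsoOfEq (show j - 1 + 1 = j by lia)).hom ∘ₗ
    f.v i (j - 1) (by lia))

lemma unshift_v (f : GradedHom E X (Y⟦(1 : ℤ)⟧) n) (i j : ℤ) (h : i + (n + 1) = j + 1)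
    (h' : i + n = j) :
    f.unshift.v i (j + 1) h = (show X.X i →ₗ[E] Y.X (j + 1) from f.v i j h') := by
  have : ∀ (k : ℤ) (hk : k = j) (hk' : k + 1 = j + 1),
      resE E (Y.XIsoOfEq hk').hom ∘ₗ f.v i k (by lia) =
        (show X.X i →ₗ[E] Y.X (j + 1) from f.v i j h') := by
    rintro k rfl hk'
    rw [HomologicalComplex.XIsoOfEq_rfl]
    rfl
  exact this (j + 1 - 1) (by lia) (by lia)

lemma unshift_add (f g : GradedHom E X (Y⟦(1 : ℤ)⟧) n) :
    (f + g).unshift = f.unshift + g.unshift := by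
  ext1 i j hij
  obtain ⟨j, rfl⟩ : ∃ k, j = k + 1 := ⟨j - 1, by lia⟩
  rw [add_v, unshift_v _ _ _ _ (by lia), unshift_v _ _ _ _ (by lia), unshift_v _ _ _ _ (by lia)]
  rfl

lemma unshift_precomp (g : Z ⟶ X) (f : GradedHom E X (Y⟦(1 : ℤ)⟧) n) :
    (f.precomp g).unshift = f.unshift.precomp g := rfl

lemma unshift_postcomp (g : Y ⟶ Z) (f : GradedHom E X (Y⟦(1 : ℤ)⟧) n) :
    (f.postcomp (g⟦(1 : ℤ)⟧')).unshift = f.unshift.postcomp g := by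
  ext1 i j hij
  obtain ⟨j, rfl⟩ : ∃ k, j = k + 1 := ⟨j - 1, by lia⟩
  rw [postcomp_v, unshift_v _ _ _ _ (by lia), unshift_v _ _ _ _ (by lia)]
  rfl

lemma resE_shift_d (i j : ℤ) : resE E ((Y⟦(1 : ℤ)⟧).d i j) =
    (show Y.X (i + 1) →ₗ[E] Y.X (j + 1) from - resE E (Y.d (i + 1) (j + 1))) := by
  have : (Y⟦(1 : ℤ)⟧).d i j = - Y.d (i + 1) (j + 1) := by
    change Int.negOnePow 1 • Y.d (i + 1) (j + 1) = _
    rw [Int.negOnePow_one, Units.neg_smul, one_smul]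
  rw [this]
  rfl

lemma neg_sub_units_smul {M : Type u} [AddCommGroup M] (a b : M) (ε : ℤˣ) :
    -a - ε • b = -(a - (-ε) • b) := by
  rw [Units.neg_smul, sub_neg_eq_add, neg_add, sub_eq_add_neg]

lemma unshift_deltaIn (h : n + 1 = m) (h' : n + 1 + 1 = m + 1)
    (f : GradedHom E X (Y⟦(1 : ℤ)⟧) n) :
    (f.deltaIn h).unshift = - f.unshift.deltaIn h' := by
  ext1 i j hij
  obtain ⟨j, rfl⟩ : ∃ k, j = k + 1 + 1 := ⟨j - 2, by lia⟩
  rw [neg_v, unshift_v _ _ _ _ (by lia), deltaIn_v h _ i (j + 1) _ j (i + 1) (by lia) rfl,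
    deltaIn_v h' _ i (j + 1 + 1) _ (j + 1) (i + 1) (by lia) rfl, unshift_v _ _ _ _ (by lia),
    unshift_v _ _ _ _ (by lia), resE_shift_d]
  rw [Int.negOnePow_succ]
  exact neg_sub_units_smul (M := X.X i →ₗ[E] Y.X (j + 1 + 1))
    (resE E (Y.d (j + 1) (j + 1 + 1)) ∘ₗ (show X.X i →ₗ[E] Y.X (j + 1) from f.v i j (by lia)))
    ((show X.X (i + 1) →ₗ[E] Y.X (j + 1 + 1) from f.v (i + 1) (j + 1) (by lia)) ∘ₗ
      resE E (X.d i (i + 1))) n.negOnePow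

lemma unshift_deltaEx (h : n + 1 = m) (h' : n + 1 + 1 = m + 1)
    (f : GradedHom E X (Y⟦(1 : ℤ)⟧) n) :
    (f.deltaEx h).unshift = - f.unshift.deltaEx h' := by
  ext1 i j hij
  obtain ⟨j, rfl⟩ : ∃ k, j = k + 1 := ⟨j - 1, by lia⟩
  rw [neg_v, unshift_v _ _ _ _ (by lia), deltaEx_v, deltaEx_v, unshift_v _ _ _ _ (by lia),
    Int.negOnePow_succ, Units.neg_smul, neg_neg]
  rfl

lemma unshift_deltaExPow (h : n + 1 = m) (h' : n + 1 + 1 = m + 1)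
    (f : GradedHom E ((omegaPow E q).obj X) (Y⟦(1 : ℤ)⟧) n) :
    (f.deltaExPow h).unshift = - f.unshift.deltaExPow h' := unshift_deltaEx h h' f

lemma unshift_zero : (0 : GradedHom E X (Y⟦(1 : ℤ)⟧) n).unshift = 0 :=
  (AddMonoidHom.mk' (unshift (E := E) (X := X) (Y := Y) (n := n)) unshift_add).map_zero

lemma postcomp_zero (g : Y ⟶ Z) : (0 : GradedHom E X Y n).postcomp g = 0 :=
  (AddMonoidHom.mk' (postcomp (E := E) (X := X) (n := n) g) (postcomp_add g)).map_zero

lemma unshift_sTensor (f : GradedHom E X (Y⟦(1 : ℤ)⟧) n) :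
    (f.sTensor.postcomp (omegaShift E Y)).unshift = f.unshift.sTensor := by
  ext1 i j hij
  obtain ⟨j, rfl⟩ : ∃ k, j = k + 1 := ⟨j - 1, by lia⟩
  rw [unshift_v _ _ _ _ (by lia), postcomp_v, sTensor_v, sTensor_v,
    unshift_v _ _ _ _ (by lia), Int.negOnePow_succ, Units.neg_smul]
  have : ∀ g : ((omega E).obj X).X i →ₗ[E] ((omega E).obj (Y⟦(1 : ℤ)⟧)).X j,
      resE E ((omegaShift E Y).f j) ∘ₗ g =
        (show ((omega E).obj X).X i →ₗ[E] ((omega E).obj Y).X (j + 1) from - g) :=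
    fun g => rfl
  rw [this]
  rfl

end GradedHom

namespace YonedaHom

variable {E}
variable {X Y Z : CochainComplex (ModuleCat.{u} Λ) ℤ} {n m : ℤ}

/-- The bijection `𝒴(X, Σ Y)^n = 𝒴(X, Y)^{n + 1}`. -/
def unshift (f : YonedaHom E X (Y⟦(1 : ℤ)⟧) n) : YonedaHom E X Y (n + 1) :=
  fun q => (f.comp q).unshift

@[simp] lemma unshift_comp (f : YonedaHom E X (Y⟦(1 : ℤ)⟧) n) (q : ℕ) :
    f.unshift.comp q = (f.comp q).unshift := rfl

lemma unshift_add (f g : YonedaHom E X (Y⟦(1 : ℤ)⟧) n) :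
    (f + g).unshift = f.unshift + g.unshift :=
  ext (fun q => GradedHom.unshift_add (f.comp q) (g.comp q))

lemma unshift_precomp (g : Z ⟶ X) (f : YonedaHom E X (Y⟦(1 : ℤ)⟧) n) :
    (f.precomp g).unshift = f.unshift.precomp g := rfl

lemma unshift_postcomp (g : Y ⟶ Z) (f : YonedaHom E X (Y⟦(1 : ℤ)⟧) n) :
    (f.postcomp (g⟦(1 : ℤ)⟧')).unshift = f.unshift.postcomp g :=
  ext (fun q => GradedHom.unshift_postcomp g (f.comp q))

lemma unshift_delta (h : n + 1 = m) (h' : n + 1 + 1 = m + 1)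
    (f : YonedaHom E X (Y⟦(1 : ℤ)⟧) n) :
    (f.delta h).unshift = - f.unshift.delta h' := by
  refine ext (fun q => ?_)
  cases q with
  | zero => exact GradedHom.unshift_deltaIn h h' (f.comp 0)
  | succ q =>
    refine (GradedHom.unshift_add _ _).trans ?_
    rw [GradedHom.unshift_deltaIn h h' (f.comp (q + 1)),
      GradedHom.unshift_deltaExPow h h' (f.comp q)]
    exact (neg_add _ _).symm

lemma unshift_theta (f : YonedaHom E X (Y⟦(1 : ℤ)⟧) n) :
    (f.theta.postcomp (omegaShift E Y)).unshift = f.unshift.theta := by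
  refine ext (fun q => ?_)
  cases q with
  | zero =>
    change GradedHom.unshift (GradedHom.postcomp (omegaShift E Y) 0) = 0
    rw [GradedHom.postcomp_zero, GradedHom.unshift_zero]
  | succ q => exact GradedHom.unshift_sTensor (f.comp q)

end YonedaHom

/-- The isomorphism `𝒴(Λ, Σ Y) → Σ 𝒴(Λ, Y)`. -/
def yonedaShift (Y : CochainComplex (ModuleCat.{u} Λ) ℤ) :
    (yoneda E).obj (Y⟦(1 : ℤ)⟧) ⟶ ((yoneda E).obj Y)⟦(1 : ℤ)⟧ where
  f n := ModuleCat.ofHom (Y := YonedaHom E (stalk Λ) Y (n + 1))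
    { toFun := fun f : YonedaHom E (stalk Λ) (Y⟦(1 : ℤ)⟧) n => f.unshift
      map_add' := unshift_add
      map_smul' := fun b f => rfl }
  comm' n m h := yonedaObj_hom_ext (fun f => by
    change n + 1 = m at h
    have h' : n + 1 + 1 = m + 1 := by lia
    have e₁ : (((yoneda E).obj Y)⟦(1 : ℤ)⟧).d n m = - (yonedaObj E Y).d (n + 1) (m + 1) := by
      change Int.negOnePow 1 • (yonedaObj E Y).d (n + 1) (m + 1) = _
      rw [Int.negOnePow_one, Units.neg_smul, one_smul]
    rw [e₁]
    change - ((yonedaObj E Y).d (n + 1) (m + 1)).hom f.unshift =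
      unshift (((yonedaObj E (Y⟦(1 : ℤ)⟧)).d n m).hom f)
    refine (congr_arg Neg.neg (yonedaObj_d_apply E Y h' f.unshift)).trans ?_
    refine (unshift_delta h h' f).symm.trans ?_
    exact congr_arg unshift (yonedaObj_d_apply E (Y⟦(1 : ℤ)⟧) h f).symm)

lemma yonedaShift_naturality {Y Z : CochainComplex (ModuleCat.{u} Λ) ℤ} (g : Y ⟶ Z) :
    (yoneda E).map (g⟦(1 : ℤ)⟧') ≫ yonedaShift E Z =
      yonedaShift E Y ≫ ((yoneda E).map g)⟦(1 : ℤ)⟧' := by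
  ext n : 1
  exact yonedaObj_hom_ext (fun f => unshift_postcomp g f)

lemma thetaTrans_shift (Y : CochainComplex (ModuleCat.{u} Λ) ℤ) :
    (thetaTrans E).app (Y⟦(1 : ℤ)⟧) ≫ (yoneda E).map (omegaShift E Y) ≫
      yonedaShift E ((omega E).obj Y) = yonedaShift E Y ≫ ((thetaTrans E).app Y)⟦(1 : ℤ)⟧' := by
  ext n : 1
  exact yonedaObj_hom_ext (fun f => unshift_theta f)

/-- The canonical morphism `𝒴(Λ, Ω_nc^p(X)) → 𝒮𝒴(Λ, X)`, `f ↦ [f; p]`. -/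
def toSingularYoneda (X : CochainComplex (ModuleCat.{u} Λ) ℤ) (p : ℕ) :
    (yoneda E).obj ((omegaPow E p).obj X) ⟶ (singularYoneda E).obj X :=
  colimit.ι ((yonedaSequence E).flip.obj X) p

lemma yonedaSequence_flip_map (X : CochainComplex (ModuleCat.{u} Λ) ℤ) (p : ℕ) :
    ((yonedaSequence E).flip.obj X).map (homOfLE (Nat.le_add_right p 1)) =
      (thetaTrans E).app ((omegaPow E p).obj X) :=
  NatTrans.congr_app (Functor.ofSequence_map_homOfLE_succ
    (X := fun p => omegaPow E p ⋙ yoneda E)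
    (fun p => Functor.whiskerLeft (omegaPow E p) (thetaTrans E)) p) X

lemma thetaTrans_toSingularYoneda (X : CochainComplex (ModuleCat.{u} Λ) ℤ) (p : ℕ) :
    (thetaTrans E).app ((omegaPow E p).obj X) ≫ toSingularYoneda E X (p + 1) =
      toSingularYoneda E X p :=
  (congr_arg (· ≫ toSingularYoneda E X (p + 1)) (yonedaSequence_flip_map E X p).symm).trans
    (colimit.w ((yonedaSequence E).flip.obj X) (homOfLE (Nat.le_add_right p 1)))

/-- The morphism `𝒴(Λ, Ω_nc^p(Σ X)) → Σ 𝒮𝒴(Λ, X)`, `f ↦ [(-1)^p f; p]`. -/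
def toSingularYonedaShift (X : CochainComplex (ModuleCat.{u} Λ) ℤ) (p : ℕ) :
    (yoneda E).obj ((omegaPow E p).obj (X⟦(1 : ℤ)⟧)) ⟶ ((singularYoneda E).obj X)⟦(1 : ℤ)⟧ :=
  (yoneda E).map (omegaPowShift E X p) ≫ yonedaShift E ((omegaPow E p).obj X) ≫
    (toSingularYoneda E X p)⟦(1 : ℤ)⟧'

lemma thetaTrans_toSingularYonedaShift (X : CochainComplex (ModuleCat.{u} Λ) ℤ) (p : ℕ) :
    (thetaTrans E).app ((omegaPow E p).obj (X⟦(1 : ℤ)⟧)) ≫ toSingularYonedaShift E X (p + 1) =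
      toSingularYonedaShift E X p := by
  have e₁ : (thetaTrans E).app ((omegaPow E p).obj (X⟦(1 : ℤ)⟧)) ≫
      (yoneda E).map ((omega E).map (omegaPowShift E X p)) =
      (yoneda E).map (omegaPowShift E X p) ≫
        (thetaTrans E).app (((omegaPow E p).obj X)⟦(1 : ℤ)⟧) :=
    ((thetaTrans E).naturality (omegaPowShift E X p)).symm
  have e₂ := thetaTrans_shift E ((omegaPow E p).obj X)
  have e₃ : ((thetaTrans E).app ((omegaPow E p).obj X))⟦(1 : ℤ)⟧' ≫
      (toSingularYoneda E X (p + 1))⟦(1 : ℤ)⟧' = (toSingularYoneda E X p)⟦(1 : ℤ)⟧' :=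
    (Functor.map_comp _ _ _).symm.trans
      (congr_arg (fun k => k⟦(1 : ℤ)⟧') (thetaTrans_toSingularYoneda E X p))
  calc
    _ = ((thetaTrans E).app ((omegaPow E p).obj (X⟦(1 : ℤ)⟧)) ≫
          (yoneda E).map ((omega E).map (omegaPowShift E X p))) ≫
          (yoneda E).map (omegaShift E ((omegaPow E p).obj X)) ≫
          yonedaShift E ((omega E).obj ((omegaPow E p).obj X)) ≫
          (toSingularYoneda E X (p + 1))⟦(1 : ℤ)⟧' := by
      rw [Category.assoc, ← Functor.map_comp_assoc]
      rfl
    _ = (yoneda E).map (omegaPowShift E X p) ≫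
          (yonedaShift E ((omegaPow E p).obj X) ≫
            ((thetaTrans E).app ((omegaPow E p).obj X))⟦(1 : ℤ)⟧') ≫
          (toSingularYoneda E X (p + 1))⟦(1 : ℤ)⟧' := by
      rw [e₁, ← e₂]
      simp only [Category.assoc]
    _ = _ := by
      rw [toSingularYonedaShift, ← e₃]
      simp only [Category.assoc]

/-- The canonical morphism `𝒮𝒴(Λ, Σ X) → Σ 𝒮𝒴(Λ, X)`, `[f; p] ↦ [(-1)^p f; p]`. -/
def singularYonedaShift (X : CochainComplex (ModuleCat.{u} Λ) ℤ) :
    (singularYoneda E).obj (X⟦(1 : ℤ)⟧) ⟶ ((singularYoneda E).obj X)⟦(1 : ℤ)⟧ :=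
  colimit.desc ((yonedaSequence E).flip.obj (X⟦(1 : ℤ)⟧))
    { pt := ((singularYoneda E).obj X)⟦(1 : ℤ)⟧
      ι := NatTrans.ofSequence (toSingularYonedaShift E X)
        (fun p => by
          refine Eq.trans ?_ (Category.comp_id _).symm
          refine Eq.trans ?_ (thetaTrans_toSingularYonedaShift E X p)
          exact congr_arg (· ≫ toSingularYonedaShift E X (p + 1))
            (yonedaSequence_flip_map E (X⟦(1 : ℤ)⟧) p)) }

lemma toSingularYoneda_shift (X : CochainComplex (ModuleCat.{u} Λ) ℤ) (p : ℕ) :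
    toSingularYoneda E (X⟦(1 : ℤ)⟧) p ≫ singularYonedaShift E X =
      (yoneda E).map (omegaPowShift E X p) ≫ yonedaShift E ((omegaPow E p).obj X) ≫
        (toSingularYoneda E X p)⟦(1 : ℤ)⟧' :=
  colimit.ι_desc _ p

end Yoneda

/-! ### The homotopy category of acyclic complexes of injective modules -/

section Homotopy

variable (Λ : Type u) [Ring Λ]

/-- The complexes of injective `Λ`-modules, as objects of the homotopy category. -/
def injectiveTerms : ObjectProperty (HomotopyCategory (ModuleCat.{u} Λ) (ComplexShape.up ℤ)) :=
  fun K => ∀ n : ℤ, Injective (K.as.X n)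

lemma injectiveTerms_quotient (K : CochainComplex (ModuleCat.{u} Λ) ℤ)
    (h : ∀ n, Injective (K.X n)) :
    injectiveTerms Λ ((HomotopyCategory.quotient _ _).obj K) := h

instance : (injectiveTerms Λ).IsStableUnderShift ℤ where
  isStableUnderShiftBy n := ⟨fun K hK => by
    change injectiveTerms Λ (((HomotopyCategory.quotient _ _).obj K.as)⟦n⟧)
    rw [HomotopyCategory.shift_quotient_obj]
    exact injectiveTerms_quotient Λ _ (fun i => hK (i + n))⟩

instance : (injectiveTerms Λ).ContainsZero where
  exists_zero := ⟨(HomotopyCategory.quotient _ _).obj HomologicalComplex.zero,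
    Functor.map_isZero _ HomologicalComplex.isZero_zero,
    injectiveTerms_quotient Λ _ (fun _ => (isZero_zero (ModuleCat.{u} Λ)).injective)⟩

instance : (injectiveTerms Λ).IsTriangulatedClosed₃ where
  ext₃' T hT h₁ h₂ := by
    obtain ⟨f, hf⟩ := (HomotopyCategory.quotient (ModuleCat.{u} Λ)
      (ComplexShape.up ℤ)).map_surjective (X := T.obj₁.as) (Y := T.obj₂.as) T.mor₁
    have e := isoTriangleOfIso₁₂ T (CochainComplex.mappingCone.triangleh f) hT
      (HomotopyCategory.mappingCone_triangleh_distinguished f) (Iso.refl _) (Iso.refl _) (by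
        refine (Category.comp_id _).trans ?_
        refine hf.symm.trans (Category.id_comp _).symm)
    refine ⟨_, injectiveTerms_quotient Λ (CochainComplex.mappingCone f) (fun n => ?_),
      ⟨Triangle.π₃.mapIso e⟩⟩
    have := h₁ (n + 1)
    have := h₂ n
    exact Injective.of_iso (HomologicalComplex.homotopyCofiber.XIsoBiprod f n (n + 1) rfl).symm
      inferInstance

instance : (injectiveTerms Λ).IsTriangulated where
  toIsTriangulatedClosed₂ := .of_isTriangulatedClosed₃

/-- The homotopy category `K_ac(Λ-Inj)` of acyclic complexes of injective `Λ`-modules, as a full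
triangulated subcategory of the homotopy category of complexes of `Λ`-modules. -/
abbrev acyclicInjectives :
    ObjectProperty (HomotopyCategory (ModuleCat.{u} Λ) (ComplexShape.up ℤ)) :=
  HomotopyCategory.subcategoryAcyclic (ModuleCat.{u} Λ) ⊓ injectiveTerms Λ


end Homotopy

end

end SingularYoneda

open SingularYoneda

/-!
# The singular Yoneda complex and complexes of injective modules

All three parts of the theorem come from one observation: the functor `𝒮𝒴(Λ, -)` is defined not
only on cochain maps, but on all graded `E`-linear maps `φ : Y → Z` of arbitrary degree, via
`[f; p] ↦ [((s Λ̄)^{⊗ p} ⊗ φ) ∘ f; p]` (`gradedMap`). This is functorial (`gradedMap_gcomp`), and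
the differentials `δ_in` and `δ_ex` are derivations for the composition of graded maps
(`GradedHom.deltaIn_gcomp`, `GradedHom.deltaEx_gcomp`). The map `δ_ex(φ)` measures the failure of
`φ` to be `Λ`-linear; when it vanishes, the boundary of `gradedMap φ` is `gradedMap (δ_in φ)`
(`gradedMap_d`).

*Contractibility.* As `E` is semisimple, an acyclic complex `X` has an `E`-linear contraction `h`.
The boundary of the map on `𝒮𝒴(Λ, X)` induced by `h` is given at each stage by
`f ↦ f + δ_ex(h) ⊙ f`. The second term raises the filtration degree `q` by one, so that this map is
invertible on the product `∏_q 𝒴_q` (`unipotent_surjective`, `unipotent_injective`). Hence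
`𝒮𝒴(Λ, X)` has an automorphism which is null-homotopic through `Λ`-linear maps
(`nonempty_homotopy_of_acyclic`).

*Acyclicity.* Each transition map `𝒴(Λ, Y) → 𝒴(Λ, Ω_nc(Y))` is zero in cohomology
(`exists_theta_eq_delta`). Indeed, the contraction `barContraction` of the bar resolution of `Λ`
shows that a cocycle is cohomologous to one which is concentrated in filtration degree zero,
i.e. to a `Λ`-linear map `u`. The image of `u` is up to a sign the coboundary of `x ↦ s x̄ ⊗ u(1)`.

*Injectivity.* The term in degree `i` of `Ω_nc^q(M)` is, as a functor of the module `M`, of the form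
`T(Λ) ⊗_Λ M` (`isTensorLike_omegaPowTerm`). Therefore `Hom_Λ(-, Hom_E(T(Λ), N))` is
`Hom_E(T(-), N)`, which is exact as `E` is semisimple, and the terms of `𝒴(Λ, Y)` are injective
(`baer_yonedaHom`). Over the noetherian ring `Λ`, injectivity passes to the sequential colimit
(`injective_singularYoneda_X`).

*The triangle functor.* Since `𝒮𝒴(Λ, -)` acts on all cochains of `Λ`-linear maps (`cochainMap`), it
commutes with shifts: the identity of the graded module of `X` is a closed cochain `X⟦a⟧ → X` of
degree `a`, whose image is the isomorphism `shiftIso`. For the same reason it preserves the cochains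
which characterize a mapping cone, hence mapping cones and standard triangles (`mapTriangleIso`).
A quasi-isomorphism has an acyclic cone, which is sent to a contractible complex, so
`𝒮𝒴(Λ, -)` inverts quasi-isomorphisms up to homotopy and descends to the derived category
(`derivedSingularYoneda`).
-/


namespace SingularYoneda

noncomputable section

open CochainComplex.HomComplex YonedaHom

/-! ### The calculus of graded maps -/

section GradedCalculus

variable {Λ : Type u} [Ring Λ] {E : Subring Λ}

namespace BarTensor

variable {M N P : Type u} [AddCommGroup M] [Module Λ M] [AddCommGroup N] [Module Λ N]
  [AddCommGroup P] [Module Λ P]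

/-- The defect of `Λ`-linearity `cobd` is a derivation with respect to composition. -/
lemma cobd_comp (g : N →ₗ[E] P) (f : M →ₗ[E] N) :
    cobd (g ∘ₗ f) = g ∘ₗ cobd f + cobd g ∘ₗ map f :=
  hom_ext (fun a m => by simp)

lemma cobd_resE_eq_zero {M N : ModuleCat.{u} Λ} (f : M ⟶ N) : cobd (resE E f) = 0 :=
  hom_ext (fun a m => by simp)

lemma map_id : map (LinearMap.id : M →ₗ[E] M) = LinearMap.id :=
  hom_ext (fun a m => by simp)

end BarTensor

lemma cobdX_comp {X Y : CochainComplex (ModuleCat.{u} Λ) ℤ} {i j : ℤ} {N : ModuleCat.{u} Λ}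
    (g : Y.X (j + 1) →ₗ[E] N) (f : X.X (i + 1) →ₗ[E] Y.X (j + 1)) :
    cobdX (g ∘ₗ f) = g ∘ₗ cobdX f + cobdX g ∘ₗ mapX f :=
  BarTensor.cobd_comp g f

namespace GradedHom

variable {X Y Z W : CochainComplex (ModuleCat.{u} Λ) ℤ} {a b c n m l k : ℤ}

/-- The composition `g ∘ f` of graded maps. -/
def gcomp (g : GradedHom E Y Z b) (f : GradedHom E X Y a) (h : a + b = c) : GradedHom E X Z c :=
  mk (fun i j hij => g.v (i + a) j (by lia) ∘ₗ f.v i (i + a) rfl)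

lemma gcomp_v (g : GradedHom E Y Z b) (f : GradedHom E X Y a) (h : a + b = c) (i j k : ℤ)
    (hij : i + a = j) (hjk : j + b = k) (hik : i + c = k) :
    (g.gcomp f h).v i k hik = g.v j k hjk ∘ₗ f.v i j hij := by
  subst hij
  rfl

lemma gcomp_add (g : GradedHom E Y Z b) (f f' : GradedHom E X Y a) (h : a + b = c) :
    g.gcomp (f + f') h = g.gcomp f h + g.gcomp f' h := by
  ext1 i j hij
  rw [add_v, gcomp_v _ _ h i _ j rfl (by lia), gcomp_v _ _ h i _ j rfl (by lia),
    gcomp_v _ _ h i _ j rfl (by lia), add_v, LinearMap.comp_add]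

lemma add_gcomp (g g' : GradedHom E Y Z b) (f : GradedHom E X Y a) (h : a + b = c) :
    (g + g').gcomp f h = g.gcomp f h + g'.gcomp f h := by
  ext1 i j hij
  rw [add_v, gcomp_v _ _ h i _ j rfl (by lia), gcomp_v _ _ h i _ j rfl (by lia),
    gcomp_v _ _ h i _ j rfl (by lia), add_v, LinearMap.add_comp]

lemma gcomp_zero (g : GradedHom E Y Z b) (h : a + b = c) :
    g.gcomp (0 : GradedHom E X Y a) h = 0 :=
  (AddMonoidHom.mk' (fun f : GradedHom E X Y a => g.gcomp f h)
    (fun f f' => gcomp_add g f f' h)).map_zero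

lemma gcomp_neg (g : GradedHom E Y Z b) (f : GradedHom E X Y a) (h : a + b = c) :
    g.gcomp (-f) h = - g.gcomp f h :=
  (AddMonoidHom.mk' (fun f : GradedHom E X Y a => g.gcomp f h)
    (fun f f' => gcomp_add g f f' h)).map_neg f

lemma zero_gcomp (f : GradedHom E X Y a) (h : a + b = c) :
    (0 : GradedHom E Y Z b).gcomp f h = 0 :=
  (AddMonoidHom.mk' (fun g : GradedHom E Y Z b => g.gcomp f h)
    (fun g g' => add_gcomp g g' f h)).map_zero

lemma gcomp_assoc {ab bc abc : ℤ} (k : GradedHom E Z W c) (g : GradedHom E Y Z b)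
    (f : GradedHom E X Y a) (h : a + b = ab) (h' : b + c = bc) (h₁ : ab + c = abc)
    (h₂ : a + bc = abc) :
    k.gcomp (g.gcomp f h) h₁ = (k.gcomp g h').gcomp f h₂ := by
  ext1 i j hij
  rw [gcomp_v _ _ h₁ i (i + ab) j rfl (by lia), gcomp_v _ _ h i (i + a) _ rfl (by lia),
    gcomp_v _ _ h₂ i (i + a) j rfl (by lia), gcomp_v _ _ h' (i + a) (i + ab) j (by lia) (by lia),
    LinearMap.comp_assoc]

lemma gcomp_precomp (g : GradedHom E Y Z b) (f : GradedHom E X Y a) (h : a + b = c)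
    (r : W ⟶ X) : g.gcomp (f.precomp r) h = (g.gcomp f h).precomp r := by
  ext1 i j hij
  rw [precomp_v, gcomp_v _ _ h i (i + a) j rfl (by lia), gcomp_v _ _ h i (i + a) j rfl (by lia),
    precomp_v, LinearMap.comp_assoc]

/-- The internal differential is a derivation. -/
lemma deltaIn_gcomp (g : GradedHom E Y Z b) (f : GradedHom E X Y a) (h : a + b = c)
    {a' b' c' : ℤ} (ha : a + 1 = a') (hb : b + 1 = b') (hc : c + 1 = c') :
    (g.gcomp f h).deltaIn hc =
      (g.deltaIn hb).gcomp f (by lia) + b.negOnePow • g.gcomp (f.deltaIn ha) (by lia) := by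
  ext1 i j hij
  have e : ∀ (ε : ℤˣ) (k : GradedHom E X Z c'), (ε • k).v i j hij = ε • k.v i j hij :=
    fun _ _ => rfl
  rw [add_v, e, deltaIn_v hc _ i j _ (j - 1) (i + 1) (by lia) rfl,
    gcomp_v _ _ h i (i + a) (j - 1) rfl (by lia),
    gcomp_v _ _ h (i + 1) (i + a') j (by lia) (by lia),
    gcomp_v _ _ _ i (i + a) j rfl (by lia), gcomp_v _ _ _ i (i + a') j rfl (by lia),
    deltaIn_v hb _ (i + a) j _ (j - 1) (i + a') (by lia) (by lia),
    deltaIn_v ha _ i (i + a') _ (i + a) (i + 1) (by lia) (by lia)]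
  subst ha
  simp only [LinearMap.comp_sub, LinearMap.sub_comp, LinearMap.comp_assoc]
  have hc : c.negOnePow = b.negOnePow * a.negOnePow := by rw [← h, Int.negOnePow_add, mul_comm]
  obtain h | h := Int.units_eq_one_or a.negOnePow <;>
  obtain h' | h' := Int.units_eq_one_or b.negOnePow <;>
  simp [hc, h, h', LinearMap.comp_assoc, LinearMap.comp_neg, LinearMap.neg_comp,
    -ModuleCat.hom_comp] <;> abel

/-- The external differential is a derivation: as it changes the source of a graded map from `X` to
`Ω_nc(X)`, the inner map has to be replaced by its image under `s Λ̄ ⊗ -` in the first term. -/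
lemma deltaEx_gcomp (g : GradedHom E Y Z b) (f : GradedHom E X Y a) (h : a + b = c)
    {a' b' c' : ℤ} (ha : a + 1 = a') (hb : b + 1 = b') (hc : c + 1 = c') :
    (g.gcomp f h).deltaEx hc =
      (g.deltaEx hb).gcomp f.sTensor (by lia) +
        b.negOnePow • g.gcomp (f.deltaEx ha) (by lia) := by
  ext1 i j hij
  have e : ∀ (ε : ℤˣ) (k : GradedHom E ((omega E).obj X) Z c'),
    (ε • k).v i j hij = ε • k.v i j hij := fun _ _ => rfl
  rw [add_v, e, deltaEx_v, gcomp_v _ _ h (i + 1) (i + a + 1) j (by lia) (by lia),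
    gcomp_v _ _ _ i (i + a) j rfl (by lia), gcomp_v _ _ _ i (i + a + 1) j (by lia) (by lia),
    deltaEx_v, deltaEx_v, sTensor_v]
  rw [cobdX_comp]
  have hc : c'.negOnePow = -(b.negOnePow * a.negOnePow) := by
    rw [← hc, ← h, Int.negOnePow_succ, Int.negOnePow_add, mul_comm]
  have hb' : b'.negOnePow = - b.negOnePow := by rw [← hb, Int.negOnePow_succ]
  have ha' : a'.negOnePow = - a.negOnePow := by rw [← ha, Int.negOnePow_succ]
  rw [hb', ha', hc]
  obtain h | h := Int.units_eq_one_or a.negOnePow <;>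
  obtain h' | h' := Int.units_eq_one_or b.negOnePow <;>
  simp only [h, h', LinearMap.comp_neg, LinearMap.neg_comp, Units.neg_smul, one_smul, mul_one,
    mul_neg, neg_neg, neg_add] <;> exact add_comm _ _

lemma sTensor_gcomp (g : GradedHom E Y Z b) (f : GradedHom E X Y a) (h : a + b = c) :
    (g.gcomp f h).sTensor = g.sTensor.gcomp f.sTensor h := by
  ext1 i j hij
  rw [sTensor_v, gcomp_v _ _ h (i + 1) (i + a + 1) (j + 1) (by lia) (by lia),
    gcomp_v _ _ h i (i + a) j rfl (by lia), sTensor_v, sTensor_v, mapX_comp]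
  have hc : c.negOnePow = b.negOnePow * a.negOnePow := by rw [← h, Int.negOnePow_add, mul_comm]
  obtain h | h := Int.units_eq_one_or a.negOnePow <;>
  obtain h' | h' := Int.units_eq_one_or b.negOnePow <;>
  simp [hc, h, h', LinearMap.comp_neg, LinearMap.neg_comp]

lemma sTensor_neg (f : GradedHom E X Y a) : (-f).sTensor = - f.sTensor :=
  (AddMonoidHom.mk' (fun f : GradedHom E X Y a => f.sTensor) sTensor_add).map_neg f

lemma sTensor_zero : (0 : GradedHom E X Y a).sTensor = 0 :=
  (AddMonoidHom.mk' (fun f : GradedHom E X Y a => f.sTensor) sTensor_add).map_zero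

variable (E) in
/-- The graded map underlying a cochain of `Λ`-linear maps. -/
def ofCochain (φ : Cochain X Y n) : GradedHom E X Y n := mk (fun i j hij => resE E (φ.v i j hij))

@[simp] lemma ofCochain_v (φ : Cochain X Y n) (i j : ℤ) (hij : i + n = j) :
    (ofCochain E φ).v i j hij = resE E (φ.v i j hij) := rfl

lemma ofCochain_add (φ ψ : Cochain X Y n) :
    ofCochain E (φ + ψ) = ofCochain E φ + ofCochain E ψ := rfl

lemma ofCochain_neg (φ : Cochain X Y n) : ofCochain E (-φ) = - ofCochain E φ := rfl

lemma ofCochain_comp (φ : Cochain X Y a) (ψ : Cochain Y Z b) (h : a + b = c) :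
    ofCochain E (φ.comp ψ h) = (ofCochain E ψ).gcomp (ofCochain E φ) h := by
  ext1 i j hij
  rw [gcomp_v _ _ h i (i + a) j rfl (by lia), ofCochain_v, ofCochain_v, ofCochain_v,
    Cochain.comp_v _ _ h i (i + a) j rfl (by lia)]
  rfl

lemma deltaEx_ofCochain (φ : Cochain X Y n) (h : n + 1 = m) : (ofCochain E φ).deltaEx h = 0 := by
  ext1 i j hij
  rw [deltaEx_v, ofCochain_v]
  have : cobdX (resE E (φ.v (i + 1) j (by lia))) = 0 := BarTensor.cobd_resE_eq_zero _
  rw [this, smul_zero, zero_v]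

lemma deltaIn_ofCochain (φ : Cochain X Y n) (h : n + 1 = m) :
    (ofCochain E φ).deltaIn h = ofCochain E (δ n m φ) := by
  ext1 i j hij
  rw [deltaIn_v h _ i j _ (j - 1) (i + 1) (by lia) rfl, ofCochain_v, ofCochain_v, ofCochain_v,
    δ_v n m h φ i j _ (j - 1) (i + 1) rfl rfl]
  subst h
  rw [Int.negOnePow_succ]
  obtain h | h := Int.units_eq_one_or n.negOnePow <;>
  simp [h, sub_eq_add_neg] <;> rfl

variable (E) in
/-- The graded map of degree `0` underlying a cochain map. -/
abbrev ofHom (f : X ⟶ Y) : GradedHom E X Y 0 := ofCochain E (Cochain.ofHom f)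

lemma ofHom_gcomp (f : X ⟶ Y) (g : GradedHom E Z X n) :
    (ofHom E f).gcomp g (add_zero n) = g.postcomp f := by
  ext1 i j hij
  obtain rfl : i + n = j := hij
  rw [gcomp_v _ _ (add_zero n) i _ _ rfl (add_zero _)]
  simp

lemma gcomp_ofHom (f : X ⟶ Y) (g : GradedHom E Y Z n) :
    g.gcomp (ofHom E f) (zero_add n) = g.precomp f := by
  ext1 i j hij
  rw [gcomp_v _ _ (zero_add n) i i j (add_zero _) hij]
  simp

lemma sTensor_ofHom (f : X ⟶ Y) : (ofHom E f).sTensor = ofHom E ((omega E).map f) := by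
  ext1 i j hij
  obtain rfl : i = j := by lia
  rw [sTensor_v, Int.negOnePow_zero, one_smul]
  simp only [ofCochain_v, Cochain.ofHom_v, omega_map_f]

lemma id_gcomp (f : GradedHom E X Y n) : (ofHom E (𝟙 Y)).gcomp f (add_zero n) = f := by
  rw [ofHom_gcomp]
  rfl

lemma gcomp_id (f : GradedHom E X Y n) : f.gcomp (ofHom E (𝟙 X)) (zero_add n) = f := by
  rw [gcomp_ofHom]
  rfl

/-- The graded map `(s Λ̄)^{⊗ p} ⊗ f : Ω_nc^p(X) → Ω_nc^p(Y)` attached to a graded map `f`. -/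
def sPow (f : GradedHom E X Y n) :
    ∀ p : ℕ, GradedHom E ((omegaPow E p).obj X) ((omegaPow E p).obj Y) n
  | 0 => f
  | p + 1 => (sPow f p).sTensor

lemma sPow_add (f g : GradedHom E X Y n) (p : ℕ) : (f + g).sPow p = f.sPow p + g.sPow p := by
  induction p with
  | zero => rfl
  | succ p hp => exact (congr_arg sTensor hp).trans (sTensor_add _ _)

lemma sPow_gcomp (g : GradedHom E Y Z b) (f : GradedHom E X Y a) (h : a + b = c) (p : ℕ) :
    (g.gcomp f h).sPow p = (g.sPow p).gcomp (f.sPow p) h := by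
  induction p with
  | zero => rfl
  | succ p hp => exact (congr_arg sTensor hp).trans (sTensor_gcomp _ _ _)

lemma sPow_ofHom (f : X ⟶ Y) (p : ℕ) : (ofHom E f).sPow p = ofHom E ((omegaPow E p).map f) := by
  induction p with
  | zero => rfl
  | succ p hp => exact (congr_arg sTensor hp).trans (sTensor_ofHom _)

lemma deltaIn_sPow (h : n + 1 = m) (f : GradedHom E X Y n) (p : ℕ) :
    (f.sPow p).deltaIn h = (f.deltaIn h).sPow p := by
  induction p with
  | zero => rfl
  | succ p hp => exact (deltaIn_sTensor h _).trans (congr_arg sTensor hp)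

lemma deltaEx_sPow_eq_zero (h : n + 1 = m) (f : GradedHom E X Y n) (hf : f.deltaEx h = 0)
    (p : ℕ) : (f.sPow p).deltaEx h = 0 := by
  induction p with
  | zero => exact hf
  | succ p hp => exact (deltaEx_sTensor h _).trans ((congr_arg sTensor hp).trans sTensor_zero)

end GradedHom

end GradedCalculus

/-! ### Graded maps act on the singular Yoneda complex -/

section Action

variable {Λ : Type u} [Ring Λ] {E : Subring Λ}

namespace YonedaHom

variable {X Y Z W : CochainComplex (ModuleCat.{u} Λ) ℤ} {a b c n m l k : ℤ}

/-- The composition `φ ∘ f` of `f ∈ 𝒴(X, Y)` with a graded map `φ : Y → Z`. -/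
def lcomp (φ : GradedHom E Y Z k) (f : YonedaHom E X Y n) (h : n + k = m) : YonedaHom E X Z m :=
  fun q => φ.gcomp (f.comp q) h

@[simp] lemma lcomp_comp (φ : GradedHom E Y Z k) (f : YonedaHom E X Y n) (h : n + k = m) (q : ℕ) :
    (lcomp φ f h).comp q = φ.gcomp (f.comp q) h := rfl

lemma lcomp_add (φ : GradedHom E Y Z k) (f g : YonedaHom E X Y n) (h : n + k = m) :
    lcomp φ (f + g) h = lcomp φ f h + lcomp φ g h :=
  ext (fun _ => GradedHom.gcomp_add _ _ _ _)

lemma add_lcomp (φ ψ : GradedHom E Y Z k) (f : YonedaHom E X Y n) (h : n + k = m) :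
    lcomp (φ + ψ) f h = lcomp φ f h + lcomp ψ f h :=
  ext (fun _ => GradedHom.add_gcomp _ _ _ _)

lemma lcomp_lcomp (ψ : GradedHom E Z W b) (φ : GradedHom E Y Z a) (f : YonedaHom E X Y n)
    (h : n + a = m) (h' : m + b = l) (hc : a + b = c) (h'' : n + c = l) :
    lcomp ψ (lcomp φ f h) h' = lcomp (ψ.gcomp φ hc) f h'' :=
  ext (fun _ => GradedHom.gcomp_assoc _ _ _ h hc h' h'')

lemma lcomp_precomp (φ : GradedHom E Y Z k) (f : YonedaHom E X Y n) (h : n + k = m) (r : W ⟶ X) :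
    lcomp φ (f.precomp r) h = (lcomp φ f h).precomp r :=
  ext (fun _ => GradedHom.gcomp_precomp _ _ h _)

lemma lcomp_ofHom (g : Y ⟶ Z) (f : YonedaHom E X Y n) :
    lcomp (GradedHom.ofHom E g) f (add_zero n) = f.postcomp g :=
  ext (fun _ => GradedHom.ofHom_gcomp _ _)

lemma theta_lcomp (φ : GradedHom E Y Z k) (f : YonedaHom E X Y n) (h : n + k = m) :
    (lcomp φ f h).theta = lcomp φ.sTensor f.theta h := by
  refine ext (fun q => ?_)
  cases q with
  | zero => exact (GradedHom.gcomp_zero φ.sTensor h).symm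
  | succ q => exact GradedHom.sTensor_gcomp φ (f.comp q) h

/-- Composition with a graded `Λ`-linear map is compatible with the differentials of the Yoneda
complexes. -/
lemma delta_lcomp (φ : GradedHom E Y Z k) (f : YonedaHom E X Y n) (h : n + k = m)
    (hk : k + 1 = l) (hn : n + 1 = a) (hm : m + 1 = b) (hφ : φ.deltaEx hk = 0) :
    (lcomp φ f h).delta hm = lcomp (φ.deltaIn hk) f (by lia) +
      k.negOnePow • lcomp φ (f.delta hn) (by lia) := by
  refine ext (fun q => ?_)
  cases q with
  | zero => exact GradedHom.deltaIn_gcomp φ (f.comp 0) h hn hk hm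
  | succ q =>
    have e₁ := GradedHom.deltaIn_gcomp φ (f.comp (q + 1)) h hn hk hm
    have e₂ := GradedHom.deltaEx_gcomp φ (f.comp q) h hn hk hm
    rw [hφ, GradedHom.zero_gcomp, zero_add] at e₂
    refine (congr_arg₂ (fun x y : GradedHom E ((omegaPow E (q + 1)).obj X) Z b => x + y)
      e₁ e₂).trans ?_
    refine (add_assoc _ _ _).trans (congr_arg _ ?_)
    refine (smul_add (A := GradedHom E ((omegaPow E (q + 1)).obj X) Z b)
      k.negOnePow _ _).symm.trans ?_
    exact congr_arg _ (GradedHom.gcomp_add φ ((f.comp (q + 1)).deltaIn hn)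
      ((f.comp q).deltaExPow hn) (by lia)).symm

/-- Composition with a graded map, as a `Λ`-linear map on `𝒴(Λ, Y)`. -/
def lcompΛ (φ : GradedHom E Y Z k) (h : n + k = m) :
    YonedaHom E (stalk Λ) Y n →ₗ[Λ] YonedaHom E (stalk Λ) Z m where
  toFun f := lcomp φ f h
  map_add' f g := lcomp_add φ f g h
  map_smul' b f := lcomp_precomp φ f h (rightMul b)

end YonedaHom

open YonedaHom

section Classes

variable {X Y Z : CochainComplex (ModuleCat.{u} Λ) ℤ} {n m : ℤ}

/-- The class `[f; p]` in `𝒮𝒴(Λ, X)`, as a `Λ`-linear function of `f ∈ 𝒴(Λ, Ω_nc^p(X))`. -/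
def cls (p : ℕ) : YonedaHom E (stalk Λ) ((omegaPow E p).obj X) n →ₗ[Λ]
    ((singularYoneda E).obj X).X n :=
  ((toSingularYoneda E X p).f n).hom

variable (E) in
/-- The terms of `𝒮𝒴(Λ, X)` are colimits of the terms of the complexes `𝒴(Λ, Ω_nc^p(X))`. -/
def isColimitTerm (X : CochainComplex (ModuleCat.{u} Λ) ℤ) (n : ℤ) :
    IsColimit ((HomologicalComplex.eval (ModuleCat.{u} Λ) (ComplexShape.up ℤ) n).mapCocone
      (colimit.cocone ((yonedaSequence E).flip.obj X))) :=
  isColimitOfPreserves _ (colimit.isColimit _)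

instance : PreservesFilteredColimitsOfSize.{0, 0} (forget (ModuleCat.{u} Λ)) :=
  preservesFilteredColimitsOfSize_shrink.{0, u, 0, u} _

lemma cls_theta (p : ℕ) (f : YonedaHom E (stalk Λ) ((omegaPow E p).obj X) n) :
    cls (X := X) (p + 1) f.theta = cls p f := by
  have e : ((thetaTrans E).app ((omegaPow E p).obj X)).f n ≫ (toSingularYoneda E X (p + 1)).f n =
      (toSingularYoneda E X p).f n :=
    HomologicalComplex.congr_hom (thetaTrans_toSingularYoneda E X p) n
  exact DFunLike.congr_fun (congr_arg ModuleCat.Hom.hom e) f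

lemma exists_cls (x : ((singularYoneda E).obj X).X n) :
    ∃ (p : ℕ) (f : YonedaHom E (stalk Λ) ((omegaPow E p).obj X) n), cls p f = x :=
  Concrete.isColimit_exists_rep _ (isColimitTerm E X n) x

lemma cls_eq_zero {p : ℕ} {f : YonedaHom E (stalk Λ) ((omegaPow E p).obj X) n}
    (h : cls p f = 0) : ∃ (p' : ℕ) (hp : p ≤ p'),
      ((((yonedaSequence E).flip.obj X).map (homOfLE hp)).f n).hom f = 0 := by
  obtain ⟨p', i, j, hp⟩ := Concrete.isColimit_exists_of_rep_eq _ (isColimitTerm E X n)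
    (i := p) (j := p) f (0 : YonedaHom E (stalk Λ) ((omegaPow E p).obj X) n)
    (h.trans (map_zero (cls (E := E) (X := X) (n := n) p)).symm)
  exact ⟨p', leOfHom i, hp.trans (map_zero (((HomologicalComplex.eval (ModuleCat.{u} Λ)
    (ComplexShape.up ℤ) n).map (((yonedaSequence E).flip.obj X).map j)).hom))⟩

lemma cls_map {p p' : ℕ} (hp : p ≤ p') (f : YonedaHom E (stalk Λ) ((omegaPow E p).obj X) n) :
    cls (X := X) p' (((((yonedaSequence E).flip.obj X).map (homOfLE hp)).f n).hom f) = cls p f :=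
  ConcreteCategory.congr_hom (HomologicalComplex.congr_hom
    (colimit.w ((yonedaSequence E).flip.obj X) (homOfLE hp)) n) f

lemma hom_ext_cls {M : ModuleCat.{u} Λ} {φ ψ : ((singularYoneda E).obj X).X n ⟶ M}
    (h : ∀ (p : ℕ) (f : YonedaHom E (stalk Λ) ((omegaPow E p).obj X) n),
      φ.hom (cls p f) = ψ.hom (cls p f)) : φ = ψ := by
  ext x
  obtain ⟨p, f, rfl⟩ := exists_cls x
  exact h p f

lemma d_cls (h : n + 1 = m) (p : ℕ) (f : YonedaHom E (stalk Λ) ((omegaPow E p).obj X) n) :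
    (((singularYoneda E).obj X).d n m).hom (cls p f) = cls p (f.delta h) := by
  have := ConcreteCategory.congr_hom ((toSingularYoneda E X p).comm n m) f
  refine this.trans ?_
  exact congr_arg (cls (X := X) p) (yonedaObj_d_apply E _ h f)

lemma map_cls (g : X ⟶ Y) (p : ℕ) (f : YonedaHom E (stalk Λ) ((omegaPow E p).obj X) n) :
    (((singularYoneda E).map g).f n).hom (cls p f) =
      cls p (f.postcomp ((omegaPow E p).map g)) := by
  have : toSingularYoneda E X p ≫ (singularYoneda E).map g =
      (yoneda E).map ((omegaPow E p).map g) ≫ toSingularYoneda E Y p :=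
    colimit.ι_desc _ p
  exact ConcreteCategory.congr_hom (HomologicalComplex.congr_hom this n) f

lemma singularYonedaShift_cls (p : ℕ)
    (f : YonedaHom E (stalk Λ) ((omegaPow E p).obj (X⟦(1 : ℤ)⟧)) n) :
    ((singularYonedaShift E X).f n).hom (cls p f) =
      cls (X := X) (n := n + 1) p (f.postcomp (omegaPowShift E X p)).unshift :=
  ConcreteCategory.congr_hom (HomologicalComplex.congr_hom (toSingularYoneda_shift E X p) n) f

/-- The universal property of the terms of `𝒮𝒴(Λ, X)`. -/
def termDesc {M : ModuleCat.{u} Λ}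
    (ψ : ∀ p, YonedaHom E (stalk Λ) ((omegaPow E p).obj X) n →ₗ[Λ] M)
    (hψ : ∀ (p : ℕ) (f : YonedaHom E (stalk Λ) ((omegaPow E p).obj X) n),
      ψ (p + 1) f.theta = ψ p f) : ((singularYoneda E).obj X).X n ⟶ M :=
  (isColimitTerm E X n).desc
    { pt := M
      ι := NatTrans.ofSequence (fun p => ModuleCat.ofHom (ψ p)) (fun p => by
        refine Eq.trans ?_ (Category.comp_id _).symm
        refine yonedaObj_hom_ext (fun f => ?_)
        refine Eq.trans ?_ (hψ p f)
        exact congr_arg (ψ (p + 1)) (ConcreteCategory.congr_hom (HomologicalComplex.congr_hom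
          (yonedaSequence_flip_map E X p) n) f)) }

lemma termDesc_cls {M : ModuleCat.{u} Λ}
    (ψ : ∀ p, YonedaHom E (stalk Λ) ((omegaPow E p).obj X) n →ₗ[Λ] M) (hψ) (p : ℕ)
    (f : YonedaHom E (stalk Λ) ((omegaPow E p).obj X) n) :
    (termDesc ψ hψ).hom (cls p f) = ψ p f :=
  ConcreteCategory.congr_hom ((isColimitTerm E X n).fac _ p) f

end Classes

section GradedMap

variable {X Y Z : CochainComplex (ModuleCat.{u} Λ) ℤ} {a b c n m l k : ℤ}

/-- The map `𝒮𝒴(Λ, Y) → 𝒮𝒴(Λ, Z)`, `[f; p] ↦ [((s Λ̄)^{⊗ p} ⊗ φ) ∘ f; p]`, induced by a graded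
`E`-linear map `φ : Y → Z` of degree `k`, in degree `n`. -/
def gradedMap (φ : GradedHom E Y Z k) (h : n + k = m) :
    ((singularYoneda E).obj Y).X n ⟶ ((singularYoneda E).obj Z).X m :=
  termDesc (fun p => cls p ∘ₗ lcompΛ (φ.sPow p) h) (fun p f => by
    refine Eq.trans ?_ (cls_theta p _)
    exact congr_arg (cls (X := Z) (p + 1)) (theta_lcomp (φ.sPow p) f h).symm)

lemma gradedMap_cls (φ : GradedHom E Y Z k) (h : n + k = m) (p : ℕ)
    (f : YonedaHom E (stalk Λ) ((omegaPow E p).obj Y) n) :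
    (gradedMap φ h).hom (cls p f) = cls p (lcomp (φ.sPow p) f h) :=
  termDesc_cls _ _ _ _

lemma gradedMap_add (φ ψ : GradedHom E Y Z k) (h : n + k = m) :
    gradedMap (φ + ψ) h = gradedMap φ h + gradedMap ψ h :=
  hom_ext_cls (fun p f => by
    refine (gradedMap_cls _ _ _ _).trans ?_
    rw [GradedHom.sPow_add, add_lcomp, map_add, ModuleCat.hom_add, LinearMap.add_apply,
      gradedMap_cls, gradedMap_cls])

lemma gradedMap_neg (φ : GradedHom E Y Z k) (h : n + k = m) :
    gradedMap (-φ) h = - gradedMap φ h :=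
  (AddMonoidHom.mk' (fun φ : GradedHom E Y Z k => gradedMap φ h)
    (fun φ ψ => gradedMap_add φ ψ h)).map_neg φ

lemma gradedMap_gcomp (ψ : GradedHom E Y Z b) (φ : GradedHom E X Y a) (hc : a + b = c)
    (h : n + a = m) (h' : m + b = l) (h'' : n + c = l) :
    gradedMap (ψ.gcomp φ hc) h'' = gradedMap φ h ≫ gradedMap ψ h' :=
  hom_ext_cls (fun p f => by
    rw [ModuleCat.hom_comp, LinearMap.comp_apply, gradedMap_cls, gradedMap_cls, gradedMap_cls,
      GradedHom.sPow_gcomp, lcomp_lcomp])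

lemma gradedMap_ofHom (g : X ⟶ Y) (n : ℤ) :
    gradedMap (GradedHom.ofHom E g) (add_zero n) = ((singularYoneda E).map g).f n :=
  hom_ext_cls (fun p f => by
    rw [gradedMap_cls, map_cls, GradedHom.sPow_ofHom, lcomp_ofHom])

/-- The functoriality of `𝒮𝒴(Λ, -)` with respect to graded `Λ`-linear maps is compatible with the
differentials. -/
lemma gradedMap_d (φ : GradedHom E Y Z k) (hφ : ∀ l (hl : k + 1 = l), φ.deltaEx hl = 0)
    (h : n + k = m) (hk : k + 1 = l) (hn : n + 1 = a) (hm : m + 1 = b) :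
    gradedMap φ h ≫ ((singularYoneda E).obj Z).d m b =
      gradedMap (φ.deltaIn hk) (by lia) +
        k.negOnePow • ((singularYoneda E).obj Y).d n a ≫ gradedMap φ (by lia) :=
  hom_ext_cls (fun p f => by
    have e : ∀ (ε : ℤˣ) (ψ : ((singularYoneda E).obj Y).X n ⟶ ((singularYoneda E).obj Z).X b)
      (x), (ε • ψ).hom x = ε • ψ.hom x := fun _ _ _ => rfl
    have e' : ∀ (ε : ℤˣ) (g : YonedaHom E (stalk Λ) ((omegaPow E p).obj Z) b),
        cls (X := Z) p (ε • g) = ε • cls p g := fun ε g => by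
      obtain rfl | rfl := Int.units_eq_one_or ε <;> simp
    rw [ModuleCat.hom_add, LinearMap.add_apply, e, ModuleCat.hom_comp, LinearMap.comp_apply,
      ModuleCat.hom_comp, LinearMap.comp_apply, gradedMap_cls, gradedMap_cls, d_cls hm, d_cls hn,
      gradedMap_cls, delta_lcomp _ _ _ hk hn hm (GradedHom.deltaEx_sPow_eq_zero _ _ (hφ _ _) _),
      map_add, e', GradedHom.deltaIn_sPow])

end GradedMap

end Action

/-! ### Transition maps, and contractibility for acyclic complexes -/

section Contraction

variable {Λ : Type u} [Ring Λ] {E : Subring Λ}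

/-- The transition map `𝒴(Λ, Ω_nc^p(X)) → 𝒴(Λ, Ω_nc^{p'}(X))` in degree `n`, for `p ≤ p'`. -/
def transition {X : CochainComplex (ModuleCat.{u} Λ) ℤ} {n : ℤ} {p p' : ℕ} (hp : p ≤ p') :
    YonedaHom E (stalk Λ) ((omegaPow E p).obj X) n →ₗ[Λ]
      YonedaHom E (stalk Λ) ((omegaPow E p').obj X) n :=
  ((((yonedaSequence E).flip.obj X).map (homOfLE hp)).f n).hom

section

variable {X : CochainComplex (ModuleCat.{u} Λ) ℤ} {n m : ℤ} {p p' : ℕ}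

lemma transition_rfl (f : YonedaHom E (stalk Λ) ((omegaPow E p).obj X) n) :
    transition (X := X) (le_refl p) f = f := by
  have e : (((yonedaSequence E).flip.obj X).map (homOfLE (le_refl p))) = 𝟙 _ :=
    ((yonedaSequence E).flip.obj X).map_id p
  exact DFunLike.congr_fun (congr_arg ModuleCat.Hom.hom (HomologicalComplex.congr_hom e n)) f

lemma transition_succ (hp : p ≤ p') (f : YonedaHom E (stalk Λ) ((omegaPow E p).obj X) n) :
    transition (X := X) (hp.trans (Nat.le_add_right p' 1)) f =
      (transition (X := X) hp f).theta := by
  have e₁ : homOfLE (hp.trans (Nat.le_add_right p' 1)) =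
      homOfLE hp ≫ homOfLE (Nat.le_add_right p' 1) := Subsingleton.elim _ _
  have e₂ : ((yonedaSequence E).flip.obj X).map (homOfLE (hp.trans (Nat.le_add_right p' 1))) =
      ((yonedaSequence E).flip.obj X).map (homOfLE hp) ≫
        ((yonedaSequence E).flip.obj X).map (homOfLE (Nat.le_add_right p' 1)) := by
    rw [e₁, Functor.map_comp]
  have e₃ := DFunLike.congr_fun (congr_arg ModuleCat.Hom.hom
    (HomologicalComplex.congr_hom (yonedaSequence_flip_map E X p') n)) (transition (X := X) hp f)
  refine Eq.trans ?_ e₃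
  exact DFunLike.congr_fun (congr_arg ModuleCat.Hom.hom (HomologicalComplex.congr_hom e₂ n)) f

lemma cls_transition (hp : p ≤ p') (f : YonedaHom E (stalk Λ) ((omegaPow E p).obj X) n) :
    cls (X := X) p' (transition hp f) = cls p f := cls_map hp f

lemma transition_transition {p'' : ℕ} (hp : p ≤ p') (hp' : p' ≤ p'')
    (f : YonedaHom E (stalk Λ) ((omegaPow E p).obj X) n) :
    transition (X := X) hp' (transition (X := X) hp f) = transition (X := X) (hp.trans hp') f := by
  induction p'', hp' using Nat.le_induction with
  | base => rw [transition_rfl]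
  | succ p'' hp' ih => rw [transition_succ hp', transition_succ (hp.trans hp'), ih]

lemma transition_delta (h : n + 1 = m) (hp : p ≤ p')
    (f : YonedaHom E (stalk Λ) ((omegaPow E p).obj X) n) :
    (transition (X := X) hp f).delta h = transition hp (f.delta h) := by
  have := ConcreteCategory.congr_hom
    ((((yonedaSequence E).flip.obj X).map (homOfLE hp)).comm n m) f
  refine (yonedaObj_d_apply E _ h _).symm.trans (this.trans ?_)
  exact congr_arg (transition (X := X) hp) (yonedaObj_d_apply E _ h f)

lemma exists_transition_eq_zero {f : YonedaHom E (stalk Λ) ((omegaPow E p).obj X) n}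
    (h : cls p f = 0) : ∃ (p' : ℕ) (hp : p ≤ p'), transition (X := X) hp f = 0 :=
  cls_eq_zero h

/-- A relation between elements of `𝒴(Λ, Ω_nc^p(X))` which is compatible with `θ` is compatible with
the transition maps. -/
lemma transition_rel {Y : CochainComplex (ModuleCat.{u} Λ) ℤ}
    (ρ : ∀ p, YonedaHom E (stalk Λ) ((omegaPow E p).obj X) n →
      YonedaHom E (stalk Λ) ((omegaPow E p).obj Y) m → Prop)
    (hρ : ∀ p f g, ρ p f g → ρ (p + 1) f.theta g.theta) (hp : p ≤ p') {f g} (h : ρ p f g) :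
    ρ p' (transition hp f) (transition hp g) := by
  induction p', hp using Nat.le_induction with
  | base => rwa [transition_rfl, transition_rfl]
  | succ p' hp ih => rw [transition_succ hp, transition_succ hp]; exact hρ _ _ _ ih

end

/-- Every linear map over a semisimple ring has a generalized inverse. -/
lemma exists_comp_comp_eq_self {R M N : Type*} [Ring R] [IsSemisimpleRing R] [AddCommGroup M]
    [AddCommGroup N] [Module R M] [Module R N] (d : M →ₗ[R] N) :
    ∃ s : N →ₗ[R] M, ∀ x, d (s (d x)) = d x := by
  obtain ⟨r, hr⟩ := IsSemisimpleModule.lifting_property d.rangeRestrict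
    d.surjective_rangeRestrict LinearMap.id
  obtain ⟨s, hs⟩ := IsSemisimpleModule.extension_property d.range.subtype
    d.range.injective_subtype r
  refine ⟨s, fun x => ?_⟩
  have h₁ : s (d x) = r (d.rangeRestrict x) := LinearMap.congr_fun hs (d.rangeRestrict x)
  rw [h₁]
  exact congr_arg Subtype.val (LinearMap.congr_fun hr (d.rangeRestrict x))

/-- An acyclic complex of `Λ`-modules is contractible as a complex of `E`-modules. -/
lemma exists_contraction [IsSemisimpleRing E] {X : CochainComplex (ModuleCat.{u} Λ) ℤ}
    (hX : X.Acyclic) :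
    ∃ h : GradedHom E X X (-1), h.deltaIn (neg_add_cancel 1) = GradedHom.ofHom E (𝟙 X) := by
  choose s hs using fun (i j : ℤ) => exists_comp_comp_eq_self (resE E (X.d i j))
  replace hs : ∀ i j x, X.d i j (s i j (X.d i j x)) = X.d i j x := hs
  have hd : ∀ i j k x, X.d j k (X.d i j x) = 0 := fun i j k x =>
    ConcreteCategory.congr_hom (X.d_comp_d i j k) x
  have hex : ∀ i j k, i + 1 = j → j + 1 = k → ∀ x : X.X j, X.d j k x = 0 →
      ∃ y, X.d i j y = x := fun i j k hij hjk x hx => by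
    have := (HomologicalComplex.exactAt_iff' X i j k (by simp [← hij]) (by simp [hjk])).1 (hX j)
    rw [ShortComplex.moduleCat_exact_iff] at this
    exact this x hx
  -- the correction by `1 - s ∘ d`, a projection onto the cycles, makes `s ∘ d + d ∘ s = 1` hold
  refine ⟨GradedHom.mk (fun i j _ => s j i ∘ₗ
    (LinearMap.id - s i (i + 1) ∘ₗ resE E (X.d i (i + 1)))), ?_⟩
  ext i j hij x
  obtain rfl : i = j := by lia
  rw [GradedHom.deltaIn_v _ _ i i _ (i - 1) (i + 1) (by lia) rfl]
  simp only [GradedHom.mk_v, Int.negOnePow_neg, Int.negOnePow_one, Units.neg_smul, one_smul,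
    sub_neg_eq_add, GradedHom.ofCochain_v, Cochain.ofHom_v]
  change X.d (i - 1) i (s (i - 1) i (x - s i (i + 1) (X.d i (i + 1) x))) +
    s i (i + 1) (X.d i (i + 1) x - s (i + 1) (i + 1 + 1)
      (X.d (i + 1) (i + 1 + 1) (X.d i (i + 1) x))) = x
  obtain ⟨y, hy⟩ := hex (i - 1) i (i + 1) (by lia) rfl (x - s i (i + 1) (X.d i (i + 1) x))
    (by rw [map_sub, hs, sub_self])
  rw [hd, map_zero, sub_zero, ← hy, hs, hy]
  exact sub_add_cancel _ _

namespace YonedaHom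

variable {X Y : CochainComplex (ModuleCat.{u} Λ) ℤ} {n m : ℤ}

/-- For a graded map `T : Y → Y` of degree `-1`, the composition `f ↦ δ_ex(T) ⊙ f`, which raises
the filtration-degree by one. -/
def deltaExComp {q : ℕ} (T : GradedHom E Y Y (-1)) (f : GradedHom E ((omegaPow E q).obj X) Y n) :
    GradedHom E ((omegaPow E (q + 1)).obj X) Y n :=
  (T.deltaEx (neg_add_cancel 1)).gcomp f.sTensor (add_zero n)

lemma deltaExComp_zero {q : ℕ} (T : GradedHom E Y Y (-1)) :
    deltaExComp T (0 : GradedHom E ((omegaPow E q).obj X) Y n) = 0 := by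
  rw [deltaExComp, GradedHom.sTensor_zero]
  exact GradedHom.gcomp_zero _ _

lemma sTensorPow_deltaExComp {q : ℕ} (T : GradedHom E Y Y (-1))
    (f : GradedHom E ((omegaPow E q).obj X) Y n) :
    (deltaExComp T f).sTensorPow = deltaExComp T.sTensor f.sTensorPow :=
  (GradedHom.sTensor_gcomp (T.deltaEx (neg_add_cancel 1)) f.sTensor (add_zero n)).trans
    (congr_arg (fun u => GradedHom.gcomp u f.sTensor.sTensor (add_zero n))
      (GradedHom.deltaEx_sTensor (neg_add_cancel 1) T).symm)

/-- For a graded map `T : Y → Y` of degree `-1`, the map `f ↦ f + δ_ex(T) ⊙ f` on `𝒴(X, Y)`: it is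
unipotent with respect to the filtration-degree. -/
def unipotent (T : GradedHom E Y Y (-1)) (f : YonedaHom E X Y n) : YonedaHom E X Y n
  | 0 => f.comp 0
  | q + 1 => f.comp (q + 1) + deltaExComp T (f.comp q)

lemma unipotent_comp_zero (T : GradedHom E Y Y (-1)) (f : YonedaHom E X Y n) :
    (unipotent T f).comp 0 = f.comp 0 := rfl

lemma unipotent_comp_succ (T : GradedHom E Y Y (-1)) (f : YonedaHom E X Y n) (q : ℕ) :
    (unipotent T f).comp (q + 1) = f.comp (q + 1) + deltaExComp T (f.comp q) := rfl

lemma unipotent_surjective (T : GradedHom E Y Y (-1)) (g : YonedaHom E X Y n) :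
    ∃ f : YonedaHom E X Y n, unipotent T f = g := by
  let f : YonedaHom E X Y n := fun q => Nat.rec (motive := fun q =>
      GradedHom E ((omegaPow E q).obj X) Y n) (g.comp 0)
    (fun q fq => g.comp (q + 1) - deltaExComp T fq) q
  refine ⟨f, ext (fun q => ?_)⟩
  cases q with
  | zero => rfl
  | succ q => exact sub_add_cancel _ _

lemma unipotent_injective (T : GradedHom E Y Y (-1)) {f : YonedaHom E X Y n}
    (hf : unipotent T f = 0) : f = 0 := by
  refine ext (fun q => ?_)
  induction q with
  | zero => exact congr_fun hf 0
  | succ q hq =>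
    have : f.comp (q + 1) + deltaExComp T (f.comp q) = 0 := congr_fun hf (q + 1)
    rwa [hq, zero_comp, deltaExComp_zero, add_zero] at this

lemma theta_unipotent (T : GradedHom E Y Y (-1)) (f : YonedaHom E X Y n) :
    (unipotent T f).theta = unipotent T.sTensor f.theta := by
  refine ext (fun q => ?_)
  obtain _ | _ | q := q
  · rfl
  · rw [unipotent_comp_succ, theta_comp_zero, deltaExComp_zero, add_zero, theta_comp_succ,
      theta_comp_succ, unipotent_comp_zero]
  · rw [unipotent_comp_succ, theta_comp_succ, theta_comp_succ, theta_comp_succ,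
      unipotent_comp_succ, GradedHom.sTensorPow_add, sTensorPow_deltaExComp]

/-- If `T` is a contraction of `Y` as a complex of `E`-modules, then composition with `T` is
a homotopy from a unipotent map to zero on `𝒴(X, Y)`. -/
lemma delta_lcomp_add (T : GradedHom E Y Y (-1))
    (hT : T.deltaIn (neg_add_cancel 1) = GradedHom.ofHom E (𝟙 Y)) (f : YonedaHom E X Y n)
    {n' : ℤ} (hn : n + (-1) = m) (hm : m + 1 = n) (hn' : n + 1 = n') (h : n' + (-1) = n) :
    (lcomp T f hn).delta hm + lcomp T (f.delta hn') h = unipotent T f := by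
  have e : ∀ q, ((lcomp T f hn).comp q).deltaIn hm =
      f.comp q - T.gcomp ((f.comp q).deltaIn hn') h := fun q => by
    rw [lcomp_comp, GradedHom.deltaIn_gcomp T (f.comp q) hn hn' (neg_add_cancel 1) hm, hT,
      GradedHom.id_gcomp, Int.negOnePow_neg, Int.negOnePow_one, Units.neg_smul, one_smul,
      sub_eq_add_neg]
  refine ext (fun q => ?_)
  cases q with
  | zero =>
    change ((lcomp T f hn).comp 0).deltaIn hm + T.gcomp ((f.comp 0).deltaIn hn') h = f.comp 0
    rw [e, sub_add_cancel]
  | succ q =>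
    have e' : ((lcomp T f hn).comp q).deltaEx hm =
      (T.deltaEx (neg_add_cancel 1)).gcomp (f.comp q).sTensor (add_zero n) -
        T.gcomp ((f.comp q).deltaEx hn') h := by
      rw [lcomp_comp, GradedHom.deltaEx_gcomp T (f.comp q) hn hn' (neg_add_cancel 1) hm,
        Int.negOnePow_neg, Int.negOnePow_one, Units.neg_smul, one_smul, sub_eq_add_neg]
    let D := deltaExComp T (f.comp q)
    let A : GradedHom E ((omegaPow E (q + 1)).obj X) Y n :=
      T.gcomp ((f.comp (q + 1)).deltaIn hn') h
    let B : GradedHom E ((omegaPow E (q + 1)).obj X) Y n :=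
      T.gcomp ((f.comp q).deltaExPow hn') h
    have e₁ : ((lcomp T f hn).delta hm).comp (q + 1) = (f.comp (q + 1) - A) + (D - B) :=
      congr_arg₂ (fun x y : GradedHom E ((omegaPow E (q + 1)).obj X) Y n => x + y)
        (e (q + 1)) e'
    have e₂ : (lcomp T (f.delta hn') h).comp (q + 1) = A + B := GradedHom.gcomp_add _ _ _ _
    have e₃ : (unipotent T f).comp (q + 1) = f.comp (q + 1) + D := rfl
    rw [add_comp, e₁, e₂, e₃]
    abel

end YonedaHom

/-- If `X` is acyclic, then the complex `𝒮𝒴(Λ, X)` is contractible: a contraction of `X` as a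
complex of `E`-modules induces a homotopy from zero to an automorphism of `𝒮𝒴(Λ, X)`. -/
theorem nonempty_homotopy_of_acyclic [IsSemisimpleRing E]
    {X : CochainComplex (ModuleCat.{u} Λ) ℤ} (hX : X.Acyclic) :
    Nonempty (Homotopy (𝟙 ((singularYoneda E).obj X)) 0) := by
  obtain ⟨h, hh⟩ := exists_contraction (E := E) hX
  have hT : ∀ p, (h.sPow p).deltaIn (neg_add_cancel 1) =
      GradedHom.ofHom E (𝟙 ((omegaPow E p).obj X)) := fun p => by
    rw [GradedHom.deltaIn_sPow, hh, GradedHom.sPow_ofHom, CategoryTheory.Functor.map_id]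
  let τ : ∀ i j : ℤ, (ComplexShape.up ℤ).Rel j i →
      (((singularYoneda E).obj X).X i ⟶ ((singularYoneda E).obj X).X j) :=
    fun i j hij => gradedMap h (by change j + 1 = i at hij; lia)
  let φ := Homotopy.nullHomotopicMap' τ
  have hφ : ∀ (n : ℤ) (p : ℕ) (f : YonedaHom E (stalk Λ) ((omegaPow E p).obj X) n),
      (φ.f n).hom (cls p f) = cls p (unipotent (h.sPow p) f) := fun n p f => by
    have : φ.f n = _ := Homotopy.nullHomotopicMap'_f (c := ComplexShape.up ℤ)
      (k₂ := n - 1) (k₁ := n) (k₀ := n + 1) (sub_add_cancel n 1) rfl τ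
    rw [this, ModuleCat.hom_add, LinearMap.add_apply, ModuleCat.hom_comp, LinearMap.comp_apply,
      ModuleCat.hom_comp, LinearMap.comp_apply, d_cls rfl, gradedMap_cls, gradedMap_cls,
      d_cls (sub_add_cancel n 1), ← map_add, add_comm,
      delta_lcomp_add _ (hT p) f _ (sub_add_cancel n 1) rfl]
  -- at every stage, `φ` is a unipotent map, hence it is bijective on the colimit
  have hinj : ∀ n, Function.Injective (φ.f n).hom := fun n => by
    rw [← LinearMap.ker_eq_bot, LinearMap.ker_eq_bot']
    intro x hx
    obtain ⟨p, f, rfl⟩ := exists_cls x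
    rw [hφ] at hx
    obtain ⟨p', hp, hp'⟩ := exists_transition_eq_zero hx
    have := transition_rel (fun p f g => unipotent (h.sPow p) f = g)
      (fun p f g hfg => by rw [← hfg, theta_unipotent]; rfl) hp
      (rfl : unipotent (h.sPow p) f = unipotent (h.sPow p) f)
    rw [← cls_transition hp, unipotent_injective _ (this.trans hp'), map_zero]
  have hsurj : ∀ n, Function.Surjective (φ.f n).hom := fun n x => by
    obtain ⟨p, g, rfl⟩ := exists_cls x
    obtain ⟨f, hf⟩ := unipotent_surjective (h.sPow p) g
    exact ⟨cls p f, (hφ n p f).trans (congr_arg _ hf)⟩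
  have : ∀ n, IsIso (φ.f n) := fun n =>
    (ConcreteCategory.isIso_iff_bijective (φ.f n)).2 ⟨hinj n, hsurj n⟩
  have : IsIso φ := HomologicalComplex.Hom.isIso_of_components φ
  exact ⟨(Homotopy.ofEq (IsIso.hom_inv_id φ).symm).trans
    (((Homotopy.nullHomotopy' τ).compRight (inv φ)).trans (Homotopy.ofEq zero_comp))⟩

end Contraction

/-! ### Acyclicity -/

section Acyclicity

variable {Λ : Type u} [Ring Λ] {E : Subring Λ}

/-- The `E`-linear map `Λ → Λ̄ ⊗_E M`, `a ↦ ā ⊗ m`. -/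
def BarTensor.tmulRight {M : Type u} [AddCommGroup M] [Module Λ M] (m : M) :
    Λ →ₗ[E] BarTensor E M where
  toFun a := tmul E a m
  map_add' a b := by rw [_root_.map_add, AddMonoidHom.add_apply]
  map_smul' e a := (coe_smul_tmul E e a m).symm

variable (Λ) in
/-- The `Λ`-linear map `Λ^i → Λ` on the terms of the stalk complex `Λ`, which is the identity for
`i = 0`. -/
def stalkCoeff (i : ℤ) : (stalk Λ).X i ⟶ ModuleCat.of Λ Λ :=
  if h : i = 0 then ((stalk Λ).XIsoOfEq h).hom ≫
    (HomologicalComplex.singleObjXSelf (ComplexShape.up ℤ) 0 (ModuleCat.of Λ Λ)).hom else 0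

variable (Λ) in
/-- The element of degree `i` of the stalk complex `Λ` which is `1` for `i = 0`. -/
def stalkOne (i : ℤ) : (stalk Λ).X i :=
  if h : i = 0 then ((HomologicalComplex.singleObjXSelf (ComplexShape.up ℤ) 0
    (ModuleCat.of Λ Λ)).inv ≫ ((stalk Λ).XIsoOfEq h).inv).hom (1 : Λ) else 0

lemma stalkCoeff_smul_stalkOne (i : ℤ) (x : (stalk Λ).X i) :
    ((stalkCoeff Λ i).hom x : Λ) • stalkOne Λ i = x := by
  by_cases h : i = 0
  · rw [stalkCoeff, stalkOne, dif_pos h, dif_pos h, ← map_smul]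
    have : ∀ a : Λ, a • (1 : Λ) = a := fun a => mul_one a
    refine (congr_arg _ (this _)).trans ?_
    exact ConcreteCategory.congr_hom ((((stalk Λ).XIsoOfEq h) ≪≫
      (HomologicalComplex.singleObjXSelf (ComplexShape.up ℤ) 0
        (ModuleCat.of Λ Λ))).hom_inv_id) x
  · have : Subsingleton ((stalk Λ).X i) := ModuleCat.subsingleton_of_isZero
      (HomologicalComplex.isZero_single_obj_X _ _ _ _ h)
    exact Subsingleton.elim _ _

namespace GradedHom

variable {X Y Z : CochainComplex (ModuleCat.{u} Λ) ℤ} {a b c n : ℤ} {q r : ℕ}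

/-- The map `f ↦ (-1)^{|f|} Id_{s Λ̄} ⊗ f` on graded maps `Ω_nc^q(X) → Ω_nc^r(Y)`. -/
def sTensorPow₂ (f : GradedHom E ((omegaPow E q).obj X) ((omegaPow E r).obj Y) n) :
    GradedHom E ((omegaPow E (q + 1)).obj X) ((omegaPow E (r + 1)).obj Y) n := f.sTensor

lemma deltaExPow_gcomp (g : GradedHom E ((omegaPow E r).obj Y) Z b)
    (f : GradedHom E ((omegaPow E q).obj X) ((omegaPow E r).obj Y) a) (h : a + b = c)
    {a' b' c' : ℤ} (ha : a + 1 = a') (hb : b + 1 = b') (hc : c + 1 = c') :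
    (g.gcomp f h).deltaExPow hc =
      (g.deltaExPow hb).gcomp f.sTensorPow₂ (by lia) +
        b.negOnePow • g.gcomp (f.deltaExPow ha) (by lia) :=
  deltaEx_gcomp g f h ha hb hc

lemma deltaIn_sTensorPow₂ {m : ℤ} (h : n + 1 = m)
    (f : GradedHom E ((omegaPow E q).obj X) ((omegaPow E r).obj Y) n) :
    f.sTensorPow₂.deltaIn h = (f.deltaIn h).sTensorPow₂ := deltaIn_sTensor h f

lemma deltaExPow_sTensorPow₂ {m : ℤ} (h : n + 1 = m)
    (f : GradedHom E ((omegaPow E q).obj X) ((omegaPow E r).obj Y) n) :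
    f.sTensorPow₂.deltaExPow h = (f.deltaExPow h).sTensorPow₂ := deltaEx_sTensor h f

lemma sTensorPow₂_zero :
    (0 : GradedHom E ((omegaPow E q).obj X) ((omegaPow E r).obj Y) n).sTensorPow₂ = 0 :=
  sTensor_zero

lemma sTensorPow₂_neg_id :
    (-ofHom E (𝟙 ((omegaPow E q).obj X))).sTensorPow₂ =
      -ofHom E (𝟙 ((omegaPow E (q + 1)).obj X)) := by
  refine (sTensor_neg _).trans (congr_arg Neg.neg ?_)
  refine (sTensor_ofHom _).trans ?_
  rw [CategoryTheory.Functor.map_id]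
  rfl

end GradedHom

variable (Λ E) in
/-- The graded map `Λ → Ω_nc(Λ)`, `x ↦ s x̄ ⊗ 1`. -/
def barContractionZero : GradedHom E (stalk Λ) ((omega E).obj (stalk Λ)) (-1) :=
  GradedHom.mk (fun i j _ => BarTensor.tmulRight (stalkOne Λ (j + 1)) ∘ₗ resE E (stalkCoeff Λ i))

lemma deltaIn_barContractionZero :
    (barContractionZero Λ E).deltaIn (neg_add_cancel 1) = 0 := by
  have h₁ : ∀ i j, resE E ((stalk Λ).d i j) = 0 := fun i j => by
    rw [stalk, HomologicalComplex.single_obj_d]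
    rfl
  have h₂ : ∀ i j, resE E (((omega E).obj (stalk Λ)).d i j) = 0 := fun i j => by
    rw [omega_d, h₁]
    refine neg_eq_zero.2 (BarTensor.hom_ext (fun a m => ?_))
    exact map_zero (BarTensor.tmul E a)
  ext1 i j hij
  rw [GradedHom.deltaIn_v _ _ i j _ (j - 1) (i + 1) (by lia) rfl, h₁, h₂, LinearMap.comp_zero,
    LinearMap.zero_comp, smul_zero, sub_zero, GradedHom.zero_v]

lemma deltaEx_barContractionZero :
    (barContractionZero Λ E).deltaEx (neg_add_cancel 1) =
      - GradedHom.ofHom E (𝟙 ((omega E).obj (stalk Λ))) := by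
  ext1 i j hij
  obtain rfl : i = j := by lia
  rw [GradedHom.deltaEx_v, Int.negOnePow_zero, one_smul]
  refine BarTensor.hom_ext (fun a (x : (stalk Λ).X (i + 1)) => ?_)
  change a • BarTensor.tmul E ((stalkCoeff Λ (i + 1)).hom x : Λ) (stalkOne Λ (i + 1)) -
    BarTensor.tmul E ((stalkCoeff Λ (i + 1)).hom (a • x) : Λ) (stalkOne Λ (i + 1)) =
      - BarTensor.tmul E a x
  rw [map_smul, BarTensor.smul_tmul, stalkCoeff_smul_stalkOne, smul_eq_mul]
  abel

variable (Λ E) in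
/-- The maps `Ω_nc^q(Λ) → Ω_nc^{q+1}(Λ)`, `s ā_{1,q} ⊗ x ↦ (-1)^q s ā_{1,q} ⊗ s x̄ ⊗ 1`. They are
the contraction of the normalized bar resolution. -/
def barContraction : ∀ q : ℕ,
    GradedHom E ((omegaPow E q).obj (stalk Λ)) ((omegaPow E (q + 1)).obj (stalk Λ)) (-1)
  | 0 => barContractionZero Λ E
  | q + 1 => (barContraction q).sTensorPow₂

lemma deltaIn_barContraction (q : ℕ) :
    (barContraction Λ E q).deltaIn (neg_add_cancel 1) = 0 := by
  induction q with
  | zero => exact deltaIn_barContractionZero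
  | succ q hq =>
    rw [barContraction, GradedHom.deltaIn_sTensorPow₂, hq, GradedHom.sTensorPow₂_zero]

lemma deltaExPow_barContraction (q : ℕ) :
    (barContraction Λ E q).deltaExPow (neg_add_cancel 1) =
      - GradedHom.ofHom E (𝟙 ((omegaPow E (q + 1)).obj (stalk Λ))) := by
  induction q with
  | zero => exact deltaEx_barContractionZero
  | succ q hq =>
    rw [barContraction, GradedHom.deltaExPow_sTensorPow₂, hq, GradedHom.sTensorPow₂_neg_id]

variable {Y : CochainComplex (ModuleCat.{u} Λ) ℤ} {n m : ℤ}

/-- Composition with the contraction of the bar resolution. -/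
def barHomotopy (f : YonedaHom E (stalk Λ) Y n) (hm : -1 + n = m) : YonedaHom E (stalk Λ) Y m :=
  fun q => (f.comp (q + 1)).gcomp (barContraction Λ E q) hm

lemma barHomotopy_comp (f : YonedaHom E (stalk Λ) Y n) (hm : -1 + n = m) (q : ℕ) :
    (barHomotopy f hm).comp q = (f.comp (q + 1)).gcomp (barContraction Λ E q) hm := rfl

/-- On cocycles, the coboundary of the homotopy given by the bar resolution is `± 1` in positive
filtration-degrees. -/
lemma delta_barHomotopy_comp_succ (f : YonedaHom E (stalk Λ) Y n) (hm : -1 + n = m)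
    (h : m + 1 = n) {l : ℤ} (hl : n + 1 = l) (hf : f.delta hl = 0) (q : ℕ) :
    ((barHomotopy f hm).delta h).comp (q + 1) = - (n.negOnePow • f.comp (q + 1)) := by
  have hfq : (f.comp (q + 1 + 1)).deltaIn hl + (f.comp (q + 1)).deltaExPow hl = 0 :=
    congr_fun hf (q + 1 + 1)
  rw [delta_comp_succ, barHomotopy_comp, barHomotopy_comp,
    GradedHom.deltaIn_gcomp (f.comp (q + 1 + 1)) (barContraction Λ E (q + 1)) hm
      (neg_add_cancel 1) hl h, deltaIn_barContraction, GradedHom.gcomp_zero, smul_zero, add_zero,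
    GradedHom.deltaExPow_gcomp (f.comp (q + 1)) (barContraction Λ E q) hm
      (neg_add_cancel 1) hl h, deltaExPow_barContraction, GradedHom.gcomp_neg, GradedHom.gcomp_id,
    smul_neg, ← add_assoc]
  have : (barContraction Λ E q).sTensorPow₂ = barContraction Λ E (q + 1) := rfl
  rw [this, ← GradedHom.add_gcomp, hfq, GradedHom.zero_gcomp, zero_add]

/-- The element of `𝒴(X, Y)` concentrated in filtration-degree zero attached to a graded map. -/
def YonedaHom.ofGradedHom {X : CochainComplex (ModuleCat.{u} Λ) ℤ} (f : GradedHom E X Y n) :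
    YonedaHom E X Y n
  | 0 => f
  | _ + 1 => 0

/-- If `u : Λ → Y` is `Λ`-linear, then `θ ⊙ u` is, up to a sign, the coboundary of
`x ↦ s x̄ ⊗ u(1)`. -/
lemma theta_ofGradedHom_eq_delta (h : m + 1 = n) (u : GradedHom E (stalk Λ) Y n) {l : ℤ}
    (hl : n + 1 = l) (h₁ : u.deltaIn hl = 0) (h₂ : u.deltaEx hl = 0) :
    (ofGradedHom u).theta = (ofGradedHom (-n.negOnePow •
      u.sTensor.gcomp (barContractionZero Λ E) (by lia : -1 + n = m))).delta h := by
  set k := u.sTensor.gcomp (barContractionZero Λ E) (by lia : -1 + n = m) with hk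
  have hk₁ : k.deltaIn h = 0 := by
    rw [hk, GradedHom.deltaIn_gcomp _ _ _ (neg_add_cancel 1) hl h, deltaIn_barContractionZero,
      GradedHom.gcomp_zero, GradedHom.deltaIn_sTensor, h₁, GradedHom.sTensor_zero,
      GradedHom.zero_gcomp, smul_zero, add_zero]
  have hk₂ : k.deltaEx h = - (n.negOnePow • u.sTensor) := by
    rw [hk, GradedHom.deltaEx_gcomp _ _ _ (neg_add_cancel 1) hl h, deltaEx_barContractionZero,
      GradedHom.gcomp_neg, GradedHom.gcomp_id, GradedHom.deltaEx_sTensor, h₂,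
      GradedHom.sTensor_zero, GradedHom.zero_gcomp, smul_neg, zero_add]
  have hk₃ : (-n.negOnePow • k).deltaIn h = 0 := by
    obtain e | e := Int.units_eq_one_or n.negOnePow <;> rw [e]
    · rw [Units.neg_smul, one_smul]
      exact ((AddMonoidHom.mk' _ (GradedHom.deltaIn_add (E := E) (X := stalk Λ)
        (Y := (omega E).obj Y) h)).map_neg k).trans (by rw [AddMonoidHom.mk'_apply, hk₁, neg_zero])
    · rw [neg_neg, one_smul, hk₁]
  have hk₄ : (-n.negOnePow • k).deltaEx h = u.sTensor := by
    obtain e | e := Int.units_eq_one_or n.negOnePow <;> rw [e] at hk₂ ⊢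
    · rw [Units.neg_smul, one_smul]
      exact ((AddMonoidHom.mk' _ (GradedHom.deltaEx_add (E := E) (X := stalk Λ)
        (Y := (omega E).obj Y) h)).map_neg k).trans
          (by rw [AddMonoidHom.mk'_apply, hk₂, one_smul, neg_neg])
    · rw [neg_neg, one_smul, hk₂, Units.neg_smul, one_smul, neg_neg]
  refine ext (fun q => ?_)
  obtain _ | _ | q := q
  · exact hk₃.symm
  · rw [delta_comp_succ]
    refine Eq.trans hk₄.symm ?_
    refine (zero_add _).symm.trans ?_
    exact congr_arg₂ (fun x y : GradedHom E ((omegaPow E 1).obj (stalk Λ)) ((omega E).obj Y) n =>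
      x + y) (GradedHom.deltaIn_zero h).symm rfl
  · rw [delta_comp_succ]
    refine Eq.trans GradedHom.sTensor_zero ?_
    refine (zero_add _).symm.trans ?_
    exact congr_arg₂ (fun x y : GradedHom E ((omegaPow E (q + 1 + 1)).obj (stalk Λ))
      ((omega E).obj Y) n => x + y) (GradedHom.deltaIn_zero h).symm
        (GradedHom.deltaExPow_zero h).symm

/-- The morphism `𝒴(Λ, Y) → 𝒴(Λ, Ω_nc(Y))` is zero in cohomology: every cocycle of `𝒴(Λ, Y)` is
cohomologous to a `Λ`-linear map `u : Λ → Y`, and `θ ⊙ u` is a coboundary. -/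
lemma exists_theta_eq_delta (h : m + 1 = n) (f : YonedaHom E (stalk Λ) Y n) {l : ℤ}
    (hl : n + 1 = l) (hf : f.delta hl = 0) :
    ∃ g : YonedaHom E (stalk Λ) ((omega E).obj Y) m, f.theta = g.delta h := by
  have hm : -1 + n = m := by lia
  obtain ⟨g, hg⟩ : ∃ g : YonedaHom E (stalk Λ) Y m,
      ∀ q, (f - g.delta h).comp (q + 1) = 0 := by
    have key := delta_barHomotopy_comp_succ f hm h hl hf
    obtain e | e := Int.units_eq_one_or n.negOnePow <;> rw [e] at key
    · refine ⟨-barHomotopy f hm, fun q => ?_⟩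
      have e' : (-barHomotopy f hm).delta h = - (barHomotopy f hm).delta h :=
        (AddMonoidHom.mk' _ (delta_add (E := E) (X := stalk Λ) (Y := Y) h)).map_neg _
      rw [e', sub_neg_eq_add, add_comp, key, one_smul, add_neg_cancel]
    · refine ⟨barHomotopy f hm, fun q => ?_⟩
      change f.comp (q + 1) - ((barHomotopy f hm).delta h).comp (q + 1) = 0
      rw [key, Units.neg_smul, one_smul, neg_neg, sub_self]
  -- `f - δ(g)` is concentrated in filtration degree zero, where it is a `Λ`-linear cocycle `u`
  obtain ⟨u, hf'⟩ : ∃ u : GradedHom E (stalk Λ) Y n, f - g.delta h = ofGradedHom u :=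
    ⟨(f - g.delta h).comp 0, ext (fun q => by
      cases q with
      | zero => rfl
      | succ q => exact hg q)⟩
  have hδ : (f - g.delta h).delta hl = 0 := by
    refine ((AddMonoidHom.mk' _
      (delta_add (E := E) (X := stalk Λ) (Y := Y) hl)).map_sub _ _).trans ?_
    change f.delta hl - (g.delta h).delta hl = 0
    rw [hf, delta_delta, sub_zero]
  rw [hf'] at hδ
  have h₁ : u.deltaIn hl = 0 := congr_fun hδ 0
  have h₂ : u.deltaEx hl = 0 := by
    refine Eq.trans ?_ (congr_fun hδ 1)
    refine (zero_add _).symm.trans ?_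
    exact congr_arg₂ (fun x y : GradedHom E ((omegaPow E 1).obj (stalk Λ)) Y l => x + y)
      (GradedHom.deltaIn_zero hl).symm rfl
  have key := theta_ofGradedHom_eq_delta h u hl h₁ h₂
  rw [← hf'] at key
  exact ⟨_ + g.theta, by rw [delta_add, ← key, delta_theta, ← theta_add, sub_add_cancel]⟩

/-- The complex `𝒮𝒴(Λ, X)` is acyclic. -/
theorem singularYoneda_acyclic (X : CochainComplex (ModuleCat.{u} Λ) ℤ) :
    ((singularYoneda E).obj X).Acyclic := fun n => by
  rw [HomologicalComplex.exactAt_iff' _ (n - 1) n (n + 1) (by simp) (by simp),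
    ShortComplex.moduleCat_exact_iff]
  intro x hx
  obtain ⟨p, f, rfl⟩ := exists_cls (E := E) (X := X) x
  have hf : cls (X := X) p (f.delta rfl) = 0 := (d_cls rfl p f).symm.trans hx
  obtain ⟨p', hp, hp'⟩ := exists_transition_eq_zero hf
  rw [← transition_delta] at hp'
  obtain ⟨g, hg⟩ := exists_theta_eq_delta (sub_add_cancel n 1) (transition hp f) rfl hp'
  refine ⟨cls (X := X) (p' + 1) g, ?_⟩
  refine (d_cls (sub_add_cancel n 1) (p' + 1) g).trans ?_
  refine (congr_arg (cls (X := X) (p' + 1)) hg.symm).trans ?_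
  rw [cls_theta, cls_transition]

end Acyclicity

/-! ### Injectivity -/

section Injectivity

variable {Λ : Type u} [Ring Λ] {E : Subring Λ}

/-- The `Λ`-linear map `Λ → M`, `x ↦ x m`. -/
def spanMap {M : ModuleCat.{u} Λ} (m : M) : ModuleCat.of Λ Λ ⟶ M :=
  ModuleCat.ofHom (LinearMap.toSpanSingleton Λ M m)

lemma spanMap_comp {M N : ModuleCat.{u} Λ} (f : M ⟶ N) (m : M) :
    spanMap m ≫ f = spanMap (f.hom m) := by
  ext
  simp [spanMap]

variable (E) in
/-- An endofunctor `T` of the category of `Λ`-modules is *tensor-like* if `T(M)` has the universal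
property of the abelian group `T(Λ) ⊗_Λ M` (with respect to the right `Λ`-module structure on
`T(Λ)` given by functoriality), and if `T` preserves the monomorphisms which split over `E`. -/
structure IsTensorLike (T : ModuleCat.{u} Λ ⥤ ModuleCat.{u} Λ) : Prop where
  hom_ext : ∀ {M : ModuleCat.{u} Λ} {A : Type u} [AddCommGroup A] {Φ Ψ : T.obj M →+ A},
    (∀ (m : M) (x : T.obj (ModuleCat.of Λ Λ)),
      Φ ((T.map (spanMap m)).hom x) = Ψ ((T.map (spanMap m)).hom x)) → Φ = Ψ
  exists_lift : ∀ {M : ModuleCat.{u} Λ} {A : Type u} [AddCommGroup A]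
    (φ : M →+ (T.obj (ModuleCat.of Λ Λ) →+ A)),
    (∀ (b : Λ) (m : M) (x : T.obj (ModuleCat.of Λ Λ)),
      φ (b • m) x = φ m ((T.map (spanMap (M := ModuleCat.of Λ Λ) b)).hom x)) →
    ∃ Φ : T.obj M →+ A, ∀ (m : M) (x : T.obj (ModuleCat.of Λ Λ)),
      Φ ((T.map (spanMap m)).hom x) = φ m x
  exists_retraction : ∀ {M N : ModuleCat.{u} Λ} (f : M ⟶ N) (r : N →ₗ[E] M),
    (∀ m, r (f.hom m) = m) →
    ∃ r' : T.obj N →ₗ[E] T.obj M, ∀ y, r' ((T.map f).hom y) = y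

namespace IsTensorLike

lemma id : IsTensorLike E (𝟭 (ModuleCat.{u} Λ)) where
  hom_ext {M A _ Φ Ψ} h := by
    ext m
    have e : (spanMap m).hom (1 : Λ) = m := one_smul Λ m
    have := h m (1 : Λ)
    change Φ ((spanMap m).hom (1 : Λ)) = Ψ ((spanMap m).hom (1 : Λ)) at this
    rwa [e] at this
  exists_lift {M A _} φ hφ := by
    refine ⟨AddMonoidHom.mk' (fun m => φ m (1 : Λ)) (fun m m' => by
      rw [map_add, AddMonoidHom.add_apply]), fun m x => ?_⟩
    refine (hφ x m (1 : Λ)).trans (congr_arg (φ m) ?_)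
    exact one_mul (M := Λ) x
  exists_retraction f r hr := ⟨r, hr⟩

lemma of_isZero {T : ModuleCat.{u} Λ ⥤ ModuleCat.{u} Λ} (hT : IsZero T) : IsTensorLike E T := by
  have : ∀ M, Subsingleton (T.obj M) := fun M =>
    ModuleCat.subsingleton_of_isZero (hT.obj M)
  exact
    { hom_ext := fun {M A _ Φ Ψ} h => by
        ext x
        rw [Subsingleton.elim x 0, map_zero, map_zero]
      exists_lift := fun {M A _} φ hφ => ⟨0, fun m x => by
        rw [Subsingleton.elim x 0, map_zero]
        exact (map_zero (φ m)).symm⟩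
      exists_retraction := fun f r hr => ⟨0, fun y => Subsingleton.elim _ _⟩ }

lemma of_iso {T T' : ModuleCat.{u} Λ ⥤ ModuleCat.{u} Λ} (e : T ≅ T') (hT : IsTensorLike E T) :
    IsTensorLike E T' := by
  have h₁ : ∀ {M N} (f : M ⟶ N) (x : T.obj M),
      (e.hom.app N).hom ((T.map f).hom x) = (T'.map f).hom ((e.hom.app M).hom x) :=
    fun f x => ConcreteCategory.congr_hom (e.hom.naturality f) x
  have h₂ : ∀ {M N} (f : M ⟶ N) (x : T'.obj M),
      (e.inv.app N).hom ((T'.map f).hom x) = (T.map f).hom ((e.inv.app M).hom x) :=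
    fun f x => ConcreteCategory.congr_hom (e.inv.naturality f) x
  have h₃ : ∀ {M} (x : T.obj M), (e.inv.app M).hom ((e.hom.app M).hom x) = x :=
    fun {M} x => ConcreteCategory.congr_hom (e.hom_inv_id_app M) x
  have h₄ : ∀ {M} (x : T'.obj M), (e.hom.app M).hom ((e.inv.app M).hom x) = x :=
    fun {M} x => ConcreteCategory.congr_hom (e.inv_hom_id_app M) x
  exact
    { hom_ext := fun {M A _ Φ Ψ} h => by
        have := hT.hom_ext (Φ := Φ.comp (e.hom.app M).hom.toAddMonoidHom)
          (Ψ := Ψ.comp (e.hom.app M).hom.toAddMonoidHom) (fun m x => by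
            change Φ ((e.hom.app M).hom ((T.map _).hom x)) =
              Ψ ((e.hom.app M).hom ((T.map _).hom x))
            rw [h₁, h])
        ext x
        rw [← h₄ x]
        exact DFunLike.congr_fun this _
      exists_lift := fun {M A _} φ hφ => by
        obtain ⟨Φ, hΦ⟩ := hT.exists_lift (M := M) (AddMonoidHom.mk'
          (fun m => (φ m).comp (e.hom.app _).hom.toAddMonoidHom)
          (fun m m' => by ext; simp)) (fun b m x => by
            change φ (b • m) ((e.hom.app _).hom x) = φ m ((e.hom.app _).hom ((T.map _).hom x))
            rw [h₁, hφ])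
        refine ⟨Φ.comp (e.inv.app M).hom.toAddMonoidHom, fun m x => ?_⟩
        change Φ ((e.inv.app M).hom ((T'.map _).hom x)) = _
        rw [h₂, hΦ]
        exact congr_arg (φ m) (h₄ x)
      exists_retraction := fun {M N} f r hr => by
        obtain ⟨r', hr'⟩ := hT.exists_retraction f r hr
        refine ⟨resE E (e.hom.app M) ∘ₗ r' ∘ₗ resE E (e.inv.app N), fun y => ?_⟩
        change (e.hom.app M).hom (r' ((e.inv.app N).hom ((T'.map f).hom y))) = y
        rw [h₂, hr', h₄] }

lemma comp_barFunctor {T : ModuleCat.{u} Λ ⥤ ModuleCat.{u} Λ} (hT : IsTensorLike E T) :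
    IsTensorLike E (T ⋙ barFunctor E) where
  hom_ext {M A _ Φ Ψ} h := by
    refine BarTensor.addHom_ext (fun a y => ?_)
    exact DFunLike.congr_fun (hT.hom_ext (M := M)
      (Φ := AddMonoidHom.comp (show BarTensor E (T.obj M) →+ A from Φ) (BarTensor.tmul E a))
      (Ψ := AddMonoidHom.comp (show BarTensor E (T.obj M) →+ A from Ψ) (BarTensor.tmul E a))
      (fun m x => h m (BarTensor.tmul E a x))) y
  exists_lift {M A _} φ hφ := by
    let φ' (m : M) : BarTensor E (T.obj (ModuleCat.of Λ Λ)) →+ A := φ m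
    have hφ'_add : ∀ m m', φ' (m + m') = φ' m + φ' m' := fun m m' => φ.map_add m m'
    have hφ' : ∀ b m a x, φ' (b • m) (BarTensor.tmul E a x) =
      φ' m (BarTensor.tmul E a ((T.map (spanMap (M := ModuleCat.of Λ Λ) b)).hom x)) :=
        fun b m a x => hφ b m (BarTensor.tmul E a x)
    have := fun a : Λ => hT.exists_lift (M := M)
      (AddMonoidHom.mk' (fun m => (φ' m).comp (BarTensor.tmul E a)) (fun m m' => by
        rw [hφ'_add, AddMonoidHom.add_comp])) (fun b m x => hφ' b m a x)
    choose Ψ hΨ using this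
    replace hΨ : ∀ a m x, Ψ a ((T.map (spanMap m)).hom x) = φ' m (BarTensor.tmul E a x) := hΨ
    have hΨ_add : ∀ a a', Ψ (a + a') = Ψ a + Ψ a' := fun a a' => by
      refine hT.hom_ext (fun m x => ?_)
      rw [AddMonoidHom.add_apply, hΨ, hΨ, hΨ, map_add, AddMonoidHom.add_apply, map_add]
    have hΨ_coe : ∀ (e : E) (y : T.obj M), Ψ e y = 0 := fun e => by
      refine DFunLike.congr_fun (f := Ψ e) (g := 0) (hT.hom_ext (fun m x => ?_))
      rw [hΨ, BarTensor.tmul_coe, map_zero, AddMonoidHom.zero_apply]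
    have hΨ_mul : ∀ (a : Λ) (e : E) (y : T.obj M), Ψ (a * e) y = Ψ a (e • y) := fun a e => by
      refine DFunLike.congr_fun (f := Ψ (a * e))
        (g := (Ψ a).comp (DistribSMul.toAddMonoidHom (T.obj M) e)) (hT.hom_ext (fun m x => ?_))
      change _ = Ψ a ((e : Λ) • (T.map _).hom x)
      rw [← map_smul, hΨ, hΨ, BarTensor.tmul_mul_coe]
      rfl
    let L : BarTensor E (T.obj M) →+ A :=
      BarTensor.lift (M := T.obj M) (AddMonoidHom.mk' Ψ hΨ_add) hΨ_coe hΨ_mul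
    refine ⟨L, fun m x => ?_⟩
    refine DFunLike.congr_fun (f := L.comp
        (BarTensor.mapΛ (E := E) (T.map (spanMap m)).hom).toAddMonoidHom) (g := φ' m)
        (BarTensor.addHom_ext (fun a x => ?_)) x
    exact hΨ a m x
  exists_retraction {M N} f r hr := by
    obtain ⟨r', hr'⟩ := hT.exists_retraction f r hr
    refine ⟨BarTensor.map r', fun y => ?_⟩
    refine DFunLike.congr_fun (f := (BarTensor.map r').toAddMonoidHom.comp
      (BarTensor.mapΛ (E := E) (T.map f).hom).toAddMonoidHom) (g := AddMonoidHom.id _)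
      (BarTensor.addHom_ext (fun a x => ?_)) y
    exact congr_arg (BarTensor.tmul E a) (hr' x)

end IsTensorLike

variable (E) in
/-- The functor which sends a `Λ`-module `M` to the term in degree `i` of `Ω_nc^q(M)`. -/
abbrev omegaPowTerm (q : ℕ) (i : ℤ) : ModuleCat.{u} Λ ⥤ ModuleCat.{u} Λ :=
  HomologicalComplex.single (ModuleCat.{u} Λ) (ComplexShape.up ℤ) 0 ⋙ omegaPow E q ⋙
    HomologicalComplex.eval _ _ i

lemma isTensorLike_omegaPowTerm (q : ℕ) (i : ℤ) :
    IsTensorLike E (omegaPowTerm E (Λ := Λ) q i) := by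
  induction q generalizing i with
  | zero =>
    by_cases h : i = 0
    · subst h
      exact IsTensorLike.id.of_iso (HomologicalComplex.singleCompEvalIsoSelf (ModuleCat.{u} Λ)
        (ComplexShape.up ℤ) 0).symm
    · exact IsTensorLike.of_isZero
        (HomologicalComplex.isZero_single_comp_eval (ModuleCat.{u} Λ) (ComplexShape.up ℤ) 0 i h)
  | succ q hq => exact (hq (i + 1)).comp_barFunctor

/-- The terms of `𝒴(Λ, Y)` are injective: they are products of modules of the form
`Hom_E(T(Λ), N)`, where `Hom_Λ(-, Hom_E(T(Λ), N)) = Hom_E(T(-), N)` is exact. -/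
theorem baer_yonedaHom [IsSemisimpleRing E] (Y : CochainComplex (ModuleCat.{u} Λ) ℤ) (n : ℤ) :
    Module.Baer Λ (YonedaHom E (stalk Λ) Y n) := by
  intro I g
  let J : ModuleCat.{u} Λ := ModuleCat.of Λ I
  let incl : J ⟶ ModuleCat.of Λ Λ := ModuleCat.ofHom I.subtype
  obtain ⟨r, hr⟩ := IsSemisimpleModule.extension_property (resE E incl)
    Subtype.val_injective (LinearMap.id : J →ₗ[E] J)
  have key : ∀ (q : ℕ) (i j : ℤ) (hij : i + n = j),
      ∃ h : ((omegaPow E q).obj (stalk Λ)).X i →ₗ[E] Y.X j,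
        ∀ b : I, h ∘ₗ resE E (((omegaPow E q).map (rightMul (b : Λ))).f i) =
          ((g b).comp q).v i j hij := fun q i j hij => by
    have hT := isTensorLike_omegaPowTerm (E := E) (Λ := Λ) q i
    let φ (b : I) : ((omegaPow E q).obj (stalk Λ)).X i →ₗ[E] Y.X j := ((g b).comp q).v i j hij
    have hφ : ∀ (c : Λ) (b : I) x,
        φ (c • b) x = φ b (((omegaPow E q).map (rightMul c)).f i x) := fun c b x => by
      change ((g (c • b)).comp q).v i j hij x = _
      rw [map_smul]
      rfl
    -- the components of the maps `g b` assemble into an `E`-linear map `Φ` on `T(I)`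
    obtain ⟨Φ, hΦ⟩ := hT.exists_lift (M := J)
      (AddMonoidHom.mk' (fun b => (φ b).toAddMonoidHom) (fun b b' => by
        ext x
        change ((g (b + b')).comp q).v i j hij x = _
        rw [map_add]
        rfl)) hφ
    replace hΦ : ∀ (b : I) x, Φ (((omegaPowTerm E q i).map (spanMap (M := J) b)).hom x) = φ b x :=
      hΦ
    have hΦE : ∀ (e : E) y, Φ (e • y) = e • Φ y := fun e =>
      DFunLike.congr_fun (f := Φ.comp (DistribSMul.toAddMonoidHom _ e))
        (g := (DistribSMul.toAddMonoidHom _ e).comp Φ) (hT.hom_ext (fun b x => by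
          change Φ ((e : Λ) • ((omegaPowTerm E q i).map (spanMap (M := J) b)).hom x) =
            e • Φ (((omegaPowTerm E q i).map (spanMap (M := J) b)).hom x)
          rw [← map_smul, hΦ, hΦ]
          exact (φ b).map_smul e x))
    -- `Φ` extends to `T(Λ)` along the `E`-split inclusion of `T(I)`
    obtain ⟨r', hr'⟩ := hT.exists_retraction incl r (fun m => LinearMap.congr_fun hr m)
    refine ⟨{ toFun := fun y => Φ (r' y)
              map_add' := fun y y' => (congr_arg Φ (r'.map_add y y')).trans (Φ.map_add _ _)
              map_smul' := fun e y =>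
                (congr_arg Φ (r'.map_smul e y)).trans (hΦE e _) }, fun b => ?_⟩
    ext x
    have e : (omegaPowTerm E q i).map (spanMap (M := ModuleCat.of Λ Λ) (b : Λ)) =
        (omegaPowTerm E q i).map (spanMap (M := J) b) ≫ (omegaPowTerm E q i).map incl := by
      rw [← Functor.map_comp, spanMap_comp]
      rfl
    change Φ (r' (((omegaPowTerm E q i).map (spanMap (M := ModuleCat.of Λ Λ) (b : Λ))).hom x)) = _
    rw [e]
    exact (congr_arg Φ (hr' _)).trans (hΦ b x)
  choose h hh using key
  let f : YonedaHom E (stalk Λ) Y n := fun q => GradedHom.mk (h q)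
  refine ⟨LinearMap.toSpanSingleton Λ _ f, fun b hb => ?_⟩
  rw [LinearMap.toSpanSingleton_apply]
  refine ext (fun q => GradedHom.ext (fun i j hij => ?_))
  exact hh q i j hij ⟨b, hb⟩

/-- The terms of `𝒮𝒴(Λ, X)` are injective: over the noetherian ring `Λ`, a sequential colimit of
injective modules satisfies Baer's criterion, as ideals are finitely presented. -/
theorem injective_singularYoneda_X [IsNoetherianRing Λ] [IsSemisimpleRing E]
    (X : CochainComplex (ModuleCat.{u} Λ) ℤ) (n : ℤ) :
    Injective (((singularYoneda E).obj X).X n) := by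
  suffices Module.Baer Λ (((singularYoneda E).obj X).X n) from
    (Module.injective_iff_injective_object _ _).1 this.injective
  intro I g
  obtain ⟨r, π, hπ⟩ := Module.Finite.exists_fin' Λ I
  -- lift the restriction of `g` to the generators of `I` to a common stage `p`
  choose p₀ f₀ hf₀ using fun i : Fin r =>
    exists_cls (E := E) (X := X) (n := n) (g (π (Pi.single i 1)))
  let p := Finset.univ.sup p₀
  let G : (Fin r → Λ) →ₗ[Λ] YonedaHom E (stalk Λ) ((omegaPow E p).obj X) n :=
    (Pi.basisFun Λ (Fin r)).constr ℕ (fun i =>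
      transition (Finset.le_sup (Finset.mem_univ i)) (f₀ i))
  have hG : cls p ∘ₗ G = g ∘ₗ π := (Pi.basisFun Λ (Fin r)).ext (fun i => by
    rw [LinearMap.comp_apply, LinearMap.comp_apply, Module.Basis.constr_basis, cls_transition, hf₀,
      Pi.basisFun_apply])
  -- the finitely many relations between the generators hold at some later stage `p'`
  obtain ⟨S, hS⟩ := IsNoetherian.noetherian (LinearMap.ker π)
  have hS' : ∀ k : S, cls (X := X) p (G k) = 0 := fun k => by
    have hk : π k = 0 := LinearMap.mem_ker.1 (hS ▸ Submodule.subset_span k.2)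
    refine (LinearMap.congr_fun hG k).trans ?_
    rw [LinearMap.comp_apply, hk, map_zero]
  choose p₁ hp₁ hp₁' using fun k => exists_transition_eq_zero (hS' k)
  let p' := p + Finset.univ.sup p₁
  have hp' : p ≤ p' := Nat.le_add_right _ _
  let G' := transition (E := E) (X := X) (n := n) hp' ∘ₗ G
  have hG' : LinearMap.ker π ≤ LinearMap.ker G' := by
    rw [← hS, Submodule.span_le]
    intro k hk
    have h₁ : p₁ ⟨k, hk⟩ ≤ p' :=
      (Finset.le_sup (f := p₁) (Finset.mem_univ _)).trans (Nat.le_add_left _ _)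
    have h₂ : transition (X := X) hp' (G k) =
        transition (X := X) h₁ (transition (X := X) (hp₁ ⟨k, hk⟩) (G k)) :=
      (transition_transition (hp₁ ⟨k, hk⟩) h₁ _).symm
    refine LinearMap.mem_ker.2 (h₂.trans ?_)
    rw [hp₁', map_zero]
  obtain ⟨s, hs⟩ := hπ.hasRightInverse
  have hGs : ∀ x, G' (s (π x)) = G' x := fun x => by
    rw [← sub_eq_zero, ← map_sub]
    refine hG' ?_
    rw [LinearMap.mem_ker, map_sub, hs, sub_self]
  let g' : I →ₗ[Λ] YonedaHom E (stalk Λ) ((omegaPow E p').obj X) n :=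
    { toFun := fun b => G' (s b)
      map_add' := fun b b' => by
        rw [← map_add, ← hGs (s b + s b'), map_add, hs, hs]
      map_smul' := fun c b => by
        rw [RingHom.id_apply, ← map_smul, ← hGs (c • s b), map_smul, hs] }
  obtain ⟨k, hk⟩ := baer_yonedaHom ((omegaPow E p').obj X) n I g'
  refine ⟨cls p' ∘ₗ k, fun b hb => ?_⟩
  have e : G' (s ⟨b, hb⟩) = transition hp' (G (s ⟨b, hb⟩)) := rfl
  rw [LinearMap.comp_apply, hk]
  refine (congr_arg (cls p') e).trans ?_
  rw [cls_transition]
  refine (LinearMap.congr_fun hG _).trans ?_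
  rw [LinearMap.comp_apply, hs]

end Injectivity

/-! ### Compatibility of `𝒮𝒴(Λ, -)` with all the shifts -/

section CommShift

variable {Λ : Type u} [Ring Λ] (E : Subring Λ)
variable {X Y Z : CochainComplex (ModuleCat.{u} Λ) ℤ} {a b c n m l k : ℤ}

/-- The map induced by `𝒮𝒴(Λ, -)` on cochains, i.e. on graded `Λ`-linear maps. -/
def cochainMap (φ : Cochain Y Z k) :
    Cochain ((singularYoneda E).obj Y) ((singularYoneda E).obj Z) k :=
  Cochain.mk (fun _ _ h => gradedMap (GradedHom.ofCochain E φ) h)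

lemma cochainMap_v (φ : Cochain Y Z k) (h : n + k = m) :
    (cochainMap E φ).v n m h = gradedMap (GradedHom.ofCochain E φ) h := rfl

lemma cochainMap_add (φ ψ : Cochain Y Z k) :
    cochainMap E (φ + ψ) = cochainMap E φ + cochainMap E ψ := by
  ext n m h : 1
  rw [Cochain.add_v, cochainMap_v, cochainMap_v, cochainMap_v, ← gradedMap_add,
    GradedHom.ofCochain_add]

lemma cochainMap_neg (φ : Cochain Y Z k) : cochainMap E (-φ) = - cochainMap E φ := by
  ext n m h : 1
  rw [Cochain.neg_v, cochainMap_v, cochainMap_v, ← gradedMap_neg, GradedHom.ofCochain_neg]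

lemma cochainMap_zero : cochainMap E (0 : Cochain Y Z k) = 0 :=
  (AddMonoidHom.mk' (cochainMap E (Y := Y) (Z := Z) (k := k)) (cochainMap_add E)).map_zero

lemma cochainMap_comp (φ : Cochain X Y a) (ψ : Cochain Y Z b) (h : a + b = c) :
    cochainMap E (φ.comp ψ h) = (cochainMap E φ).comp (cochainMap E ψ) h := by
  ext n m hnm : 1
  rw [Cochain.comp_v _ _ h n (n + a) m rfl (by lia), cochainMap_v, cochainMap_v, cochainMap_v,
    GradedHom.ofCochain_comp, gradedMap_gcomp _ _ h rfl]

lemma cochainMap_ofHom (f : X ⟶ Y) :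
    cochainMap E (Cochain.ofHom f) = Cochain.ofHom ((singularYoneda E).map f) := by
  ext n : 1
  rw [Cochain.ofHom_v, cochainMap_v]
  exact gradedMap_ofHom f n

lemma cochainMap_id :
    cochainMap E (Cochain.ofHom (𝟙 X)) = Cochain.ofHom (𝟙 ((singularYoneda E).obj X)) := by
  rw [cochainMap_ofHom, CategoryTheory.Functor.map_id]

lemma δ_cochainMap (φ : Cochain X Y k) (l : ℤ) :
    δ k l (cochainMap E φ) = cochainMap E (δ k l φ) := by
  by_cases hk : k + 1 = l
  · ext n m h
    rw [δ_v k l hk _ n m h (m - 1) (n + 1) rfl rfl, cochainMap_v, cochainMap_v, cochainMap_v,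
      gradedMap_d _ (fun _ hl => GradedHom.deltaEx_ofCochain _ hl) (show n + k = m - 1 by lia) hk
        rfl (show m - 1 + 1 = m by lia),
      GradedHom.deltaIn_ofCochain]
    have : l.negOnePow = - k.negOnePow := by rw [← hk, Int.negOnePow_succ]
    rw [this, Units.neg_smul, add_neg_cancel_right]
  · rw [δ_shape _ _ hk, δ_shape _ _ hk, cochainMap_zero]

/-- The identity of the underlying graded module of `X`, considered as a cochain `X⟦a⟧ → X` of
degree `a`. -/
def shiftCochain (X : CochainComplex (ModuleCat.{u} Λ) ℤ) (a : ℤ) : Cochain (X⟦a⟧) X a :=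
  Cochain.mk (fun _ _ h => (X.XIsoOfEq h).hom)

/-- The identity of the underlying graded module of `X`, considered as a cochain `X → X⟦a⟧` of
degree `-a`. -/
def unshiftCochain (X : CochainComplex (ModuleCat.{u} Λ) ℤ) (a : ℤ) : Cochain X (X⟦a⟧) (-a) :=
  Cochain.mk (fun p q h => (X.XIsoOfEq (show p = q + a by lia)).hom)

lemma shiftCochain_v (X : CochainComplex (ModuleCat.{u} Λ) ℤ) (h : n + a = m) :
    (shiftCochain X a).v n m h = (X.XIsoOfEq h).hom := rfl

lemma unshiftCochain_v (X : CochainComplex (ModuleCat.{u} Λ) ℤ) (h : n + -a = m)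
    (h' : n = m + a) : (unshiftCochain X a).v n m h = (X.XIsoOfEq h').hom := rfl

lemma shiftCochain_comp_unshiftCochain (X : CochainComplex (ModuleCat.{u} Λ) ℤ) (a : ℤ) :
    (shiftCochain X a).comp (unshiftCochain X a) (add_neg_cancel a) = Cochain.ofHom (𝟙 _) := by
  ext n : 1
  rw [Cochain.comp_v _ _ _ n (n + a) n rfl (by lia), shiftCochain_v, unshiftCochain_v _ _ rfl,
    Cochain.ofHom_v]
  exact HomologicalComplex.XIsoOfEq_hom_comp_XIsoOfEq_hom X _ _

lemma unshiftCochain_comp_shiftCochain (X : CochainComplex (ModuleCat.{u} Λ) ℤ) (a : ℤ) :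
    (unshiftCochain X a).comp (shiftCochain X a) (neg_add_cancel a) = Cochain.ofHom (𝟙 _) := by
  ext n : 1
  rw [Cochain.comp_v _ _ _ n (n + -a) n rfl (by lia), shiftCochain_v,
    unshiftCochain_v _ _ (by lia), Cochain.ofHom_v]
  exact HomologicalComplex.XIsoOfEq_hom_comp_XIsoOfEq_hom X _ _

lemma δ_shiftCochain (X : CochainComplex (ModuleCat.{u} Λ) ℤ) (a b : ℤ) :
    δ a b (shiftCochain X a) = 0 := by
  by_cases h : a + 1 = b
  · ext n m hnm : 1
    rw [δ_v a b h _ n m hnm (m - 1) (n + 1) rfl rfl, shiftCochain_v, shiftCochain_v,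
      Cochain.zero_v]
    have e₁ := HomologicalComplex.XIsoOfEq_hom_comp_d X (show n + a = m - 1 by lia) m
    have e₂ := HomologicalComplex.d_comp_XIsoOfEq_hom X (show n + 1 + a = m by lia) (n + a)
    change (X.XIsoOfEq _).hom ≫ X.d (m - 1) m +
      b.negOnePow • (a.negOnePow • X.d (n + a) (n + 1 + a)) ≫ (X.XIsoOfEq _).hom = 0
    rw [Linear.units_smul_comp, e₁, e₂, ← h, Int.negOnePow_succ, Units.neg_smul, smul_smul,
      Int.units_mul_self, one_smul]
    exact add_neg_cancel (X.d (n + a) m)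
  · exact δ_shape _ _ h _

lemma shiftCochain_naturality (f : X ⟶ Y) (a : ℤ) :
    (Cochain.ofHom (f⟦a⟧')).comp (shiftCochain Y a) (zero_add a) =
      (shiftCochain X a).comp (Cochain.ofHom f) (add_zero a) := by
  ext n m h : 1
  rw [Cochain.zero_cochain_comp_v, Cochain.comp_zero_cochain_v, Cochain.ofHom_v, Cochain.ofHom_v,
    shiftCochain_v, shiftCochain_v]
  exact HomologicalComplex.XIsoOfEq_hom_naturality f h

lemma shiftCochain_zero (X : CochainComplex (ModuleCat.{u} Λ) ℤ) :
    shiftCochain X 0 = Cochain.ofHom ((shiftFunctorZero _ ℤ).hom.app X) := by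
  ext n : 1
  rw [Cochain.ofHom_v, CochainComplex.shiftFunctorZero_hom_app_f, shiftCochain_v]

lemma shiftCochain_add (X : CochainComplex (ModuleCat.{u} Λ) ℤ) (a b : ℤ) :
    shiftCochain X (a + b) = (Cochain.ofHom ((shiftFunctorAdd _ a b).hom.app X)).comp
      ((shiftCochain (X⟦a⟧) b).comp (shiftCochain X a) (add_comm b a)) (zero_add (a + b)) := by
  ext n m h : 1
  rw [Cochain.zero_cochain_comp_v, Cochain.ofHom_v, CochainComplex.shiftFunctorAdd_hom_app_f,
    Cochain.comp_v _ _ _ n (n + b) m rfl (by lia), shiftCochain_v, shiftCochain_v, shiftCochain_v]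
  have e₁ := HomologicalComplex.XIsoOfEq_hom_comp_XIsoOfEq_hom X
    (show n + b + a = n + b + a from rfl) (show n + b + a = m by lia)
  have e₂ := HomologicalComplex.XIsoOfEq_hom_comp_XIsoOfEq_hom X
    (show n + (a + b) = n + b + a by lia) (show n + b + a = m by lia)
  refine Eq.symm (Eq.trans ?_ e₂)
  exact congr_arg ((X.XIsoOfEq (show n + (a + b) = n + b + a by lia)).hom ≫ ·) e₁

lemma cochainMap_v_comp_XIsoOfEq (φ : Cochain Y Z k) (h : n + k = m) (h' : m = l) :
    (cochainMap E φ).v n m h ≫ (((singularYoneda E).obj Z).XIsoOfEq h').hom =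
      (cochainMap E φ).v n l (h.trans h') := by
  subst h'
  exact Category.comp_id _

/-- The isomorphism `𝒮𝒴(Λ, X⟦a⟧) ≅ 𝒮𝒴(Λ, X)⟦a⟧`. -/
def shiftIso (X : CochainComplex (ModuleCat.{u} Λ) ℤ) (a : ℤ) :
    (singularYoneda E).obj (X⟦a⟧) ≅ ((singularYoneda E).obj X)⟦a⟧ :=
  HomologicalComplex.Hom.isoOfComponents
    (fun n =>
      { hom := (cochainMap E (shiftCochain X a)).v n (n + a) rfl
        inv := (cochainMap E (unshiftCochain X a)).v (n + a) n (by lia)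
        hom_inv_id := by
          refine (Cochain.comp_v _ _ (add_neg_cancel a) n (n + a) n rfl (by lia)).symm.trans ?_
          rw [← cochainMap_comp, shiftCochain_comp_unshiftCochain, cochainMap_id, Cochain.ofHom_v]
          rfl
        inv_hom_id := by
          refine (Cochain.comp_v _ _ (neg_add_cancel a) (n + a) n (n + a)
            (by lia) rfl).symm.trans ?_
          rw [← cochainMap_comp, unshiftCochain_comp_shiftCochain, cochainMap_id, Cochain.ofHom_v]
          rfl })
    (fun n m h => by
      change n + 1 = m at h
      have e := Cochain.congr_v ((δ_cochainMap E (shiftCochain X a) (a + 1)).trans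
        ((congr_arg _ (δ_shiftCochain X a _)).trans (cochainMap_zero E))) n (m + a) (by lia)
      rw [δ_v a (a + 1) rfl _ n (m + a) (by lia) (n + a) m (by lia) (by lia), Cochain.zero_v,
        Int.negOnePow_succ, Units.neg_smul, add_neg_eq_zero] at e
      change (cochainMap E (shiftCochain X a)).v n (n + a) rfl ≫
        (a.negOnePow • ((singularYoneda E).obj X).d (n + a) (m + a)) = _
      rw [Linear.comp_units_smul]
      refine (congr_arg _ e).trans ?_
      rw [smul_smul, Int.units_mul_self, one_smul]
      rfl)

instance : (singularYoneda E).CommShift ℤ where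
  commShiftIso a := NatIso.ofComponents (fun X => shiftIso E X a) (fun {X Y} f => by
    ext n : 1
    change ((singularYoneda E).map (f⟦a⟧')).f n ≫
      (cochainMap E (shiftCochain Y a)).v n (n + a) rfl =
      (cochainMap E (shiftCochain X a)).v n (n + a) rfl ≫ ((singularYoneda E).map f).f (n + a)
    rw [← Cochain.ofHom_v, ← Cochain.ofHom_v, ← cochainMap_ofHom, ← cochainMap_ofHom,
      ← Cochain.zero_cochain_comp_v, ← Cochain.comp_zero_cochain_v, ← cochainMap_comp,
      ← cochainMap_comp, shiftCochain_naturality])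
  commShiftIso_zero := by
    ext X n : 4
    rw [Functor.CommShift.isoZero_hom_app]
    change (cochainMap E (shiftCochain X 0)).v n (n + 0) rfl =
      ((singularYoneda E).map ((shiftFunctorZero _ ℤ).hom.app X)).f n ≫
        (((singularYoneda E).obj X).XIsoOfEq (show n = n + 0 by lia)).hom
    rw [← Cochain.ofHom_v, ← cochainMap_ofHom, shiftCochain_zero]
    exact (cochainMap_v_comp_XIsoOfEq E (Z := X) _ (add_zero n) _).symm
  commShiftIso_add a b := by
    ext X n : 4
    rw [Functor.CommShift.isoAdd_hom_app]
    change (cochainMap E (shiftCochain X (a + b))).v n (n + (a + b)) rfl =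
      ((singularYoneda E).map ((shiftFunctorAdd _ a b).hom.app X)).f n ≫
        (cochainMap E (shiftCochain (X⟦a⟧) b)).v n (n + b) rfl ≫
        (cochainMap E (shiftCochain X a)).v (n + b) (n + b + a) rfl ≫
        (((singularYoneda E).obj X).XIsoOfEq (show n + b + a = n + (a + b) by lia)).hom
    rw [cochainMap_v_comp_XIsoOfEq, ← Cochain.ofHom_v, ← cochainMap_ofHom,
      ← Cochain.comp_v _ _ (add_comm b a) _ _ _ _ _, ← cochainMap_comp,
      ← Cochain.zero_cochain_comp_v, ← cochainMap_comp, shiftCochain_add]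

lemma unshift_eq_gcomp (f : GradedHom E X (Y⟦(1 : ℤ)⟧) n) :
    f.unshift = (GradedHom.ofCochain E (shiftCochain Y 1)).gcomp f rfl := by
  ext1 i j hij
  obtain ⟨j, rfl⟩ : ∃ j', j = j' + 1 := ⟨j - 1, by lia⟩
  rw [GradedHom.unshift_v _ _ _ _ (by lia), GradedHom.gcomp_v _ _ _ i j (j + 1) (by lia) rfl]
  rfl

lemma sTensor_shiftCochain (Y : CochainComplex (ModuleCat.{u} Λ) ℤ) :
    (GradedHom.ofCochain E (shiftCochain Y 1)).sTensor =
      (GradedHom.ofCochain E (shiftCochain ((omega E).obj Y) 1)).precomp (omegaShift E Y) := by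
  ext1 i j hij
  obtain rfl : i + 1 = j := hij
  rw [GradedHom.sTensor_v, GradedHom.precomp_v, Int.negOnePow_one, Units.neg_smul, one_smul]
  have e : ∀ g : ((omega E).obj Y).X (i + 1) →ₗ[E] ((omega E).obj Y).X (i + 1),
      -g = g ∘ₗ resE E ((omegaShift E Y).f i) := fun g => by
    ext x
    change - g x = g (-x)
    rw [map_neg]
  refine Eq.trans ?_ (e _)
  refine congr_arg Neg.neg ?_
  exact BarTensor.map_id

/-- The sign `(-1)^p` in `omegaPowShift` is the sign of `(s Λ̄)^{⊗ p} ⊗ -` on maps of degree one. -/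
lemma sPow_shiftCochain (X : CochainComplex (ModuleCat.{u} Λ) ℤ) (p : ℕ) :
    (GradedHom.ofCochain E (shiftCochain X 1)).sPow p =
      (GradedHom.ofCochain E (shiftCochain ((omegaPow E p).obj X) 1)).precomp
        (omegaPowShift E X p) := by
  induction p with
  | zero =>
    ext1 i j hij
    rfl
  | succ p hp =>
    refine (congr_arg GradedHom.sTensor hp).trans ?_
    rw [← GradedHom.gcomp_ofHom, GradedHom.sTensor_gcomp, GradedHom.sTensor_ofHom,
      sTensor_shiftCochain, GradedHom.gcomp_ofHom]
    rfl

/-- The suspension isomorphism of the functor `𝒮𝒴(Λ, -)` is given by `[f; p] ↦ [(-1)^p f; p]`. -/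
lemma singularYoneda_commShiftIso_one (X : CochainComplex (ModuleCat.{u} Λ) ℤ) :
    ((singularYoneda E).commShiftIso (1 : ℤ)).hom.app X = singularYonedaShift E X := by
  ext n : 1
  refine hom_ext_cls (fun p f => ?_)
  refine Eq.trans ?_ (singularYonedaShift_cls p f).symm
  refine (gradedMap_cls _ _ p f).trans (congr_arg (cls p) ?_)
  refine ext (fun q => ?_)
  rw [lcomp_comp, sPow_shiftCochain, YonedaHom.unshift_comp, unshift_eq_gcomp]
  rw [← GradedHom.gcomp_ofHom, ← GradedHom.gcomp_assoc _ _ _ (add_zero n) (zero_add 1) rfl rfl,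
    GradedHom.ofHom_gcomp]
  rfl

end CommShift

/-! ### Compatibility of `𝒮𝒴(Λ, -)` with mapping cones -/

section MappingCone

open CochainComplex

variable {Λ : Type u} [Ring Λ] (E : Subring Λ)
variable {X Y : CochainComplex (ModuleCat.{u} Λ) ℤ} (f : X ⟶ Y)

instance : (singularYoneda E).Additive where
  map_add {X Y f g} := by
    ext n : 1
    rw [HomologicalComplex.add_f_apply, ← gradedMap_ofHom, ← gradedMap_ofHom, ← gradedMap_ofHom,
      ← gradedMap_add, ← GradedHom.ofCochain_add, ← Cochain.ofHom_add]

lemma δ_cochainMap_inl :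
    δ (-1) 0 (cochainMap E (mappingCone.inl f)) =
      Cochain.ofHom ((singularYoneda E).map f ≫ (singularYoneda E).map (mappingCone.inr f)) := by
  rw [δ_cochainMap, mappingCone.δ_inl, cochainMap_ofHom, Functor.map_comp]

/-- The canonical isomorphism between the cone of `𝒮𝒴(Λ, f)` and the image of the cone of `f`. -/
def mappingConeIso :
    mappingCone ((singularYoneda E).map f) ≅ (singularYoneda E).obj (mappingCone f) where
  hom := mappingCone.desc _ (cochainMap E (mappingCone.inl f))
    ((singularYoneda E).map (mappingCone.inr f)) (δ_cochainMap_inl E f)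
  inv := mappingCone.lift _ (Cocycle.mk (cochainMap E (mappingCone.fst f).1) 2 (by lia) (by
      rw [δ_cochainMap, (mappingCone.fst f).δ_eq_zero, cochainMap_zero]))
    (cochainMap E (mappingCone.snd f)) (by
      rw [δ_cochainMap, mappingCone.δ_snd, cochainMap_neg, cochainMap_comp, cochainMap_ofHom]
      exact neg_add_cancel _)
  hom_inv_id := by
    refine (Cocycle.equivHom _ _).injective (Subtype.ext ?_)
    change Cochain.ofHom _ = Cochain.ofHom _
    rw [Cochain.ofHom_comp, mappingCone.ofHom_desc, mappingCone.ofHom_lift,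
      mappingCone.ext_cochain_from_iff _ (-1) 0 (by lia), Cochain.comp_id, Cochain.comp_id,
      ← Cochain.comp_assoc_of_third_is_zero_cochain,
      ← Cochain.comp_assoc_of_third_is_zero_cochain, mappingCone.inl_descCochain,
      mappingCone.inr_descCochain, mappingCone.ext_cochain_to_iff _ (-1) 0 (by lia),
      mappingCone.ext_cochain_to_iff _ 0 1 (by lia),
      Cochain.comp_assoc_of_second_is_zero_cochain, Cochain.comp_assoc_of_second_is_zero_cochain,
      Cochain.comp_assoc_of_second_is_zero_cochain, Cochain.comp_assoc_of_second_is_zero_cochain,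
      mappingCone.liftCochain_fst, mappingCone.liftCochain_snd, Cocycle.mk_coe,
      ← cochainMap_ofHom, ← cochainMap_comp, ← cochainMap_comp, ← cochainMap_comp,
      ← cochainMap_comp, mappingCone.inl_fst, mappingCone.inl_snd, mappingCone.inr_fst,
      mappingCone.inr_snd, mappingCone.inl_fst, mappingCone.inl_snd, mappingCone.inr_fst,
      mappingCone.inr_snd, cochainMap_zero, cochainMap_zero, cochainMap_id, cochainMap_id]
    exact ⟨⟨rfl, rfl⟩, ⟨rfl, rfl⟩⟩
  inv_hom_id := by
    refine (Cocycle.equivHom _ _).injective (Subtype.ext ?_)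
    change Cochain.ofHom _ = Cochain.ofHom _
    rw [Cochain.ofHom_comp, mappingCone.ofHom_desc, mappingCone.ofHom_lift,
      mappingCone.liftCochain_descCochain, Cocycle.mk_coe,
      ← cochainMap_ofHom, ← cochainMap_comp, ← cochainMap_comp, ← cochainMap_add, mappingCone.id,
      cochainMap_id]

lemma ofHom_mappingConeIso_hom_comp_fst :
    (Cochain.ofHom (mappingConeIso E f).hom).comp (cochainMap E (mappingCone.fst f).1)
      (zero_add 1) = (mappingCone.fst ((singularYoneda E).map f)).1 := by
  have e : Cochain.ofHom (mappingConeIso E f).hom =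
      mappingCone.descCochain _ (cochainMap E (mappingCone.inl f))
        (Cochain.ofHom ((singularYoneda E).map (mappingCone.inr f))) (neg_add_cancel 1) :=
    mappingCone.ofHom_desc _ _ _ (δ_cochainMap_inl E f)
  rw [e, mappingCone.ext_cochain_from_iff _ 0 1 (by lia),
    ← Cochain.comp_assoc_of_second_is_zero_cochain,
    ← Cochain.comp_assoc_of_second_is_zero_cochain, mappingCone.inl_descCochain,
    mappingCone.inr_descCochain, ← cochainMap_ofHom, ← cochainMap_comp, ← cochainMap_comp,
    mappingCone.inl_fst, mappingCone.inl_fst, mappingCone.inr_fst, mappingCone.inr_fst,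
    cochainMap_zero, cochainMap_id]
  exact ⟨rfl, rfl⟩

/-- The connecting morphism of the standard triangle attached to a morphism of complexes. -/
def connecting : mappingCone f ⟶ X⟦(1 : ℤ)⟧ := (mappingCone.triangle f).mor₃

lemma connecting_comp_shiftCochain :
    (Cochain.ofHom (connecting f)).comp (shiftCochain X 1) (zero_add 1) =
      -(mappingCone.fst f).1 := by
  ext n m h : 1
  obtain rfl : n + 1 = m := h
  rw [Cochain.zero_cochain_comp_v, Cochain.ofHom_v, shiftCochain_v]
  refine (Category.comp_id _).trans ?_
  refine (Cochain.rightShift_v (-(mappingCone.fst f).1) 1 0 (zero_add 1) n n (add_zero n) (n + 1)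
    rfl).trans ?_
  exact Category.comp_id _

lemma shiftIso_comp_shiftCochain (X : CochainComplex (ModuleCat.{u} Λ) ℤ) (a : ℤ) :
    (Cochain.ofHom (shiftIso E X a).hom).comp (shiftCochain ((singularYoneda E).obj X) a)
      (zero_add a) = cochainMap E (shiftCochain X a) := by
  ext n m h : 1
  obtain rfl : n + a = m := h
  rw [Cochain.zero_cochain_comp_v, Cochain.ofHom_v, shiftCochain_v]
  exact Category.comp_id _

/-- A morphism to `L⟦a⟧` is determined by the cochain of degree `a` to `L` that it induces. -/
lemma hom_ext_shiftCochain {K L : CochainComplex (ModuleCat.{u} Λ) ℤ} {a : ℤ} {g₁ g₂ : K ⟶ L⟦a⟧}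
    (h : (Cochain.ofHom g₁).comp (shiftCochain L a) (zero_add a) =
      (Cochain.ofHom g₂).comp (shiftCochain L a) (zero_add a)) : g₁ = g₂ := by
  ext n : 1
  have := Cochain.congr_v h n (n + a) rfl
  rw [Cochain.zero_cochain_comp_v, Cochain.zero_cochain_comp_v, Cochain.ofHom_v, Cochain.ofHom_v,
    shiftCochain_v] at this
  exact (Category.comp_id _).symm.trans (this.trans (Category.comp_id _))

/-- The functor `𝒮𝒴(Λ, -)` sends the standard triangle of `f` to the standard triangle
of `𝒮𝒴(Λ, f)`. -/
def mapTriangleIso :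
    (singularYoneda E).mapTriangle.obj (mappingCone.triangle f) ≅
      mappingCone.triangle ((singularYoneda E).map f) := by
  refine (Triangle.isoMk (mappingCone.triangle ((singularYoneda E).map f))
    ((singularYoneda E).mapTriangle.obj (mappingCone.triangle f))
    (Iso.refl _) (Iso.refl _) (mappingConeIso E f) ?_ ?_ ?_).symm
  · exact (Category.comp_id _).trans (Category.id_comp _).symm
  · refine Eq.trans ?_ (Category.id_comp _).symm
    exact mappingCone.inr_desc ((singularYoneda E).map f) _ _ (δ_cochainMap_inl E f)
  · refine Eq.trans
      ((congr_arg _ (CategoryTheory.Functor.map_id _ _)).trans (Category.comp_id _)) ?_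
    change connecting ((singularYoneda E).map f) = (mappingConeIso E f).hom ≫
      (singularYoneda E).map (connecting f) ≫ (shiftIso E X 1).hom
    refine hom_ext_shiftCochain ?_
    rw [Cochain.ofHom_comp, Cochain.ofHom_comp, Cochain.comp_assoc_of_first_is_zero_cochain,
      Cochain.comp_assoc_of_first_is_zero_cochain, shiftIso_comp_shiftCochain, ← cochainMap_ofHom,
      ← cochainMap_comp, connecting_comp_shiftCochain, connecting_comp_shiftCochain,
      cochainMap_neg, Cochain.comp_neg, ofHom_mappingConeIso_hom_comp_fst]

end MappingCone

/-! ### The induced functor on the derived category -/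

section Derived

open CochainComplex

variable {Λ : Type u} [Ring Λ] (E : Subring Λ)

/-- The functor `𝒮𝒴(Λ, -)` with values in the homotopy category. -/
abbrev singularYonedaHomotopy :
    CochainComplex (ModuleCat.{u} Λ) ℤ ⥤ HomotopyCategory (ModuleCat.{u} Λ) (ComplexShape.up ℤ) :=
  singularYoneda E ⋙ HomotopyCategory.quotient _ _

/-- The functor `𝒮𝒴(Λ, -)` sends the standard triangles to distinguished triangles. -/
lemma mapTriangle_triangle_distinguished {X Y : CochainComplex (ModuleCat.{u} Λ) ℤ} (f : X ⟶ Y) :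
    (singularYonedaHomotopy E).mapTriangle.obj (mappingCone.triangle f) ∈
      distTriang (HomotopyCategory (ModuleCat.{u} Λ) (ComplexShape.up ℤ)) :=
  isomorphic_distinguished _
    (HomotopyCategory.mappingCone_triangleh_distinguished ((singularYoneda E).map f)) _
    ((Functor.mapTriangleCompIso (singularYoneda E) (HomotopyCategory.quotient _ _)).app _ ≪≫
      (HomotopyCategory.quotient _ _).mapTriangle.mapIso (mapTriangleIso E f))

/-- The functor `𝒮𝒴(Λ, -)` sends quasi-isomorphisms to homotopy equivalences, as it sends their
acyclic cones to contractible complexes. -/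
lemma isIso_map_of_quasiIso [IsSemisimpleRing E] {X Y : CochainComplex (ModuleCat.{u} Λ) ℤ}
    (f : X ⟶ Y) [QuasiIso f] :
    IsIso ((singularYonedaHomotopy E).map f) := by
  refine (Triangle.isZero₃_iff_isIso₁ _ (mapTriangle_triangle_distinguished E f)).1 ?_
  have hf : (mappingCone f).Acyclic := by
    rw [← HomotopyCategory.quotient_obj_mem_subcategoryAcyclic_iff_acyclic]
    refine ((HomotopyCategory.subcategoryAcyclic _).trW_iff_of_distinguished _
      (HomotopyCategory.mappingCone_triangleh_distinguished f)).1 ?_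
    rw [← HomotopyCategory.quasiIso_eq_trW_subcategoryAcyclic]
    exact (HomotopyCategory.quotient_map_mem_quasiIso_iff f).2 (inferInstanceAs (QuasiIso f))
  exact (HomotopyCategory.isZero_quotient_obj_iff _).2 (nonempty_homotopy_of_acyclic hf)

variable [IsNoetherianRing Λ] [IsSemisimpleRing E]

/-- The functor `𝒮𝒴(Λ, -)` with values in the homotopy category of acyclic complexes of injective
modules. -/
abbrev singularYonedaLift :
    CochainComplex (ModuleCat.{u} Λ) ℤ ⥤ (acyclicInjectives Λ).FullSubcategory :=
  (acyclicInjectives Λ).lift (singularYonedaHomotopy E) (fun X =>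
    ⟨(HomotopyCategory.quotient_obj_mem_subcategoryAcyclic_iff_acyclic _).2
      (singularYoneda_acyclic X),
      injectiveTerms_quotient Λ _ (injective_singularYoneda_X X)⟩)

lemma singularYonedaLift_isInvertedBy :
    (HomologicalComplex.quasiIso (ModuleCat.{u} Λ) (ComplexShape.up ℤ)).IsInvertedBy
      (singularYonedaLift E) := fun X Y f hf => by
  have : QuasiIso f := hf
  have : IsIso ((acyclicInjectives Λ).ι.map ((singularYonedaLift E).map f)) :=
    isIso_map_of_quasiIso E f
  exact isIso_of_reflects_iso _ (acyclicInjectives Λ).ι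

variable [HasDerivedCategory.{w} (ModuleCat.{u} Λ)]

/-- The functor `𝐃(Λ-Mod) ⥤ 𝐊_ac(Λ-Inj)` induced by `𝒮𝒴(Λ, -)`. -/
def derivedSingularYoneda :
    DerivedCategory (ModuleCat.{u} Λ) ⥤ (acyclicInjectives Λ).FullSubcategory :=
  Localization.lift (singularYonedaLift E) (singularYonedaLift_isInvertedBy E) DerivedCategory.Q

instance : Localization.Lifting DerivedCategory.Q
    (HomologicalComplex.quasiIso (ModuleCat.{u} Λ) (ComplexShape.up ℤ))
    (singularYonedaLift E) (derivedSingularYoneda E) :=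
  inferInstanceAs (Localization.Lifting _ _ _ (Localization.lift _ _ _))

instance : (derivedSingularYoneda E).CommShift ℤ :=
  Functor.commShiftOfLocalization DerivedCategory.Q
    (HomologicalComplex.quasiIso (ModuleCat.{u} Λ) (ComplexShape.up ℤ)) ℤ
    (singularYonedaLift E) (derivedSingularYoneda E)

/-- The isomorphism expressing that `derivedSingularYoneda E` is induced by `𝒮𝒴(Λ, -)`. -/
def derivedSingularYonedaFac :
    DerivedCategory.Q ⋙ derivedSingularYoneda E ≅ singularYonedaLift E :=
  Localization.Lifting.iso DerivedCategory.Q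
    (HomologicalComplex.quasiIso (ModuleCat.{u} Λ) (ComplexShape.up ℤ)) _ _

instance : NatTrans.CommShift (derivedSingularYonedaFac E).hom ℤ :=
  NatTrans.commShift_iso_hom_of_localization DerivedCategory.Q
    (HomologicalComplex.quasiIso (ModuleCat.{u} Λ) (ComplexShape.up ℤ)) ℤ
    (singularYonedaLift E) (derivedSingularYoneda E)

/-- The comparison isomorphism between `derivedSingularYoneda E` and `𝒮𝒴(Λ, -)`, in the homotopy
category of complexes. -/
def derivedSingularYonedaIso :
    (DerivedCategory.Q ⋙ derivedSingularYoneda E) ⋙ (acyclicInjectives Λ).ι ≅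
      singularYonedaHomotopy E :=
  Functor.isoWhiskerRight (derivedSingularYonedaFac E) _ ≪≫ (acyclicInjectives Λ).liftCompιIso _ _

instance : NatTrans.CommShift (derivedSingularYonedaIso E).hom ℤ := by
  dsimp [derivedSingularYonedaIso]
  infer_instance

instance : (derivedSingularYoneda E).IsTriangulated where
  map_distinguished T hT := by
    obtain ⟨X, Y, f, ⟨e⟩⟩ := (DerivedCategory.mem_distTriang_iff T).1 hT
    change (acyclicInjectives Λ).ι.mapTriangle.obj ((derivedSingularYoneda E).mapTriangle.obj T) ∈
      distTriang _
    refine isomorphic_distinguished _ (mapTriangle_triangle_distinguished E f) _ ?_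
    exact (acyclicInjectives Λ).ι.mapTriangle.mapIso
        ((derivedSingularYoneda E).mapTriangle.mapIso e ≪≫
          (Functor.mapTriangleCompIso DerivedCategory.Q (derivedSingularYoneda E)).symm.app _) ≪≫
      (Functor.mapTriangleCompIso (DerivedCategory.Q ⋙ derivedSingularYoneda E)
        (acyclicInjectives Λ).ι).symm.app _ ≪≫
      (Functor.mapTriangleIso (derivedSingularYonedaIso E)).app _

end Derived

end

end SingularYoneda

theorem mainTheorem2 {Λ : Type u} [Ring Λ] [IsNoetherianRing Λ] (E : Subring Λ)
    [IsSemisimpleRing E] [HasDerivedCategory.{w} (ModuleCat.{u} Λ)] :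
    (∀ X : CochainComplex (ModuleCat.{u} Λ) ℤ,
      ((singularYoneda E).obj X).Acyclic ∧
        ∀ n : ℤ, Injective (((singularYoneda E).obj X).X n)) ∧
    (∀ X : CochainComplex (ModuleCat.{u} Λ) ℤ, X.Acyclic →
      Nonempty (Homotopy (𝟙 ((singularYoneda E).obj X)) 0)) ∧
    ∃ (F : DerivedCategory (ModuleCat.{u} Λ) ⥤ (acyclicInjectives Λ).FullSubcategory)
      (_ : F.CommShift ℤ)
      (e : DerivedCategory.Q ⋙ F ⋙ (acyclicInjectives Λ).ι ≅
        singularYoneda E ⋙ HomotopyCategory.quotient (ModuleCat.{u} Λ) (ComplexShape.up ℤ)),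
      F.IsTriangulated ∧
      ∀ X : CochainComplex (ModuleCat.{u} Λ) ℤ,
        ((DerivedCategory.Q ⋙ F ⋙ (acyclicInjectives Λ).ι).commShiftIso (1 : ℤ)).hom.app X ≫
            (e.hom.app X)⟦(1 : ℤ)⟧' =
          e.hom.app (X⟦(1 : ℤ)⟧) ≫
            (HomotopyCategory.quotient (ModuleCat.{u} Λ) (ComplexShape.up ℤ)).map
              (singularYonedaShift E X) ≫
            ((HomotopyCategory.quotient (ModuleCat.{u} Λ)
              (ComplexShape.up ℤ)).commShiftIso (1 : ℤ)).hom.app ((singularYoneda E).obj X) := by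
  refine ⟨fun X => ⟨singularYoneda_acyclic X, injective_singularYoneda_X X⟩,
    fun X hX => nonempty_homotopy_of_acyclic hX,
    derivedSingularYoneda E, inferInstance,
    (Functor.associator _ _ _).symm ≪≫ derivedSingularYonedaIso E, inferInstance, fun X => ?_⟩
  rw [← singularYoneda_commShiftIso_one]
  have : NatTrans.CommShift ((Functor.associator DerivedCategory.Q (derivedSingularYoneda E)
      (acyclicInjectives Λ).ι).inv ≫ (derivedSingularYonedaIso E).hom) ℤ := inferInstance
  refine (NatTrans.shift_app_comm ((Functor.associator DerivedCategory.Q (derivedSingularYoneda E)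
    (acyclicInjectives Λ).ι).inv ≫ (derivedSingularYonedaIso E).hom) (1 : ℤ) X).trans ?_
  rw [Functor.commShiftIso_comp_hom_app]
  rfl
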